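/- **Definitions.** All graphs are finite, simple, undirected and unweighted. For a graph $G=(V,E)$ and $r\ge 1$, a set $K\subseteq V$ is an *$r$-center* of $G$ if every $u\in V\setminus K$ has $d_G(v,u)\le r$ for some $v\in K$, where $d_G$ is the shortest-path distance ($\infty$ between different components). A *$(k,r)$-center* is an $r$-center $K$ with $|K|\le k$. A *clique-width expression* with $\mathrm{cw}$ labels is a rooted binary tree built from the operations: introduce $i(l)$ (a single vertex with label $l$), join $\eta(a,b)$ (add all possible edges between distinct vertices, one with label $a$ and one with label $b$), rename $\rho(a,b)$ (change label $a$ to $b$), and disjoint union, where $l,a,b$ range over the $\mathrm{cw}$ labels. It is an expression *for* $G$ if the graph that it constructs is isomorphic to $G$. The model of computation is the random access machine with integer registers, direct and indirect addressing, addition, subtraction, multiplication and integer division, and logarithmic cost (every instruction is charged 1 plus the binary lengths of the register addresses and contents that it touches). The input is the sequence $k,r,\mathrm{cw}$ followed by the preorder listing of the expression; $L$ denotes its total binary length. $O^*$ omits factors polynomial in the input length $L$. **Theorem.** The counting version of $(k,r)$-Center can be solved in $O^*((3r+1)^{\mathrm{cw}})$ time when a clique-width expression is given. Precisely: there are a random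 access machine program and a polynomial $P$ such that, for all integers $k,r\ge 1$, every graph $G$ and every clique-width expression $T$ with $\mathrm{cw}$ labels for $G$, the program, given $k$, $r$ and $T$, outputs the number of $(k,r)$-centers of $G$, that is, the number of $r$-centers $K$ with $|K|\le k$, in time at most $P(L)\cdot(3r+1)^{\mathrm{cw}}$. Likewise, there are a program and a polynomial with the same property for the number of $r$-centers $K$ with $|K|=k$. -/

import Mathlib

/-! ### Clique-width expressions -/

/-- Clique-width expressions over the label set `Fin cw`: rooted binary trees whose leaves introduce
a labelled vertex and whose inner nodes are joins, renames and disjoint unions. -/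
inductive CWExpr (cw : ℕ) : Type
  | intro (l : Fin cw) : CWExpr cw
  | join (a b : Fin cw) (e : CWExpr cw) : CWExpr cw
  | rename (a b : Fin cw) (e : CWExpr cw) : CWExpr cw
  | union (e₁ e₂ : CWExpr cw) : CWExpr cw

namespace CWExpr

variable {cw : ℕ}

/-- The vertices of the graph constructed by an expression: one for each leaf. -/
def Vert : CWExpr cw → Type
  | intro _ => Unit
  | join _ _ e => e.Vert
  | rename _ _ e => e.Vert
  | union e₁ e₂ => e₁.Vert ⊕ e₂.Vert

/-- The label of a vertex at the root of the expression. -/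
def label : (e : CWExpr cw) → e.Vert → Fin cw
  | intro l, _ => l
  | join _ _ e, v => e.label v
  | rename a b e, v => if e.label v = a then b else e.label v
  | union e₁ _, Sum.inl v => e₁.label v
  | union _ e₂, Sum.inr v => e₂.label v

/-- The graph constructed by an expression. A join adds all possible edges (between distinct
vertices) between label `a` and label `b`. -/
def graph : (e : CWExpr cw) → SimpleGraph e.Vert
  | intro _ => (⊥ : SimpleGraph Unit)
  | join a b e => e.graph ⊔ SimpleGraph.fromRel (fun u v => e.label u = a ∧ e.label v = b)
  | rename _ _ e => e.graph
  | union e₁ e₂ => e₁.graph ⊕g e₂.graph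

/-- `e` is a clique-width expression for `G`: it constructs a graph isomorphic to `G`. -/
def IsExprFor {V : Type*} (e : CWExpr cw) (G : SimpleGraph V) : Prop :=
  Nonempty (e.graph ≃g G)

/-- Preorder listing of an expression: each node is written as a tag followed by its labels. -/
def encode : CWExpr cw → List ℕ
  | intro l => [0, l]
  | join a b e => 1 :: (a : ℕ) :: (b : ℕ) :: e.encode
  | rename a b e => 2 :: (a : ℕ) :: (b : ℕ) :: e.encode
  | union e₁ e₂ => 3 :: (e₁.encode ++ e₂.encode)

end CWExpr

/-! ### Centers -/

/-- Every vertex outside `K` is at (shortest-path) distance at most `r` from some vertex of `K`;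
unreachable vertices are at distance `⊤`. -/
def IsDistCenter {V : Type*} (G : SimpleGraph V) (r : ℕ) (K : Finset V) : Prop :=
  ∀ u ∉ K, ∃ v ∈ K, G.edist v u ≤ (r : ℕ∞)

/-- The number of `(k,r)`-centers: sets of at most `k` vertices. -/
noncomputable def numCenters {V : Type*} (G : SimpleGraph V) (k r : ℕ) : ℕ :=
  Set.ncard {K : Finset V | K.card ≤ k ∧ IsDistCenter G r K}

/-- The number of `(k,r)`-centers that consist of exactly `k` vertices. -/
noncomputable def numExactCenters {V : Type*} (G : SimpleGraph V) (k r : ℕ) : ℕ :=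
  Set.ncard {K : Finset V | K.card = k ∧ IsDistCenter G r K}

/-! ### Random access machines with logarithmic cost

The memory consists of integer registers indexed by `ℕ`, with direct and indirect addressing, a
one-way input tape and a one-way output tape. Programs are structured (sequences, conditionals and
loops); such a program is a particular goto program. Every instruction and every test is charged `1`
plus the binary lengths of all register addresses and all register contents it touches. -/

namespace RAM

/-- Logarithmic size of an integer. -/
def len (z : ℤ) : ℕ := Nat.size z.natAbs + 1

structure State where
  mem : ℕ → ℤ
  inp : List ℤ
  out : List ℤ

/-- A constant, the content of register `a`, or the content of the register whose address is the
content of register `a`. -/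
inductive Operand : Type
  | const (z : ℤ)
  | reg (a : ℕ)
  | ind (a : ℕ)

/-- Negative contents used as an address are read as address `0`. -/
def Operand.val (s : State) : Operand → ℤ
  | const z => z
  | reg a => s.mem a
  | ind a => s.mem (s.mem a).toNat

def Operand.cost (s : State) : Operand → ℕ
  | const z => len z
  | reg a => len a + len (s.mem a)
  | ind a => len a + len (s.mem a) + len (s.mem (s.mem a).toNat)

/-- Where a result is stored: in register `a`, or in the register whose address is the content of
register `a`. -/
inductive Dest : Type
  | reg (a : ℕ)
  | ind (a : ℕ)

def Dest.addr (s : State) : Dest → ℕ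
  | reg a => a
  | ind a => (s.mem a).toNat

def Dest.cost (s : State) : Dest → ℕ
  | reg a => len a
  | ind a => len a + len (s.mem a)

/-- Store `z` at `d`. -/
def State.store (s : State) (d : Dest) (z : ℤ) : State :=
  { s with mem := Function.update s.mem (d.addr s) z }

inductive ArithOp : Type
  | add | sub | mul | div

/-- `div` is integer division with remainder (and `0` if the divisor is `0`). -/
def ArithOp.eval : ArithOp → ℤ → ℤ → ℤ
  | add, x, y => x + y
  | sub, x, y => x - y
  | mul, x, y => x * y
  | div, x, y => x / y

inductive Test : Type
  | le (x y : Operand)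
  | eq (x y : Operand)

def Test.holds (s : State) : Test → Prop
  | le x y => x.val s ≤ y.val s
  | eq x y => x.val s = y.val s

def Test.cost (s : State) : Test → ℕ
  | le x y => 1 + x.cost s + y.cost s
  | eq x y => 1 + x.cost s + y.cost s

inductive Prog : Type
  | move (d : Dest) (x : Operand)
  | arith (o : ArithOp) (d : Dest) (x y : Operand)
  | read (d : Dest)
  | write (x : Operand)
  | seq (p q : Prog)
  | ite (c : Test) (p q : Prog)
  | loop (c : Test) (p : Prog)

/-- `Runs p s t s'`: started in state `s`, the program `p` terminates in state `s'` at total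
cost `t`. Reading past the end of the input yields `0`. -/
inductive Runs : Prog → State → ℕ → State → Prop
  | move (d : Dest) (x : Operand) (s : State) :
      Runs (Prog.move d x) s (1 + x.cost s + d.cost s + len (x.val s)) (s.store d (x.val s))
  | arith (o : ArithOp) (d : Dest) (x y : Operand) (s : State) :
      Runs (Prog.arith o d x y) s
        (1 + x.cost s + y.cost s + d.cost s + len (o.eval (x.val s) (y.val s)))
        (s.store d (o.eval (x.val s) (y.val s)))
  | read (d : Dest) (s : State) :
      Runs (Prog.read d) s (1 + d.cost s + len (s.inp.headD 0))
        { s.store d (s.inp.headD 0) with inp := s.inp.tail }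
  | write (x : Operand) (s : State) :
      Runs (Prog.write x) s (1 + x.cost s) { s with out := s.out ++ [x.val s] }
  | seq {p q : Prog} {s s₁ s₂ : State} {t₁ t₂ : ℕ} (hp : Runs p s t₁ s₁) (hq : Runs q s₁ t₂ s₂) :
      Runs (Prog.seq p q) s (t₁ + t₂) s₂
  | ite_true {c : Test} {p q : Prog} {s s' : State} {t : ℕ} (hc : c.holds s)
      (hp : Runs p s t s') : Runs (Prog.ite c p q) s (c.cost s + t) s'
  | ite_false {c : Test} {p q : Prog} {s s' : State} {t : ℕ} (hc : ¬ c.holds s)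
      (hq : Runs q s t s') : Runs (Prog.ite c p q) s (c.cost s + t) s'
  | loop_true {c : Test} {p : Prog} {s s₁ s₂ : State} {t₁ t₂ : ℕ} (hc : c.holds s)
      (hp : Runs p s t₁ s₁) (hl : Runs (Prog.loop c p) s₁ t₂ s₂) :
      Runs (Prog.loop c p) s (c.cost s + t₁ + t₂) s₂
  | loop_false {c : Test} {p : Prog} {s : State} (hc : ¬ c.holds s) :
      Runs (Prog.loop c p) s (c.cost s) s

/-- The initial state: the input is on the input tape, all registers hold `0`, no output. -/
def initState (input : List ℕ) : State where
  mem := fun _ => 0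
  inp := input.map (fun n => (n : ℤ))
  out := []

/-- On the given input, `p` terminates at cost at most `bound`, and what it has written to the
output tape is `output`. -/
def Prog.OutputsWithin (p : Prog) (input output : List ℕ) (bound : ℕ) : Prop :=
  ∃ (t : ℕ) (s : State), Runs p (initState input) t s ∧ t ≤ bound ∧
    s.out = output.map (fun n => (n : ℤ))

/-- The binary length of an input. -/
def inputSize (input : List ℕ) : ℕ := (input.map (fun n => len (n : ℤ))).sum

end RAM

/-- The input of the algorithm: the numbers `k`, `r` and `cw` and a clique-width expression. The
graph itself is given by the expression only. -/
def centerInput {cw : ℕ} (k r : ℕ) (T : CWExpr cw) : List ℕ :=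
  k :: r :: cw :: T.encode

/-! ### Distance labellings -/

/-! An `r`-center `K` is determined by the function `d = dist(·, K)`. The functions that arise in
this way are the labellings with values at most `r` in which adjacent values differ by at most 1 and
every positive value has a neighbour with value one smaller. So centers can be counted by counting
labellings subject to local conditions (`sum_isDistLabelling`). Giving every zero the weight `X`
turns the total into the generating polynomial of the centers by size, evaluated at `X`. For `X =
2^(n+1)`, with `n` vertices, every coefficient is below `X`, so the coefficients are the base-`X`
digits of the total (`sum_mul_pow_div_mod`).

The labellings are counted by dynamic programming over the expression. All vertices of one label
class get the same neighbours from later joins, up to the vertex itself. If `s` is the least value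
among those neighbours, the values in the class must lie between `s - 1` and `s + 1`, and exactly
the value `s + 1` obtains a predecessor from them. A context `(m, M)` for each label records this
promise: values lie in `[m, M]`, and only `M` is exempt from having a predecessor already (`Good`).
Contexts speak about the future and are the same for both sides of a union, so counts simply
multiply (`count_union`). At a join of two classes with minima `s` and `s'`, each context is
intersected with the window given by the other minimum (`good_join`). The minima need not be stored:
"the minimum is `s`" is "all values are at least `s`" minus "all values are at least `s + 1`", and
lower bounds are part of the contexts (`good_update_max`). Hence a table entry of a join is a signed
sum of `O(r^2)` entries of its child (`count_join`).

A class that still gets neighbours has a window with `M - 2 ≤ m ≤ M`, `1 ≤ M ≤ r + 1` and `m ≤ r`,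
since other windows contribute nothing (`count_eq_zero`). There are `3r + 1` of these, numbered by
`2M + m - 2` (`digitCtx_eq`, `joinCtx_ctx`, `code_lt`). A class without further neighbours has the
single context `(0, r + 1)`, whose exemption is void. Which classes are of which kind is computed
from the root downwards (`nodes`), so each node has `(3r+1)^c` table entries.

The numbers `r` and `cw` are given in binary and may be exponential in the input length. The radius
is therefore capped by the number of vertices (`isDistCenter_min_card`), and the labels are replaced
by their positions in a dictionary of the labels that are mentioned (`ParseState.parsed`). Then all
stored numbers have polynomial length. The program is written in a small language of expressions
with bounded sums, loop-free statements and loops that set one array entry per round. Simulation and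
cost are proved once for the language (`Ex.exists_hasCost`, `Stmt.exists_tri`, `exists_tri_fill`).
Only the table loop has exponentially many rounds, and each of its rounds takes polynomial time. -/

/-- `v` has label `0` or a neighbour whose label is one smaller. -/
def HasPred {V : Type*} (G : SimpleGraph V) (d : V → ℕ) (v : V) : Prop :=
  d v = 0 ∨ ∃ u, G.Adj v u ∧ d u + 1 = d v

/-! ### Partial distance labellings and the recurrences for their number -/

namespace CWExpr

variable {cw : ℕ}

instance fintypeVert : (e : CWExpr cw) → Fintype e.Vert
  | intro _ => inferInstanceAs (Fintype Unit)
  | join _ _ e => fintypeVert e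
  | rename _ _ e => fintypeVert e
  | union e₁ e₂ => @instFintypeSum _ _ (fintypeVert e₁) (fintypeVert e₂)

/-- `d` is a partial distance labelling: `σ l = (m, M)` prescribes that the vertices with label `l`
have values between `m` and `M`, and that only the value `M` may rely on a later neighbour. -/
def Good (e : CWExpr cw) (σ : Fin cw → ℕ × ℕ) (d : e.Vert → ℕ) : Prop :=
  (∀ u v, e.graph.Adj u v → d u ≤ d v + 1) ∧
    ∀ v, (σ (e.label v)).1 ≤ d v ∧ d v ≤ (σ (e.label v)).2 ∧
      (HasPred e.graph d v ∨ d v = (σ (e.label v)).2)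

open Classical in
/-- The weighted number of partial distance labellings with values at most `r`; every vertex with
value `0` contributes a factor `X`. -/
noncomputable def count (r X : ℕ) (e : CWExpr cw) (σ : Fin cw → ℕ × ℕ) : ℕ :=
  ∑ d : e.Vert → Fin (r + 1), if e.Good σ (fun v => (d v : ℕ)) then
    ∏ v, (if (d v : ℕ) = 0 then X else 1) else 0

/-- Edges do not change; below the rename, the vertices labelled `a` have to meet the context of
`b`. -/
theorem count_rename (r X : ℕ) (a b : Fin cw) (e : CWExpr cw) (σ : Fin cw → ℕ × ℕ) :
    count r X (rename a b e) σ = count r X e (Function.update σ a (σ b)) := by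
  have h : ∀ d : e.Vert → ℕ, Good (rename a b e) σ d ↔ Good e (Function.update σ a (σ b)) d := by
    intro d
    have : ∀ v : e.Vert, σ (label (rename a b e) v) = Function.update σ a (σ b) (e.label v) := by
      intro v
      change σ (if e.label v = a then b else e.label v) = _
      rw [Function.update_apply]
      split_ifs <;> rfl
    constructor
    · rintro ⟨h1, h2⟩
      refine ⟨h1, fun v => ?_⟩
      rw [← this]; exact h2 v
    · rintro ⟨h1, h2⟩
      refine ⟨h1, fun v => ?_⟩
      exact (this v).symm ▸ h2 v
  classical
  unfold count
  refine Finset.sum_congr rfl fun d _ => ?_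
  exact if_congr (h _) rfl rfl

/-- A vertex without neighbours has value `0`, with weight `X`, or the exempt upper bound. The
hypothesis that this bound is positive keeps the two cases apart. -/
theorem count_intro (r X : ℕ) (l : Fin cw) (σ : Fin cw → ℕ × ℕ) (h : 1 ≤ (σ l).2) :
    count r X (intro l) σ =
      (if (σ l).1 = 0 then X else 0) + (if (σ l).1 ≤ (σ l).2 ∧ (σ l).2 ≤ r then 1 else 0) := by
  classical
  have hg : ∀ d : Unit → ℕ, Good (intro l) σ d ↔
      (σ l).1 ≤ d () ∧ d () ≤ (σ l).2 ∧ (d () = 0 ∨ d () = (σ l).2) := by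
    intro d
    constructor
    · rintro ⟨-, h2⟩
      obtain ⟨h3, h4, h5⟩ := h2 ()
      refine ⟨h3, h4, ?_⟩
      rcases h5 with (h5 | ⟨u, hu, -⟩) | h5
      · exact Or.inl h5
      · exact absurd hu (by intro h; exact h)
      · exact Or.inr h5
    · rintro ⟨h3, h4, h5⟩
      refine ⟨fun u v h => absurd h (by intro h; exact h), fun v => ⟨h3, h4, ?_⟩⟩
      rcases h5 with h5 | h5
      · exact Or.inl (Or.inl h5)
      · exact Or.inr h5
  have h1 : count r X (intro l) σ = ∑ x : Fin (r + 1),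
      if (σ l).1 ≤ x ∧ (x : ℕ) ≤ (σ l).2 ∧ ((x : ℕ) = 0 ∨ (x : ℕ) = (σ l).2)
        then (if (x : ℕ) = 0 then X else 1) else 0 := by
    unfold count
    refine @Fintype.sum_equiv _ _ _ _ _ _ (show ((intro l).Vert → Fin (r + 1)) ≃ Fin (r + 1) from
      Equiv.funUnique Unit (Fin (r + 1))) _ _ fun d => ?_
    refine if_congr (hg _) ?_ rfl
    exact Fintype.prod_unique (ι := Unit) _
  rw [h1, Fin.sum_univ_eq_sum_range (fun x => if (σ l).1 ≤ x ∧ (x : ℕ) ≤ (σ l).2 ∧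
    ((x : ℕ) = 0 ∨ (x : ℕ) = (σ l).2) then (if (x : ℕ) = 0 then X else 1) else 0)]
  have h2 : ∀ x, (if (σ l).1 ≤ x ∧ (x : ℕ) ≤ (σ l).2 ∧ ((x : ℕ) = 0 ∨ (x : ℕ) = (σ l).2)
      then (if (x : ℕ) = 0 then X else 1) else 0) =
      (if x = 0 then (if (σ l).1 = 0 then X else 0) else 0) +
      (if x = (σ l).2 then (if (σ l).1 ≤ (σ l).2 then 1 else 0) else 0) := by
    intro x
    split_ifs <;> omega
  simp only [h2, Finset.sum_add_distrib, Finset.sum_ite_eq', Finset.mem_range]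
  have : (σ l).2 < r + 1 ↔ (σ l).2 ≤ r := by omega
  simp only [this]
  split_ifs <;> simp_all

theorem good_union (e₁ e₂ : CWExpr cw) (σ : Fin cw → ℕ × ℕ) (d₁ : e₁.Vert → ℕ) (d₂ : e₂.Vert → ℕ) :
    Good (union e₁ e₂) σ (Sum.elim d₁ d₂) ↔ Good e₁ σ d₁ ∧ Good e₂ σ d₂ := by
  constructor
  · rintro ⟨h1, h2⟩
    refine ⟨⟨fun u v h => h1 (Sum.inl u) (Sum.inl v) (by simpa [graph] using h), fun v => ?_⟩,
      ⟨fun u v h => h1 (Sum.inr u) (Sum.inr v) (by simpa [graph] using h), fun v => ?_⟩⟩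
    · obtain ⟨h3, h4, h5⟩ := h2 (Sum.inl v)
      refine ⟨h3, h4, h5.imp_left ?_⟩
      rintro (h | ⟨u | u, h, h'⟩)
      · exact Or.inl h
      · exact Or.inr ⟨u, by simpa [graph] using h, h'⟩
      · exact absurd h (by simp [graph])
    · obtain ⟨h3, h4, h5⟩ := h2 (Sum.inr v)
      refine ⟨h3, h4, h5.imp_left ?_⟩
      rintro (h | ⟨u | u, h, h'⟩)
      · exact Or.inl h
      · exact absurd h (by simp [graph])
      · exact Or.inr ⟨u, by simpa [graph] using h, h'⟩
  · rintro ⟨⟨h1, h2⟩, h3, h4⟩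
    refine ⟨?_, ?_⟩
    · rintro (u | u) (v | v) h
      · exact h1 u v (by simpa [graph] using h)
      · exact absurd h (by simp [graph])
      · exact absurd h (by simp [graph])
      · exact h3 u v (by simpa [graph] using h)
    · rintro (v | v)
      · obtain ⟨h5, h6, h7⟩ := h2 v
        refine ⟨h5, h6, h7.imp_left ?_⟩
        rintro (h | ⟨u, h, h'⟩)
        · exact Or.inl h
        · exact Or.inr ⟨Sum.inl u, by simpa [graph] using h, h'⟩
      · obtain ⟨h5, h6, h7⟩ := h4 v
        refine ⟨h5, h6, h7.imp_left ?_⟩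
        rintro (h | ⟨u, h, h'⟩)
        · exact Or.inl h
        · exact Or.inr ⟨Sum.inr u, by simpa [graph] using h, h'⟩

/-- No edge runs between the two sides, and both are judged by the same contexts, so a labelling of
the union is an independent pair of labellings; no convolution over contexts is needed. -/
theorem count_union (r X : ℕ) (e₁ e₂ : CWExpr cw) (σ : Fin cw → ℕ × ℕ) :
    count r X (union e₁ e₂) σ = count r X e₁ σ * count r X e₂ σ := by
  classical
  unfold count
  rw [Finset.sum_mul_sum, ← Fintype.sum_prod_type']
  refine @Fintype.sum_equiv _ _ _ _ _ _ (show ((union e₁ e₂).Vert → Fin (r + 1)) ≃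
    (e₁.Vert → Fin (r + 1)) × (e₂.Vert → Fin (r + 1)) from
      Equiv.sumArrowEquivProdArrow e₁.Vert e₂.Vert (Fin (r + 1))) _ _ fun d => ?_
  have h1 : (fun v : e₁.Vert ⊕ e₂.Vert => (d v : ℕ)) =
      Sum.elim (fun v => (d (Sum.inl v) : ℕ)) (fun v => (d (Sum.inr v) : ℕ)) := by
    funext v; rcases v with v | v <;> rfl
  have h2 := good_union e₁ e₂ σ (fun v => (d (Sum.inl v) : ℕ)) (fun v => (d (Sum.inr v) : ℕ))
  rw [← h1] at h2
  have h3 : (∏ v : e₁.Vert ⊕ e₂.Vert, (if (d v : ℕ) = 0 then X else 1)) =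
      (∏ v, (if (d (Sum.inl v) : ℕ) = 0 then X else 1)) *
      ∏ v, (if (d (Sum.inr v) : ℕ) = 0 then X else 1) := Fintype.prod_sum_type _
  refine (if_congr h2 h3 rfl).trans ?_
  change _ = (if Good e₁ σ (fun v => (d (Sum.inl v) : ℕ)) then _ else 0) *
    (if Good e₂ σ (fun v => (d (Sum.inr v) : ℕ)) then _ else 0)
  by_cases h4 : Good e₁ σ (fun v => (d (Sum.inl v) : ℕ))
  · by_cases h5 : Good e₂ σ (fun v => (d (Sum.inr v) : ℕ))
    · rw [if_pos ⟨h4, h5⟩, if_pos h4, if_pos h5]; rfl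
    · rw [if_neg (fun h => h5 h.2), if_neg h5, mul_zero]
  · rw [if_neg (fun h => h4 h.1), if_neg h4, zero_mul]

/-- The labels that occur at the root of an expression. -/
def Occurs (e : CWExpr cw) (l : Fin cw) : Prop := ∃ v, e.label v = l

theorem occurs_intro (l x : Fin cw) : (intro l).Occurs x ↔ l = x :=
  ⟨fun ⟨_, h⟩ => h, fun h => ⟨(), h⟩⟩

theorem occurs_join (a b x : Fin cw) (e : CWExpr cw) : (join a b e).Occurs x ↔ e.Occurs x := Iff.rfl

theorem occurs_rename (a b x : Fin cw) (e : CWExpr cw) :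
    (rename a b e).Occurs x ↔
      if x = b then e.Occurs a ∨ e.Occurs b else if x = a then False else e.Occurs x := by
  constructor
  · rintro ⟨v, rfl⟩
    change (if (if e.label v = a then b else e.label v) = b then _ else
      if (if e.label v = a then b else e.label v) = a then _ else
        e.Occurs (if e.label v = a then b else e.label v))
    by_cases h : e.label v = a
    · simp only [h, if_true]; exact Or.inl ⟨v, h⟩
    · simp only [h, if_false]
      split_ifs with h1
      · exact Or.inr ⟨v, h1⟩
      · exact ⟨v, rfl⟩
  · intro h
    split_ifs at h with h1 h2
    · rcases h with ⟨v, hv⟩ | ⟨v, hv⟩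
      · exact ⟨v, by change (if e.label v = a then b else e.label v) = x; simp [hv, h1]⟩
      · exact ⟨v, by change (if e.label v = a then b else e.label v) = x; simp [hv, h1]⟩
    · obtain ⟨v, hv⟩ := h
      exact ⟨v, by change (if e.label v = a then b else e.label v) = x; simp [hv, h2]⟩

theorem occurs_union (x : Fin cw) (e₁ e₂ : CWExpr cw) :
    (union e₁ e₂).Occurs x ↔ e₁.Occurs x ∨ e₂.Occurs x := by
  constructor
  · rintro ⟨v | v, hv⟩
    · exact Or.inl ⟨v, hv⟩
    · exact Or.inr ⟨v, hv⟩
  · rintro (⟨v, hv⟩ | ⟨v, hv⟩)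
    · exact ⟨Sum.inl v, hv⟩
    · exact ⟨Sum.inr v, hv⟩

theorem join_adj (a b : Fin cw) (e : CWExpr cw) (u v : e.Vert) :
    (join a b e).graph.Adj u v ↔ e.graph.Adj u v ∨ u ≠ v ∧
      (e.label u = a ∧ e.label v = b ∨ e.label v = a ∧ e.label u = b) := by
  change (e.graph ⊔ SimpleGraph.fromRel (fun u v => e.label u = a ∧ e.label v = b)).Adj u v ↔ _
  rw [SimpleGraph.sup_adj, SimpleGraph.fromRel_adj]

theorem good_join_of_empty (a b : Fin cw) (e : CWExpr cw) (σ : Fin cw → ℕ × ℕ) (d : e.Vert → ℕ)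
    (h : ¬ (e.Occurs a ∧ e.Occurs b)) : Good (join a b e) σ d ↔ Good e σ d := by
  have : (join a b e).graph = e.graph := by
    ext u v
    refine (join_adj a b e u v).trans ⟨?_, Or.inl⟩
    rintro (h1 | ⟨-, ⟨h1, h2⟩ | ⟨h1, h2⟩⟩)
    · exact h1
    · exact absurd ⟨⟨_, h1⟩, _, h2⟩ h
    · exact absurd ⟨⟨_, h1⟩, _, h2⟩ h
  unfold Good
  rw [this]
  rfl

theorem count_join_of_empty (r X : ℕ) (a b : Fin cw) (e : CWExpr cw) (σ : Fin cw → ℕ × ℕ)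
    (h : ¬ (e.Occurs a ∧ e.Occurs b)) : count r X (join a b e) σ = count r X e σ := by
  classical
  unfold count
  refine Finset.sum_congr rfl fun d _ => ?_
  exact if_congr (good_join_of_empty a b e σ _ h) rfl rfl

/-- A vertex with label `l` would need a value from an empty range. This disposes of the contexts
that have no digit. -/
theorem count_eq_zero (r X : ℕ) (e : CWExpr cw) (σ : Fin cw → ℕ × ℕ) (l : Fin cw) (h : e.Occurs l)
    (h' : (σ l).2 < (σ l).1 ∨ r < (σ l).1) : count r X e σ = 0 := by
  classical
  unfold count
  refine Finset.sum_eq_zero fun d _ => if_neg ?_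
  rintro ⟨-, hg⟩
  obtain ⟨v, rfl⟩ := h
  have h1 : _ ≤ (d v : ℕ) ∧ (d v : ℕ) ≤ _ ∧ _ := hg v
  have h2 := (d v).isLt
  omega

/-- The smallest value `d` takes on the vertices with label `l` is `m`. -/
def IsMin (e : CWExpr cw) (d : e.Vert → ℕ) (l : Fin cw) (m : ℕ) : Prop :=
  (∃ v, e.label v = l ∧ d v = m) ∧ ∀ v, e.label v = l → m ≤ d v

theorem exists_isMin (e : CWExpr cw) (d : e.Vert → ℕ) (l : Fin cw) (h : e.Occurs l) :
    ∃ m, e.IsMin d l m := by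
  classical
  have h1 : ∃ m, ∃ v, e.label v = l ∧ d v = m := by
    obtain ⟨v, hv⟩ := h; exact ⟨_, v, hv, rfl⟩
  exact ⟨Nat.find h1, Nat.find_spec h1, fun v hv => Nat.find_le ⟨v, hv, rfl⟩⟩

theorem IsMin.unique {e : CWExpr cw} {d : e.Vert → ℕ} {l : Fin cw} {m m' : ℕ}
    (h : e.IsMin d l m) (h' : e.IsMin d l m') : m = m' := by
  obtain ⟨⟨v, h1, h2⟩, h3⟩ := h
  obtain ⟨⟨v', h1', h2'⟩, h3'⟩ := h'
  have := h3 v' h1'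
  have := h3' v h1
  omega

/-- The new edges bound every value of one class by the minimum of the other plus 1; the lower
bounds follow from the upper ones and are included because they make the windows short. A vertex of
class `a` gains a predecessor from the join exactly if its value is `s' + 1`. This is the exempt
value of the narrowed window, unless the old upper bound is smaller and remains the exempt one. -/
theorem good_join (a b : Fin cw) (e : CWExpr cw) (σ : Fin cw → ℕ × ℕ) (d : e.Vert → ℕ) {s s' : ℕ}
    (hs : e.IsMin d a s) (hs' : e.IsMin d b s') :
    Good (join a b e) σ d ↔ Good e (Function.update
      (Function.update σ b (max (σ b).1 (s - 1), min (σ b).2 (s + 1)))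
      a (max (σ a).1 (s' - 1), min (σ a).2 (s' + 1))) d := by
  set τ := Function.update
      (Function.update σ b (max (σ b).1 (s - 1), min (σ b).2 (s + 1)))
      a (max (σ a).1 (s' - 1), min (σ a).2 (s' + 1)) with hτ
  have hτa : τ a = (max (σ a).1 (s' - 1), min (σ a).2 (s' + 1)) := by simp [hτ]
  -- For `a = b` the outer update hides the inner one, but both minima and hence both windows
  -- coincide.
  have hτb : τ b = (max (σ b).1 (s - 1), min (σ b).2 (s + 1)) := by
    by_cases h : b = a
    · subst h
      have : s = s' := hs.unique hs'
      subst this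
      exact hτa
    · simp [hτ, h]
  have hτo : ∀ l, l ≠ a → l ≠ b → τ l = σ l := by
    intro l h1 h2; simp [hτ, h1, h2]
  obtain ⟨⟨ua, hua, hda⟩, hmina⟩ := hs
  obtain ⟨⟨ub, hub, hdb⟩, hminb⟩ := hs'
  constructor
  · rintro ⟨h1, h2⟩
    have hB : ∀ v, e.label v = a → d v ≤ s' + 1 ∧ s' ≤ d v + 1 := by
      intro v hv
      -- This can only happen for `a = b`: the vertex is not adjacent to itself, and the bounds are
      -- trivial.
      by_cases h : v = ub
      · subst h; omega
      · have := h1 v ub ((join_adj a b e v ub).2 (Or.inr ⟨h, Or.inl ⟨hv, hub⟩⟩))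
        have := h1 ub v ((join_adj a b e ub v).2 (Or.inr ⟨Ne.symm h, Or.inr ⟨hv, hub⟩⟩))
        omega
    have hA : ∀ v, e.label v = b → d v ≤ s + 1 ∧ s ≤ d v + 1 := by
      intro v hv
      by_cases h : v = ua
      · subst h; omega
      · have := h1 v ua ((join_adj a b e v ua).2 (Or.inr ⟨h, Or.inr ⟨hua, hv⟩⟩))
        have := h1 ua v ((join_adj a b e ua v).2 (Or.inr ⟨Ne.symm h, Or.inl ⟨hua, hv⟩⟩))
        omega
    refine ⟨fun u v h => h1 u v ((join_adj a b e u v).2 (Or.inl h)), fun v => ?_⟩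
    obtain ⟨h3, h4, h5⟩ := h2 v
    change (σ (e.label v)).1 ≤ d v at h3
    change d v ≤ (σ (e.label v)).2 at h4
    change _ ∨ d v = (σ (e.label v)).2 at h5
    have h6 : HasPred e.graph d v ∨ d v = (σ (e.label v)).2 ∨
        (∃ u, e.label v = a ∧ e.label u = b ∧ d u + 1 = d v) ∨
        (∃ u, e.label v = b ∧ e.label u = a ∧ d u + 1 = d v) := by
      rcases h5 with (h5 | ⟨u, hu, hd⟩) | h5
      · exact Or.inl (Or.inl h5)
      · rcases (join_adj a b e v u).1 hu with hu | ⟨-, ⟨h, h'⟩ | ⟨h, h'⟩⟩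
        · exact Or.inl (Or.inr ⟨u, hu, hd⟩)
        · exact Or.inr (Or.inr (Or.inl ⟨u, h, h', hd⟩))
        · exact Or.inr (Or.inr (Or.inr ⟨u, h', h, hd⟩))
      · exact Or.inr (Or.inl h5)
    by_cases hva : e.label v = a
    · rw [hva, hτa]
      rw [hva] at h3 h4 h6
      have h7 := hB v hva
      refine ⟨by simp only; omega, by simp only; omega, ?_⟩
      rcases h6 with h6 | h6 | ⟨u, -, hu, hd⟩ | ⟨u, h, hu, hd⟩
      · exact Or.inl h6
      · right; simp only; omega
      · right; have := hminb u hu; simp only; omega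
      · right; have := hminb u (by rw [hu, h]); simp only; omega
    · by_cases hvb : e.label v = b
      · rw [hvb, hτb]
        rw [hvb] at h3 h4 h6
        have h7 := hA v hvb
        refine ⟨by simp only; omega, by simp only; omega, ?_⟩
        rcases h6 with h6 | h6 | ⟨u, h, hu, hd⟩ | ⟨u, -, hu, hd⟩
        · exact Or.inl h6
        · right; simp only; omega
        · right; have := hmina u (by rw [hu, h]); simp only; omega
        · right; have := hmina u hu; simp only; omega
      · rw [hτo _ hva hvb]
        refine ⟨h3, h4, ?_⟩
        rcases h6 with h6 | h6 | ⟨u, h, -⟩ | ⟨u, h, -⟩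
        · exact Or.inl h6
        · exact Or.inr h6
        · exact absurd h hva
        · exact absurd h hvb
  · rintro ⟨h1, h2⟩
    have h2a : ∀ v, e.label v = a → max (σ a).1 (s' - 1) ≤ d v ∧ d v ≤ min (σ a).2 (s' + 1) ∧
        (HasPred e.graph d v ∨ d v = min (σ a).2 (s' + 1)) := by
      intro v hv; have := h2 v; rwa [hv, hτa] at this
    have h2b : ∀ v, e.label v = b → max (σ b).1 (s - 1) ≤ d v ∧ d v ≤ min (σ b).2 (s + 1) ∧
        (HasPred e.graph d v ∨ d v = min (σ b).2 (s + 1)) := by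
      intro v hv; have := h2 v; rwa [hv, hτb] at this
    have hmono : ∀ v, HasPred e.graph d v → HasPred (join a b e).graph d v := by
      rintro v (h | ⟨u, hu, hd⟩)
      · exact Or.inl h
      · exact Or.inr ⟨u, (join_adj a b e v u).2 (Or.inl hu), hd⟩
    refine ⟨fun u v h => ?_, fun v => ?_⟩
    · rcases (join_adj a b e u v).1 h with h | ⟨-, ⟨h, h'⟩ | ⟨h, h'⟩⟩
      · exact h1 u v h
      · have := h2a u h; have := hminb v h'; omega
      · have := h2b u h'; have := hmina v h; omega
    · change (σ (e.label v)).1 ≤ d v ∧ d v ≤ (σ (e.label v)).2 ∧ (_ ∨ d v = (σ (e.label v)).2)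
      by_cases hva : e.label v = a
      · obtain ⟨h3, h4, h5⟩ := h2a v hva
        rw [hva]
        refine ⟨by omega, by omega, ?_⟩
        rcases h5 with h5 | h5
        · exact Or.inl (hmono v h5)
        · by_cases h : d v = (σ a).2
          · exact Or.inr h
          -- The value is the narrowed bound but not the old one, so it is `s' + 1`, and a minimal
          -- vertex of the other class serves as predecessor.
          · refine Or.inl (Or.inr ⟨ub, (join_adj a b e v ub).2 (Or.inr ⟨?_, Or.inl ⟨hva, hub⟩⟩), ?_⟩)
            · rintro rfl; omega
            · omega
      · by_cases hvb : e.label v = b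
        · obtain ⟨h3, h4, h5⟩ := h2b v hvb
          rw [hvb]
          refine ⟨by omega, by omega, ?_⟩
          rcases h5 with h5 | h5
          · exact Or.inl (hmono v h5)
          · by_cases h : d v = (σ b).2
            · exact Or.inr h
            · refine Or.inl (Or.inr ⟨ua,
                (join_adj a b e v ua).2 (Or.inr ⟨?_, Or.inr ⟨hua, hvb⟩⟩), ?_⟩)
              · rintro rfl; omega
              · omega
        · have := h2 v
          rw [hτo _ hva hvb] at this
          exact ⟨this.1, this.2.1, this.2.2.imp_left (hmono v)⟩

/-- Events of the form "the minimum of a class is at least `x`" are absorbed into the lower bound of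
its context. This makes inclusion–exclusion over the minima possible without storing them. -/
theorem good_update_max (e : CWExpr cw) (σ : Fin cw → ℕ × ℕ) (d : e.Vert → ℕ) (l : Fin cw)
    (m x M : ℕ) {s : ℕ} (hs : e.IsMin d l s) :
    Good e (Function.update σ l (max m x, M)) d ↔ Good e (Function.update σ l (m, M)) d ∧ x ≤ s := by
  obtain ⟨⟨u, hu, hd⟩, hmin⟩ := hs
  constructor
  · rintro ⟨h1, h2⟩
    refine ⟨⟨h1, fun v => ?_⟩, ?_⟩
    · have := h2 v
      rw [Function.update_apply] at this ⊢
      split_ifs at this ⊢ with h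
      · exact ⟨le_trans (le_max_left _ _) this.1, this.2⟩
      · exact this
    · have := h2 u
      rw [hu, Function.update_self] at this
      have := this.1
      simp only at this
      omega
  · rintro ⟨⟨h1, h2⟩, h3⟩
    refine ⟨h1, fun v => ?_⟩
    have := h2 v
    rw [Function.update_apply] at this ⊢
    split_ifs at this ⊢ with h
    · exact ⟨max_le this.1 (h3.trans (hmin v h)), this.2⟩
    · exact this

/-- The contexts of the labels `a` and `b` below a join of the two. -/
def joinCtx (σ : Fin cw → ℕ × ℕ) (a b : Fin cw) (s s' i j : ℕ) : Fin cw → ℕ × ℕ :=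
  Function.update
    (Function.update σ b (max (max (σ b).1 (s - 1)) (s' + j), min (σ b).2 (s + 1)))
    a (max (max (σ a).1 (s' - 1)) (s + i), min (σ a).2 (s' + 1))

-- For fixed `s, s'` the alternating sum over `i, j` is the product of `[min ≥ s] - [min ≥ s + 1]`
-- for class `a` and the analogous difference for class `b`, so only the pair of true minima
-- survives, and for it the windows are those of `good_join`. If `a = b` there is one minimum and
-- one factor, whence `s = s'` and `j = 0`.
open Classical in
theorem sum_join_indicator (a b : Fin cw) (e : CWExpr cw) (σ : Fin cw → ℕ × ℕ) (d : e.Vert → ℕ)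
    (ha : e.Occurs a) (hb : e.Occurs b) (w : ℤ) (r : ℕ) (hr : ∀ v, d v ≤ r) :
    (if Good (join a b e) σ d then w else 0) =
      ∑ s ∈ Finset.range (r + 1), ∑ s' ∈ Finset.range (r + 1), ∑ i ∈ Finset.range 2,
        ∑ j ∈ Finset.range 2, if a = b → s = s' ∧ j = 0 then
          ((1 - 2 * i) * (1 - 2 * j) : ℤ) * (if Good e (joinCtx σ a b s s' i j) d then w else 0)
          else 0 := by
  obtain ⟨s₀, hs⟩ := e.exists_isMin d a ha
  obtain ⟨s₀', hs'⟩ := e.exists_isMin d b hb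
  have hsr : s₀ < r + 1 := by
    obtain ⟨⟨v, -, hv⟩, -⟩ := hs; have := hr v; omega
  have hsr' : s₀' < r + 1 := by
    obtain ⟨⟨v, -, hv⟩, -⟩ := hs'; have := hr v; omega
  have key : ∀ s s', (∑ i ∈ Finset.range 2,
        ∑ j ∈ Finset.range 2, if a = b → s = s' ∧ j = 0 then
          ((1 - 2 * i) * (1 - 2 * j) : ℤ) * (if Good e (joinCtx σ a b s s' i j) d then w else 0)
          else 0) = if s' = s₀' then if s = s₀ then
            (if Good (join a b e) σ d then w else 0) else 0 else 0 := by
    intro s s'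
    set G₀ := Good e (Function.update
      (Function.update σ b (max (σ b).1 (s - 1), min (σ b).2 (s + 1)))
      a (max (σ a).1 (s' - 1), min (σ a).2 (s' + 1))) d with hG₀
    have hj : s = s₀ → s' = s₀' → (Good (join a b e) σ d ↔ G₀) := by
      rintro rfl rfl
      exact good_join a b e σ d hs hs'
    by_cases hab : a = b
    · subst hab
      have hss : s₀ = s₀' := hs.unique hs'
      subst hss
      have h1 : ∀ i j, Good e (joinCtx σ a a s s' i j) d ↔ G₀ ∧ s + i ≤ s₀ := by
        intro i j
        unfold joinCtx
        rw [good_update_max _ _ _ _ _ _ _ hs]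
        simp only [hG₀, Function.update_idem]
      by_cases hs1 : s = s'
      · subst hs1
        simp only [h1, Finset.sum_range_succ, Finset.range_zero, Finset.sum_empty]
        by_cases hG : G₀
        · simp only [hG, true_and]
          by_cases h : s = s₀
          · have := (hj h h).2 hG
            subst h
            simp [this]
          · by_cases h' : s ≤ s₀
            · have : s + 1 ≤ s₀ := by omega
              simp [h, h', this]
            · have : ¬ s + 1 ≤ s₀ := by omega
              simp [h, h', this]
        · by_cases h : s = s₀
          · have := (hj h h).not.2 hG
            simp [hG, this]
          · simp [hG, h]
      · have : ¬ (s = s₀ ∧ s' = s₀) := by omega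
        simp only [hs1, false_and, imp_false, not_true_eq_false, if_false, Finset.sum_const_zero]
        split_ifs <;> first | rfl | omega
    · have h1 : ∀ i j, Good e (joinCtx σ a b s s' i j) d ↔ G₀ ∧ s + i ≤ s₀ ∧ s' + j ≤ s₀' := by
        intro i j
        unfold joinCtx
        rw [good_update_max _ _ _ _ _ _ _ hs, Function.update_comm (Ne.symm hab),
          good_update_max _ _ _ _ _ _ _ hs', Function.update_comm hab, and_assoc,
          and_comm (a := s' + j ≤ s₀')]
      simp only [h1, hab, false_imp_iff, if_true, Finset.sum_range_succ, Finset.range_zero,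
        Finset.sum_empty]
      by_cases hG : G₀
      · simp only [hG, true_and]
        by_cases h : s = s₀
        · by_cases h' : s' = s₀'
          · have := (hj h h').2 hG
            subst h h'
            simp [this]
          · subst h
            by_cases h2 : s' ≤ s₀'
            · have : s' + 1 ≤ s₀' := by omega
              simp [h2, this, h']
            · have : ¬ s' + 1 ≤ s₀' := by omega
              simp [h2, this, h']
        · by_cases h2 : s ≤ s₀
          · have : s + 1 ≤ s₀ := by omega
            simp only [h2, this, h, add_zero, true_and, if_false, ite_self]
            push_cast
            ring
          · have : ¬ s + 1 ≤ s₀ := by omega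
            simp [h2, this, h]
      · by_cases h : s = s₀
        · by_cases h' : s' = s₀'
          · have := (hj h h').not.2 hG
            simp [hG, this]
          · simp [hG, h']
        · simp [hG, h]
  simp only [key, Finset.sum_ite_eq', Finset.mem_range, hsr, hsr', if_true]

/-- The identity for single labellings, summed over all of them. Its signs are the reason for
working in the integers. -/
theorem count_join (r X : ℕ) (a b : Fin cw) (e : CWExpr cw) (σ : Fin cw → ℕ × ℕ)
    (ha : e.Occurs a) (hb : e.Occurs b) :
    (count r X (join a b e) σ : ℤ) =
      ∑ s ∈ Finset.range (r + 1), ∑ s' ∈ Finset.range (r + 1), ∑ i ∈ Finset.range 2,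
        ∑ j ∈ Finset.range 2, if a = b → s = s' ∧ j = 0 then
          ((1 - 2 * i) * (1 - 2 * j) : ℤ) * count r X e (joinCtx σ a b s s' i j) else 0 := by
  classical
  have h1 : (count r X (join a b e) σ : ℤ) = ∑ d : e.Vert → Fin (r + 1),
      if Good (join a b e) σ (fun v => (d v : ℕ)) then
        ((∏ v, (if (d v : ℕ) = 0 then X else 1) : ℕ) : ℤ) else 0 := by
    unfold count
    rw [Nat.cast_sum]
    refine Finset.sum_congr rfl fun d _ => ?_
    rw [Nat.cast_ite, Nat.cast_zero]
    rfl
  have h2 : ∀ τ, (count r X e τ : ℤ) = ∑ d : e.Vert → Fin (r + 1),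
      if Good e τ (fun v => (d v : ℕ)) then
        ((∏ v, (if (d v : ℕ) = 0 then X else 1) : ℕ) : ℤ) else 0 := by
    intro τ
    unfold count
    rw [Nat.cast_sum]
    refine Finset.sum_congr rfl fun d _ => ?_
    rw [Nat.cast_ite, Nat.cast_zero]
  rw [h1, Finset.sum_congr rfl fun d _ => sum_join_indicator a b e σ (fun v => (d v : ℕ)) ha hb _ r
    fun v => Nat.lt_succ_iff.1 (d v).isLt]
  rw [Finset.sum_comm]
  refine Finset.sum_congr rfl fun s _ => ?_
  rw [Finset.sum_comm]
  refine Finset.sum_congr rfl fun s' _ => ?_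
  rw [Finset.sum_comm]
  refine Finset.sum_congr rfl fun i _ => ?_
  rw [Finset.sum_comm]
  refine Finset.sum_congr rfl fun j _ => ?_
  rw [h2]
  split_ifs with h
  · rw [Finset.mul_sum]
  · simp

/-- Packs a double sum into one index; the machine language sees only the index of the innermost
sum. -/
theorem sum_range_mul_div_mod {M : Type*} [AddCommMonoid M] (n m : ℕ) (f : ℕ → ℕ → M) :
    ∑ z ∈ Finset.range (n * m), f (z / m) (z % m) =
      ∑ x ∈ Finset.range n, ∑ y ∈ Finset.range m, f x y := by
  induction n with
  | zero => simp
  | succ n ih =>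
    rw [Nat.succ_mul, Finset.sum_range_add, ih, Finset.sum_range_succ]
    congr 1
    refine Finset.sum_congr rfl fun y hy => ?_
    have hy := Finset.mem_range.1 hy
    have hm : 0 < m := by omega
    rw [Nat.add_comm, Nat.add_mul_div_right _ _ hm, Nat.div_eq_of_lt hy, Nat.add_mul_mod_self_right,
      Nat.mod_eq_of_lt hy, Nat.zero_add]

/-- The recurrence for an effective join, as a single sum. -/
theorem count_join' (r X : ℕ) (a b : Fin cw) (e : CWExpr cw) (σ : Fin cw → ℕ × ℕ)
    (ha : e.Occurs a) (hb : e.Occurs b) :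
    (count r X (join a b e) σ : ℤ) =
      ∑ z ∈ Finset.range ((r + 1) * (r + 1) * 2 * 2),
        if a = b → z / 2 / 2 / (r + 1) = z / 2 / 2 % (r + 1) ∧ z % 2 = 0 then
          ((1 - 2 * (z / 2 % 2 : ℕ)) * (1 - 2 * (z % 2 : ℕ)) : ℤ) * count r X e
            (joinCtx σ a b (z / 2 / 2 / (r + 1)) (z / 2 / 2 % (r + 1)) (z / 2 % 2) (z % 2))
        else 0 := by
  rw [count_join r X a b e σ ha hb,
    sum_range_mul_div_mod ((r + 1) * (r + 1) * 2) 2 (fun y j =>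
      if a = b → y / 2 / (r + 1) = y / 2 % (r + 1) ∧ j = 0 then
          ((1 - 2 * (y % 2 : ℕ)) * (1 - 2 * (j : ℕ)) : ℤ) * count r X e
            (joinCtx σ a b (y / 2 / (r + 1)) (y / 2 % (r + 1)) (y % 2) j) else 0),
    sum_range_mul_div_mod ((r + 1) * (r + 1)) 2 (fun y i => ∑ j ∈ Finset.range 2,
      if a = b → y / (r + 1) = y % (r + 1) ∧ j = 0 then
          ((1 - 2 * (i : ℕ)) * (1 - 2 * (j : ℕ)) : ℤ) * count r X e
            (joinCtx σ a b (y / (r + 1)) (y % (r + 1)) i j) else 0),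
    sum_range_mul_div_mod (r + 1) (r + 1) (fun s s' => ∑ i ∈ Finset.range 2, ∑ j ∈ Finset.range 2,
      if a = b → s = s' ∧ j = 0 then
          ((1 - 2 * (i : ℕ)) * (1 - 2 * (j : ℕ)) : ℤ) * count r X e
            (joinCtx σ a b s s' i j) else 0)]

/-- A crude bound; it only serves to keep the binary length of table entries polynomial. -/
theorem count_le (r X : ℕ) (hX : 1 ≤ X) (e : CWExpr cw) (σ : Fin cw → ℕ × ℕ) :
    count r X e σ ≤ ((r + 1) * X) ^ Fintype.card e.Vert := by
  classical
  unfold count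
  have h : ∀ d : e.Vert → Fin (r + 1), (if e.Good σ (fun v => (d v : ℕ)) then
      ∏ v, (if (d v : ℕ) = 0 then X else 1) else 0) ≤ X ^ Fintype.card e.Vert := by
    intro d
    split_ifs
    · calc _ ≤ ∏ _v : e.Vert, X := Finset.prod_le_prod' fun v _ => by split_ifs <;> omega
        _ = _ := by simp
    · exact Nat.zero_le _
  refine (Finset.sum_le_sum fun d _ => h d).trans ?_
  simp [mul_pow]

end CWExpr


/-! ### Distance labellings correspond to centers; counting by size -/

section DistanceLabellings

variable {V : Type*} {G : SimpleGraph V}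

theorem edist_adj_le {G : SimpleGraph V} {u v w : V} {j : ℕ} (h : G.edist u v ≤ (j : ℕ∞))
    (hvw : G.Adj v w) : G.edist u w ≤ ((j + 1 : ℕ) : ℕ∞) := by
  obtain ⟨p, hp⟩ := SimpleGraph.exists_walk_of_edist_ne_top
    (ne_top_of_le_ne_top (ENat.natCast_ne_top j) h)
  rw [← hp] at h
  have h' : p.length ≤ j := by exact_mod_cast h
  refine (SimpleGraph.edist_le (p.concat hvw)).trans ?_
  rw [SimpleGraph.Walk.length_concat]
  exact_mod_cast Nat.succ_le_succ h'

theorem exists_adj_of_edist_le {u v : V} {j : ℕ} (h : G.edist u v ≤ ((j + 1 : ℕ) : ℕ∞))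
    (h' : ¬ G.edist u v ≤ (j : ℕ∞)) : ∃ w, G.Adj v w ∧ G.edist u w ≤ (j : ℕ∞) := by
  obtain ⟨p, hp⟩ := SimpleGraph.exists_walk_of_edist_ne_top
    (ne_top_of_le_ne_top (ENat.natCast_ne_top (j + 1)) h)
  have h1 : p.length ≤ j + 1 := by rw [← hp] at h; exact_mod_cast h
  have h2 : ¬ p.length ≤ j := by rw [← hp] at h'; exact_mod_cast h'
  obtain ⟨q, hq⟩ : ∃ q : G.Walk v u, q.length = p.length := ⟨p.reverse, by simp⟩
  cases q with
  | nil => simp at hq; omega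
  | cons hadj q =>
    rename_i w
    refine ⟨w, hadj, ?_⟩
    rw [SimpleGraph.edist_comm]
    refine (SimpleGraph.edist_le q).trans ?_
    rw [SimpleGraph.Walk.length_cons] at hq
    have : q.length ≤ j := by omega
    exact_mod_cast this

/-- Distance labellings: neighbouring values differ by at most `1`, and every vertex with positive
value has a neighbour with a smaller one. -/
def IsDistLabelling (G : SimpleGraph V) (d : V → ℕ) : Prop :=
  (∀ u v, G.Adj u v → d u ≤ d v + 1) ∧ ∀ v, HasPred G d v

/-- So `d` is the distance to its zero set: following predecessors reaches a zero in `d v` steps,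
and along a walk that starts at a zero the value grows by at most 1 per step. -/
theorem IsDistLabelling.le_iff {d : V → ℕ} (hd : IsDistLabelling G d) (v : V) (j : ℕ) :
    d v ≤ j ↔ ∃ u, d u = 0 ∧ G.edist u v ≤ (j : ℕ∞) := by
  constructor
  · intro h
    induction j generalizing v with
    | zero => exact ⟨v, by omega, by simp⟩
    | succ j ih =>
      rcases hd.2 v with h0 | ⟨w, hw, hdw⟩
      · exact ⟨v, h0, by simp⟩
      · obtain ⟨u, hu, huw⟩ := ih w (by omega)
        exact ⟨u, hu, edist_adj_le huw hw.symm⟩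
  · rintro ⟨u, hu, huv⟩
    obtain ⟨p, hp⟩ := SimpleGraph.exists_walk_of_edist_ne_top
      (ne_top_of_le_ne_top (ENat.natCast_ne_top j) huv)
    rw [← hp] at huv
    have h : p.length ≤ j := by exact_mod_cast huv
    have : ∀ {x y : V} (q : G.Walk x y), d y ≤ d x + q.length := by
      intro x y q
      induction q with
      | nil => simp
      | cons h q ih =>
        have := hd.1 _ _ h.symm
        rw [SimpleGraph.Walk.length_cons]
        omega
    have := this p
    omega

-- The labelling is the distance to `K`, taken as a least natural number, which exists because `K`
-- is a center. The neighbour of `v` on a shortest walk to `K` is a predecessor.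
open Classical in
theorem exists_isDistLabelling {r : ℕ} {K : Finset V} (hK : IsDistCenter G r K) :
    ∃ d : V → ℕ, IsDistLabelling G d ∧ (∀ v, d v ≤ r) ∧ ∀ v, d v = 0 ↔ v ∈ K := by
  have hex : ∀ v, ∃ u ∈ K, G.edist u v ≤ (r : ℕ∞) := by
    intro v
    by_cases hv : v ∈ K
    · exact ⟨v, hv, by simp⟩
    · exact hK v hv
  have hex' : ∀ v, ∃ j : ℕ, ∃ u ∈ K, G.edist u v ≤ (j : ℕ∞) := fun v => ⟨r, hex v⟩
  refine ⟨fun v => Nat.find (hex' v), ⟨fun u v huv => ?_, fun v => ?_⟩, fun v => ?_, fun v => ?_⟩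
  · obtain ⟨w, hw, hwv⟩ := Nat.find_spec (hex' v)
    exact Nat.find_le ⟨w, hw, edist_adj_le hwv huv.symm⟩
  · by_cases h0 : Nat.find (hex' v) = 0
    · exact Or.inl h0
    · obtain ⟨j, hj⟩ := Nat.exists_eq_succ_of_ne_zero h0
      obtain ⟨w, hw, hwv⟩ := Nat.find_spec (hex' v)
      rw [hj] at hwv
      obtain ⟨x, hx, hwx⟩ := exists_adj_of_edist_le hwv
        (fun h => Nat.find_min (hex' v) (by omega : j < _) ⟨w, hw, h⟩)
      refine Or.inr ⟨x, hx, ?_⟩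
      have h1 : Nat.find (hex' x) ≤ j := Nat.find_le ⟨w, hw, hwx⟩
      have h2 : Nat.find (hex' v) ≤ Nat.find (hex' x) + 1 := by
        obtain ⟨w', hw', hwx'⟩ := Nat.find_spec (hex' x)
        exact Nat.find_le ⟨w', hw', edist_adj_le hwx' hx.symm⟩
      show Nat.find (hex' x) + 1 = Nat.find (hex' v)
      omega
  · exact Nat.find_le (hex v)
  · rw [Nat.find_eq_zero]
    constructor
    · rintro ⟨u, hu, huv⟩
      have : G.edist u v = 0 := le_antisymm (by simpa using huv) bot_le
      rw [SimpleGraph.edist_eq_zero_iff] at this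
      exact this ▸ hu
    · intro hv
      exact ⟨v, hv, by simp⟩

theorem IsDistLabelling.isDistCenter [Fintype V] [DecidableEq V] {d : V → ℕ} {r : ℕ}
    (hd : IsDistLabelling G d) (hr : ∀ v, d v ≤ r) :
    IsDistCenter G r (Finset.univ.filter fun v => d v = 0) := by
  intro u _
  obtain ⟨v, hv, hvu⟩ := (hd.le_iff u r).1 (hr u)
  exact ⟨v, by simpa using hv, hvu⟩

/-- Both are the distance to the common zero set. -/
theorem IsDistLabelling.ext {d d' : V → ℕ} (hd : IsDistLabelling G d) (hd' : IsDistLabelling G d')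
    (h : ∀ v, d v = 0 ↔ d' v = 0) : d = d' := by
  have key : ∀ v j, d v ≤ j ↔ d' v ≤ j := by
    intro v j
    rw [hd.le_iff, hd'.le_iff]
    simp only [h]
  funext v
  have h1 := (key v (d v)).1 le_rfl
  have h2 := (key v (d' v)).2 le_rfl
  omega

-- Taking the zero set is a bijection from distance labellings with values at most `r` to
-- `r`-centers, and the weight of a labelling depends only on the size of its zero set.
open Classical in
theorem sum_isDistLabelling [Fintype V] (G : SimpleGraph V) (r X : ℕ) :
    (∑ d : V → Fin (r + 1), if IsDistLabelling G (fun v => (d v : ℕ)) then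
      ∏ v, (if (d v : ℕ) = 0 then X else 1) else 0) =
    ∑ K : Finset V, if IsDistCenter G r K then X ^ K.card else 0 := by
  rw [← Finset.sum_filter, ← Finset.sum_filter]
  refine Finset.sum_nbij (fun d => Finset.univ.filter fun v => (d v : ℕ) = 0) ?_ ?_ ?_ ?_
  · intro d hd
    rw [Finset.mem_filter] at hd ⊢
    exact ⟨Finset.mem_univ _, hd.2.isDistCenter fun v => Nat.lt_succ_iff.1 (d v).isLt⟩
  · intro d hd d' hd' h
    have hd := (Finset.mem_filter.1 (Finset.mem_coe.1 hd)).2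
    have hd' := (Finset.mem_filter.1 (Finset.mem_coe.1 hd')).2
    have := hd.ext hd' fun v => by
      have := Finset.ext_iff.1 h v
      simpa using this
    funext v
    exact Fin.ext (congrFun this v)
  · intro K hK
    have hK := (Finset.mem_filter.1 (Finset.mem_coe.1 hK)).2
    obtain ⟨d, hd, hr, h0⟩ := exists_isDistLabelling hK
    refine ⟨fun v => ⟨d v, Nat.lt_succ_iff.2 (hr v)⟩, ?_, ?_⟩
    · rw [Finset.mem_coe, Finset.mem_filter]
      exact ⟨Finset.mem_univ _, hd⟩
    · ext v
      simp [h0]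
  · intro d _
    rw [Finset.prod_ite, Finset.prod_const, Finset.prod_const_one, mul_one]

open Classical in
theorem numExactCenters_eq [Fintype V] (G : SimpleGraph V) (k r : ℕ) :
    numExactCenters G k r =
      (Finset.univ.filter fun K : Finset V => K.card = k ∧ IsDistCenter G r K).card := by
  unfold numExactCenters
  rw [Set.ncard_eq_toFinset_card']
  congr 1
  ext K
  simp

/-- Makes `2^(n+1)` a base in which each of the numbers to be extracted is a single digit. -/
theorem numExactCenters_lt [Fintype V] (G : SimpleGraph V) (k r : ℕ) :
    numExactCenters G k r < 2 ^ (Fintype.card V + 1) := by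
  classical
  rw [numExactCenters_eq]
  refine (Finset.card_filter_le _ _).trans_lt ?_
  rw [Finset.card_univ, Fintype.card_finset]
  exact Nat.pow_lt_pow_right (by norm_num) (Nat.lt_succ_self _)

theorem numExactCenters_eq_zero [Fintype V] (G : SimpleGraph V) (k r : ℕ)
    (h : Fintype.card V < k) : numExactCenters G k r = 0 := by
  classical
  rw [numExactCenters_eq, Finset.card_eq_zero, Finset.filter_eq_empty_iff]
  rintro K - ⟨h1, -⟩
  have := K.card_le_univ
  omega

open Classical in
theorem sum_numExactCenters_mul_pow [Fintype V] (G : SimpleGraph V) (r X : ℕ) :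
    ∑ s ∈ Finset.range (Fintype.card V + 1), numExactCenters G s r * X ^ s =
      ∑ d : V → Fin (r + 1), if IsDistLabelling G (fun v => (d v : ℕ)) then
          ∏ v, (if (d v : ℕ) = 0 then X else 1) else 0 := by
  have h := sum_isDistLabelling G r X
  refine Eq.trans ?_ h.symm
  rw [← Finset.sum_filter]
  rw [← Finset.sum_fiberwise_of_maps_to (s := Finset.univ.filter fun K => IsDistCenter G r K)
    (t := Finset.range (Fintype.card V + 1)) (g := Finset.card)]
  · refine Finset.sum_congr rfl fun s _ => ?_
    rw [numExactCenters_eq, Finset.filter_filter, Finset.card_eq_sum_ones, Finset.sum_mul]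
    refine Finset.sum_congr ?_ fun K hK => ?_
    · ext K; simp [and_comm]
    · rw [(Finset.mem_filter.1 hK).2.2, one_mul]
  · intro K _
    exact Finset.mem_range.2 (Nat.lt_succ_iff.2 K.card_le_univ)

theorem numCenters_eq_sum [Fintype V] (G : SimpleGraph V) (k r : ℕ) :
    numCenters G k r = ∑ s ∈ Finset.range (Fintype.card V + 1),
      if s ≤ k then numExactCenters G s r else 0 := by
  classical
  have h1 : numCenters G k r =
      (Finset.univ.filter fun K : Finset V => K.card ≤ k ∧ IsDistCenter G r K).card := by
    unfold numCenters
    rw [Set.ncard_eq_toFinset_card']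
    congr 1
    ext K
    simp
  rw [h1, Finset.card_eq_sum_card_fiberwise (t := Finset.range (Fintype.card V + 1))
    (f := Finset.card)]
  · refine Finset.sum_congr rfl fun s _ => ?_
    split_ifs with hs
    · rw [numExactCenters_eq, Finset.filter_filter]
      congr 1
      ext K
      simp only [Finset.mem_filter, Finset.mem_univ, true_and]
      constructor
      · rintro ⟨⟨-, h2⟩, h3⟩; exact ⟨h3, h2⟩
      · rintro ⟨h3, h2⟩; exact ⟨⟨by omega, h2⟩, h3⟩
    · rw [Finset.card_eq_zero, Finset.filter_filter, Finset.filter_eq_empty_iff]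
      rintro K - ⟨⟨h2, -⟩, h3⟩
      omega
  · intro K _
    simpa using Nat.lt_succ_iff.2 K.card_le_univ

/-- A finite distance is realised by a path, so it is less than the number of vertices. Without the
cap, sums over all values up to `r` could be exponentially long, since `r` is given in binary. -/
theorem isDistCenter_min_card [Fintype V] (G : SimpleGraph V) (r : ℕ) (K : Finset V) :
    IsDistCenter G (min r (Fintype.card V)) K ↔ IsDistCenter G r K := by
  have h : ∀ u v, G.edist u v ≤ ((min r (Fintype.card V) : ℕ) : ℕ∞) ↔ G.edist u v ≤ (r : ℕ∞) := by
    intro u v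
    constructor
    · intro h
      exact h.trans (by exact_mod_cast min_le_left _ _)
    · intro h
      classical
      obtain ⟨p, hp⟩ := SimpleGraph.exists_walk_of_edist_ne_top
        (ne_top_of_le_ne_top (ENat.natCast_ne_top r) h)
      have h1 : G.edist u v ≤ (Fintype.card V : ℕ∞) := by
        refine (SimpleGraph.edist_le p.bypass).trans ?_
        exact_mod_cast (p.bypass_isPath.length_lt).le
      have := le_min h h1
      exact_mod_cast this
  unfold IsDistCenter
  simp only [h]

theorem Iso.edist_le {W : Type*} {H : SimpleGraph W} (f : G ≃g H) (u v : V) :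
    H.edist (f u) (f v) ≤ G.edist u v := by
  by_cases h : G.edist u v = ⊤
  · rw [h]; exact le_top
  · obtain ⟨p, hp⟩ := SimpleGraph.exists_walk_of_edist_ne_top h
    rw [← hp]
    refine (SimpleGraph.edist_le (p.map f.toHom)).trans ?_
    simp

theorem IsDistCenter.iso {W : Type*} {H : SimpleGraph W} (f : G ≃g H) (r : ℕ) (K : Finset V) :
    IsDistCenter H r (K.map f.toEquiv.toEmbedding) ↔ IsDistCenter G r K := by
  have heq : ∀ u v, H.edist (f u) (f v) = G.edist u v := by
    intro u v
    refine le_antisymm (Iso.edist_le f u v) ?_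
    have := Iso.edist_le f.symm (f u) (f v)
    rwa [f.symm_apply_apply, f.symm_apply_apply] at this
  constructor
  · intro h u hu
    obtain ⟨w, hw, hwu⟩ := h (f u) (fun h => hu (by
      obtain ⟨x, hx, hxu⟩ := Finset.mem_map.1 h
      exact f.injective hxu ▸ hx))
    obtain ⟨v, hv, rfl⟩ := Finset.mem_map.1 hw
    exact ⟨v, hv, by rw [← heq]; exact hwu⟩
  · intro h u hu
    obtain ⟨u, rfl⟩ := f.surjective u
    obtain ⟨v, hv, hvu⟩ := h u (fun h => hu (Finset.mem_map.2 ⟨u, h, rfl⟩))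
    refine ⟨f v, Finset.mem_map.2 ⟨v, hv, rfl⟩, by rw [heq]; exact hvu⟩

theorem ncard_centers_iso {W : Type*} {H : SimpleGraph W} (f : G ≃g H) (r : ℕ) (p : ℕ → Prop) :
    Set.ncard {K : Finset V | p K.card ∧ IsDistCenter G r K} =
      Set.ncard {K : Finset W | p K.card ∧ IsDistCenter H r K} := by
  rw [← Set.ncard_image_of_injective _ (f.toEquiv.finsetCongr.injective)]
  congr 1
  ext K
  constructor
  · rintro ⟨K, ⟨h1, h2⟩, rfl⟩
    refine ⟨?_, (IsDistCenter.iso f r K).2 h2⟩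
    simpa [Equiv.finsetCongr] using h1
  · rintro ⟨h1, h2⟩
    obtain ⟨K, rfl⟩ := f.toEquiv.finsetCongr.surjective K
    refine ⟨K, ⟨?_, (IsDistCenter.iso f r K).1 h2⟩, rfl⟩
    simpa [Equiv.finsetCongr] using h1

theorem numCenters_iso {W : Type*} {H : SimpleGraph W} (f : G ≃g H) (k r : ℕ) :
    numCenters G k r = numCenters H k r := ncard_centers_iso f r (· ≤ k)

theorem numExactCenters_iso {W : Type*} {H : SimpleGraph W} (f : G ≃g H) (k r : ℕ) :
    numExactCenters G k r = numExactCenters H k r := ncard_centers_iso f r (· = k)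

theorem numExactCenters_min_card [Fintype V] (G : SimpleGraph V) (k r : ℕ) :
    numExactCenters G k (min r (Fintype.card V)) = numExactCenters G k r := by
  simp only [numExactCenters, isDistCenter_min_card]

end DistanceLabellings

/-! ### The count at the root, and injective relabellings -/

namespace CWExpr

variable {cw : ℕ}

/-- The upper bound `r + 1` is never attained, so no vertex is exempt and the partial labellings are
the distance labellings. -/
theorem count_eq_sum (r X : ℕ) (e : CWExpr cw) :
    count r X e (fun _ => (0, r + 1)) =
      ∑ s ∈ Finset.range (Fintype.card e.Vert + 1), numExactCenters e.graph s r * X ^ s := by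
  classical
  rw [sum_numExactCenters_mul_pow]
  unfold count
  refine Finset.sum_congr rfl fun d _ => ?_
  refine if_congr ⟨fun h => ⟨h.1, fun v => ?_⟩, fun h => ⟨h.1, fun v => ⟨Nat.zero_le _, ?_, ?_⟩⟩⟩
    rfl rfl
  · rcases (h.2 v).2.2 with h1 | h1
    · exact h1
    · have h2 : (d v : ℕ) = r + 1 := h1
      have := (d v).isLt
      omega
  · exact (d v).isLt.le
  · exact Or.inl (h.2 v)

/-- Replace the labels of an expression. -/
def map {c : ℕ} (ψ : Fin c → Fin cw) : CWExpr c → CWExpr cw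
  | intro l => intro (ψ l)
  | join a b e => join (ψ a) (ψ b) (e.map ψ)
  | rename a b e => rename (ψ a) (ψ b) (e.map ψ)
  | union e₁ e₂ => union (e₁.map ψ) (e₂.map ψ)

/-- Injectivity is essential: identifying two labels could let joins create additional edges. -/
theorem exists_map_equiv {c : ℕ} (ψ : Fin c → Fin cw) (hψ : Function.Injective ψ) :
    ∀ e : CWExpr c, ∃ f : e.Vert ≃ (e.map ψ).Vert, (∀ v, (e.map ψ).label (f v) = ψ (e.label v)) ∧
      ∀ u v, (e.map ψ).graph.Adj (f u) (f v) ↔ e.graph.Adj u v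
  | intro l => ⟨Equiv.refl Unit, fun _ => rfl, fun _ _ => Iff.rfl⟩
  | join a b e => by
    obtain ⟨f, h1, h2⟩ := exists_map_equiv ψ hψ e
    refine ⟨f, h1, fun (u v : e.Vert) => ?_⟩
    refine (join_adj (ψ a) (ψ b) (e.map ψ) (f u) (f v)).trans
      (Iff.trans ?_ (join_adj a b e u v).symm)
    rw [h2, h1, h1, hψ.eq_iff, hψ.eq_iff, hψ.eq_iff, hψ.eq_iff, f.injective.ne_iff]
  | rename a b e => by
    obtain ⟨f, h1, h2⟩ := exists_map_equiv ψ hψ e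
    refine ⟨f, fun (v : e.Vert) => ?_, h2⟩
    change (if (e.map ψ).label (f v) = ψ a then ψ b else (e.map ψ).label (f v)) =
      ψ (if e.label v = a then b else e.label v)
    simp only [h1, hψ.eq_iff, apply_ite ψ]
  | union e₁ e₂ => by
    obtain ⟨f₁, h1, h2⟩ := exists_map_equiv ψ hψ e₁
    obtain ⟨f₂, h3, h4⟩ := exists_map_equiv ψ hψ e₂
    refine ⟨Equiv.sumCongr f₁ f₂, ?_, ?_⟩
    · rintro (v | v)
      · exact h1 v
      · exact h3 v
    · rintro (u | u) (v | v)
      · exact h2 u v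
      · exact Iff.rfl
      · exact Iff.rfl
      · exact h4 u v

theorem nonempty_map_iso {c : ℕ} (ψ : Fin c → Fin cw) (hψ : Function.Injective ψ) (e : CWExpr c) :
    Nonempty (e.graph ≃g (e.map ψ).graph) := by
  obtain ⟨f, -, h⟩ := exists_map_equiv ψ hψ e
  exact ⟨⟨f, fun {u v} => h u v⟩⟩

end CWExpr


namespace RAM

/-! ### Lengths -/

theorem one_le_len (z : ℤ) : 1 ≤ len z := Nat.le_add_left _ _

theorem len_le_of_abs_lt {z : ℤ} {n : ℕ} (h : z.natAbs < 2 ^ n) : len z ≤ n + 1 :=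
  Nat.succ_le_succ (Nat.size_le.2 h)

theorem natAbs_lt_two_pow (z : ℤ) : z.natAbs < 2 ^ (len z - 1) := Nat.size_le.1 le_rfl

theorem len_natCast_le (n : ℕ) : len (n : ℤ) ≤ n + 1 :=
  len_le_of_abs_lt (by simpa using Nat.lt_two_pow_self)

theorem len_le_of_natAbs_le {x y : ℤ} (h : x.natAbs ≤ y.natAbs) : len x ≤ len y :=
  Nat.succ_le_succ (Nat.size_le_size h)

theorem len_add_le (x y : ℤ) : len (x + y) ≤ len x + len y := by
  have hx := natAbs_lt_two_pow x
  have hy := natAbs_lt_two_pow y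
  have h1 := one_le_len x
  have h2 := one_le_len y
  have h3 : 2 ^ (len x - 1) ≤ 2 ^ (len x + len y - 2) := Nat.pow_le_pow_right (by norm_num) (by omega)
  have h4 : 2 ^ (len y - 1) ≤ 2 ^ (len x + len y - 2) := Nat.pow_le_pow_right (by norm_num) (by omega)
  have h5 : (x + y).natAbs < 2 ^ (len x + len y - 2 + 1) := by
    rw [pow_succ]
    have := Int.natAbs_add_le x y
    omega
  have := len_le_of_abs_lt h5
  omega

theorem len_neg (x : ℤ) : len (-x) = len x := by unfold len; rw [Int.natAbs_neg]

theorem len_sub_le (x y : ℤ) : len (x - y) ≤ len x + len y := by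
  rw [sub_eq_add_neg, ← len_neg y]
  exact len_add_le _ _

theorem len_mul_le (x y : ℤ) : len (x * y) ≤ len x + len y := by
  have hx := natAbs_lt_two_pow x
  have hy := natAbs_lt_two_pow y
  have h1 := one_le_len x
  have h2 := one_le_len y
  have h5 : (x * y).natAbs < 2 ^ (len x - 1 + (len y - 1)) := by
    rw [Int.natAbs_mul, pow_add]
    exact Nat.mul_lt_mul'' hx hy
  have := len_le_of_abs_lt h5
  omega

theorem len_div_le (x y : ℤ) : len (x / y) ≤ len x :=
  len_le_of_natAbs_le (Int.natAbs_ediv_le_natAbs x y)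

theorem len_eval_le (o : ArithOp) (x y : ℤ) : len (o.eval x y) ≤ len x + len y := by
  cases o
  · exact len_add_le x y
  · exact len_sub_le x y
  · exact len_mul_le x y
  · exact (len_div_le x y).trans (Nat.le_add_right _ _)

theorem len_sum_le (n q : ℕ) (f : ℕ → ℤ) (h : ∀ j < n, len (f j) ≤ q) :
    len (∑ j ∈ Finset.range n, f j) ≤ n * q + 1 := by
  induction n with
  | zero => simp [len]
  | succ n ih =>
    rw [Finset.sum_range_succ, Nat.succ_mul]
    have h1 := ih fun j hj => h j (by omega)
    have h2 := h n (by omega)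
    have := len_add_le (∑ j ∈ Finset.range n, f j) (f n)
    omega

/-! ### Array states -/

/-- A view of the memory as scalar variables and sixteen arrays. -/
structure AState where
  var : ℕ → ℤ
  arr : Fin 16 → ℕ → ℤ
  inp : List ℤ
  out : List ℤ

def AState.setVar (a : AState) (x : ℕ) (z : ℤ) : AState :=
  { a with var := Function.update a.var x z }

def AState.setArr (a : AState) (t : Fin 16) (f : ℕ → ℤ) : AState :=
  { a with arr := Function.update a.arr t f }

/-- All contents of an array state have length at most `Z`. -/
structure Bdd (Z : ℕ) (a : AState) : Prop where
  var : ∀ x, len (a.var x) ≤ Z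
  arr : ∀ t i, len (a.arr t i) ≤ Z
  inp : ∀ z ∈ a.inp, len z ≤ Z

/-- The machine state `s` represents the array state `a`: variables, temporary registers and array
entries are interleaved. -/
structure Sim (a : AState) (s : State) : Prop where
  var : ∀ x, s.mem (3 * x) = a.var x
  arr : ∀ (t : Fin 16) i, s.mem (3 * (16 * i + t) + 2) = a.arr t i
  inp : s.inp = a.inp
  out : s.out = a.out

theorem store_reg_mem (s : State) (x y : ℕ) (z : ℤ) :
    (s.store (Dest.reg x) z).mem y = if y = x then z else s.mem y := by
  simp [State.store, Dest.addr, Function.update_apply]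

theorem Sim.store_temp {a : AState} {s : State} (h : Sim a s) (d : ℕ) (z : ℤ) :
    Sim a (s.store (Dest.reg (3 * d + 1)) z) where
  var x := by rw [store_reg_mem, if_neg (by omega), h.var]
  arr t i := by rw [store_reg_mem, if_neg (by omega), h.arr]
  inp := h.inp
  out := h.out

/-! ### Expressions -/

/-- Expressions with bounded sums; `loc` is the summation index of the innermost sum. -/
inductive Ex : Type
  | c (z : ℤ)
  | v (x : ℕ)
  | loc
  | op (o : ArithOp) (e f : Ex)
  | arr (t : Fin 16) (e : Ex)
  | ifle (e f p q : Ex)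
  | sum (n e : Ex)

namespace Ex

/-- Within a sum, `loc` is rebound to the new index. The value for a negative array index mirrors
the machine: the computed address is negative, is read as address 0, and register 0 holds variable
0. -/
def eval (a : AState) : Ex → ℤ → ℤ
  | c z, _ => z
  | v x, _ => a.var x
  | loc, y => y
  | op o e f, y => o.eval (e.eval a y) (f.eval a y)
  | arr t e, y => if 0 ≤ e.eval a y then a.arr t (e.eval a y).toNat else a.var 0
  | ifle e f p q, y => if e.eval a y ≤ f.eval a y then p.eval a y else q.eval a y
  | sum n e, y => ∑ j ∈ Finset.range (n.eval a y).toNat, e.eval a j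

/-- All sums have at most `Z` terms. -/
def lim (Z : ℕ) (a : AState) : Ex → ℤ → Prop
  | c _, _ => True
  | v _, _ => True
  | loc, _ => True
  | op _ e f, y => e.lim Z a y ∧ f.lim Z a y
  | arr _ e, y => e.lim Z a y
  | ifle e f p q, y => e.lim Z a y ∧ f.lim Z a y ∧ p.lim Z a y ∧ q.lim Z a y
  | sum n e, y => n.lim Z a y ∧ (n.eval a y).toNat ≤ Z ∧
      ∀ j < (n.eval a y).toNat, e.lim Z a (j : ℕ)

/-- Code that leaves the value of an expression in temporary register `d`; the summation index is
found in temporary register `l`. -/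
def code : Ex → ℕ → ℕ → Prog
  | c z, _, d => .move (.reg (3 * d + 1)) (.const z)
  | v x, _, d => .move (.reg (3 * d + 1)) (.reg (3 * x))
  | loc, l, d => .move (.reg (3 * d + 1)) (.reg (3 * l + 1))
  | op o e f, l, d => .seq (e.code l d) (.seq (f.code l (d + 1))
      (.arith o (.reg (3 * d + 1)) (.reg (3 * d + 1)) (.reg (3 * (d + 1) + 1))))
  | arr t e, l, d => .seq (e.code l d)
      (.seq (.arith .mul (.reg (3 * d + 1)) (.reg (3 * d + 1)) (.const 48))
      (.seq (.arith .add (.reg (3 * d + 1)) (.reg (3 * d + 1)) (.const (3 * (t : ℕ) + 2 : ℕ)))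
        (.move (.reg (3 * d + 1)) (.ind (3 * d + 1)))))
  | ifle e f p q, l, d => .seq (e.code l d) (.seq (f.code l (d + 1))
      (.ite (.le (.reg (3 * d + 1)) (.reg (3 * (d + 1) + 1))) (p.code l d) (q.code l d)))
  | sum n e, l, d => .seq (n.code l d) (.seq (.move (.reg (3 * (d + 1) + 1)) (.const 0))
      (.seq (.loop (.le (.const 1) (.reg (3 * d + 1)))
        (.seq (.arith .sub (.reg (3 * d + 1)) (.reg (3 * d + 1)) (.const 1))
        (.seq (e.code d (d + 2))
          (.arith .add (.reg (3 * (d + 1) + 1)) (.reg (3 * (d + 1) + 1))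
            (.reg (3 * (d + 2) + 1))))))
      (.move (.reg (3 * d + 1)) (.reg (3 * (d + 1) + 1)))))

/-- Variables and array entries have length at most `Z`, an operation at most adds lengths, and a
sum of at most `Z` terms at most multiplies the length by `Z` up to an additive 1. The degree
depends only on the expression. -/
theorem exists_len_eval_le (e : Ex) : ∃ Q : Polynomial ℕ, ∀ (Z : ℕ) (a : AState) (y : ℤ),
    Bdd Z a → len y ≤ Z → e.lim Z a y → len (e.eval a y) ≤ Q.eval Z := by
  induction e with
  | c z => exact ⟨Polynomial.C (len z), fun Z a y _ _ _ => by simp [eval]⟩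
  | v x => exact ⟨Polynomial.X, fun Z a y h _ _ => by simpa [eval] using h.var x⟩
  | loc => exact ⟨Polynomial.X, fun Z a y _ h _ => by simpa [eval] using h⟩
  | op o e f he hf =>
    obtain ⟨Q₁, h₁⟩ := he
    obtain ⟨Q₂, h₂⟩ := hf
    refine ⟨Q₁ + Q₂, fun Z a y h hy hl => ?_⟩
    rw [Polynomial.eval_add]
    exact (len_eval_le _ _ _).trans (Nat.add_le_add (h₁ Z a y h hy hl.1) (h₂ Z a y h hy hl.2))
  | arr t e he =>
    refine ⟨Polynomial.X, fun Z a y h hy hl => ?_⟩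
    simp only [eval, Polynomial.eval_X]
    split_ifs
    · exact h.arr _ _
    · exact h.var _
  | ifle e f p q _ _ hp hq =>
    obtain ⟨Q₁, h₁⟩ := hp
    obtain ⟨Q₂, h₂⟩ := hq
    refine ⟨Q₁ + Q₂, fun Z a y h hy hl => ?_⟩
    have h3 := h₁ Z a y h hy hl.2.2.1
    have h4 := h₂ Z a y h hy hl.2.2.2
    simp only [eval, Polynomial.eval_add]
    split_ifs <;> omega
  | sum n e _ he =>
    obtain ⟨Q, hQ⟩ := he
    refine ⟨Polynomial.X * Q + 1, fun Z a y h hy hl => ?_⟩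
    obtain ⟨-, h1, h2⟩ := hl
    simp only [eval, Polynomial.eval_add, Polynomial.eval_mul, Polynomial.eval_X,
      Polynomial.eval_one]
    refine (len_sum_le _ (Q.eval Z) _ fun j hj => ?_).trans
      (Nat.add_le_add_right (Nat.mul_le_mul_right _ h1) 1)
    exact hQ Z a j h ((len_natCast_le j).trans (by omega)) (h2 j hj)

/-- `s'` arises from `s` by computing the value `z` into temporary register `d`. -/
structure Result (a : AState) (d : ℕ) (z : ℤ) (s s' : State) : Prop where
  sim : Sim a s'
  val : s'.mem (3 * d + 1) = z
  old : ∀ d' < d, s'.mem (3 * d' + 1) = s.mem (3 * d' + 1)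

/-- The code of `e` computes its value at a cost of at most `P.eval Z`. -/
def HasCost (e : Ex) (l d : ℕ) (P : Polynomial ℕ) : Prop :=
  ∀ (Z : ℕ) (a : AState) (y : ℤ) (s : State), Bdd Z a → len y ≤ Z → e.lim Z a y → Sim a s →
    s.mem (3 * l + 1) = y →
      ∃ t s', Runs (e.code l d) s t s' ∧ t ≤ P.eval Z ∧ Result a d (e.eval a y) s s'

/-- Temporary `d` counts the remaining terms and, after being decremented, is the summation index;
temporary `d + 1` accumulates. Here `q` bounds the length of each term and `W` that of the
accumulator in all rounds. -/
theorem runs_sum_loop (e : Ex) (d : ℕ) (P : Polynomial ℕ) (hP : e.HasCost d (d + 2) P)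
    (Z : ℕ) (a : AState) (ha : Bdd Z a) (q W : ℕ) (n : ℕ) :
    ∀ (s : State) (z : ℤ), n ≤ Z → (∀ j < n, e.lim Z a (j : ℕ)) →
      (∀ j < n, len (e.eval a (j : ℕ)) ≤ q) → q ≤ W → len z + n * q ≤ W → Sim a s →
      s.mem (3 * d + 1) = n → s.mem (3 * (d + 1) + 1) = z →
      ∃ t s', Runs (.loop (.le (.const 1) (.reg (3 * d + 1)))
        (.seq (.arith .sub (.reg (3 * d + 1)) (.reg (3 * d + 1)) (.const 1))
        (.seq (e.code d (d + 2))
          (.arith .add (.reg (3 * (d + 1) + 1)) (.reg (3 * (d + 1) + 1))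
            (.reg (3 * (d + 2) + 1)))))) s t s' ∧
        t ≤ (n + 1) * (P.eval Z + 3 * Z + 3 * W + 10 * len ((3 * d + 7 : ℕ) : ℤ) + 15) ∧
        Sim a s' ∧ s'.mem (3 * (d + 1) + 1) = z + ∑ j ∈ Finset.range n, e.eval a (j : ℕ) ∧
        ∀ d' < d, s'.mem (3 * d' + 1) = s.mem (3 * d' + 1) := by
  have hlen1 : len 1 = 2 := by decide
  have hmono : ∀ x y : ℕ, x ≤ y → len (x : ℤ) ≤ len (y : ℤ) := fun x y h =>
    len_le_of_natAbs_le (by simpa using h)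
  have hm1 := hmono (3 * d + 1) (3 * d + 7) (by omega)
  have hm2 := hmono (3 * (d + 1) + 1) (3 * d + 7) (by omega)
  have hm3 := hmono (3 * (d + 2) + 1) (3 * d + 7) (by omega)
  induction n with
  | zero =>
    intro s z _ _ _ _ _ hs hn hz
    refine ⟨_, s, Runs.loop_false ?_, ?_, hs, by simpa using hz, fun _ _ => rfl⟩
    · simp [Test.holds, Operand.val, hn]
    · simp only [Test.cost, Operand.cost, hn, hlen1]
      have : len ((0 : ℕ) : ℤ) = 1 := by decide
      rw [this]
      omega
  | succ n ih =>
    intro s z hnZ hlim hlen hqW hW hs hn hz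
    set s₁ := s.store (Dest.reg (3 * d + 1)) (n : ℤ) with hs₁
    have r1 : Runs (.arith .sub (.reg (3 * d + 1)) (.reg (3 * d + 1)) (.const 1)) s
        (1 + (len ((3 * d + 1 : ℕ) : ℤ) + len ((n + 1 : ℕ) : ℤ)) + 2 + len ((3 * d + 1 : ℕ) : ℤ)
          + len (n : ℤ)) s₁ := by
      have := Runs.arith .sub (.reg (3 * d + 1)) (.reg (3 * d + 1)) (.const 1) s
      simp only [Operand.cost, Operand.val, Dest.cost, ArithOp.eval, hn, hlen1] at this
      have h1 : ((n + 1 : ℕ) : ℤ) - 1 = n := by push_cast; ring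
      rw [h1] at this
      exact this
    have hl1 := len_natCast_le n
    have hl2 := len_natCast_le (n + 1)
    obtain ⟨t₂, s₂, r2, ht₂, hr⟩ := hP Z a (n : ℤ) s₁ ha (by omega) (hlim n (by omega))
      (hs.store_temp _ _) (by rw [hs₁, store_reg_mem, if_pos rfl])
    have hz₂ : s₂.mem (3 * (d + 1) + 1) = z := by
      rw [hr.old (d + 1) (by omega), hs₁, store_reg_mem, if_neg (by omega), hz]
    have hn₂ : s₂.mem (3 * d + 1) = n := by
      rw [hr.old d (by omega), hs₁, store_reg_mem, if_pos rfl]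
    set s₃ := s₂.store (Dest.reg (3 * (d + 1) + 1)) (z + e.eval a (n : ℤ)) with hs₃
    have r3 : Runs (.arith .add (.reg (3 * (d + 1) + 1)) (.reg (3 * (d + 1) + 1))
        (.reg (3 * (d + 2) + 1))) s₂ (1 + (len ((3 * (d + 1) + 1 : ℕ) : ℤ) + len z) +
          (len ((3 * (d + 2) + 1 : ℕ) : ℤ) + len (e.eval a (n : ℤ))) +
          len ((3 * (d + 1) + 1 : ℕ) : ℤ) + len (z + e.eval a (n : ℤ))) s₃ := by
      have := Runs.arith .add (.reg (3 * (d + 1) + 1)) (.reg (3 * (d + 1) + 1))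
        (.reg (3 * (d + 2) + 1)) s₂
      simp only [Operand.cost, Operand.val, Dest.cost, ArithOp.eval, hz₂, hr.val] at this
      exact this
    have hq := hlen n (by omega)
    have hadd := len_add_le z (e.eval a (n : ℤ))
    rw [Nat.succ_mul] at hW
    obtain ⟨t₄, s₄, r4, ht₄, hs₄, hv₄, ho₄⟩ := ih s₃ (z + e.eval a (n : ℤ)) (by omega)
      (fun j hj => hlim j (by omega)) (fun j hj => hlen j (by omega)) hqW (by omega)
      (hr.sim.store_temp _ _) (by rw [hs₃, store_reg_mem, if_neg (by omega), hn₂])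
      (by rw [hs₃, store_reg_mem, if_pos rfl])
    refine ⟨_, s₄, Runs.loop_true ?_ (Runs.seq r1 (Runs.seq r2 r3)) r4, ?_, hs₄, ?_, ?_⟩
    · simp only [Test.holds, Operand.val, hn]; push_cast; omega
    · simp only [Test.cost, Operand.cost, hn, hlen1]
      rw [Nat.succ_mul (n + 1)]
      omega
    · rw [hv₄, Finset.sum_range_succ]; ring
    · intro d' hd'
      rw [ho₄ d' hd', hs₃, store_reg_mem, if_neg (by omega), hr.old d' (by omega), hs₁,
        store_reg_mem, if_neg (by omega)]

/-- Subexpressions only write to temporaries from their own number on, so earlier operands survive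
the evaluation of later ones. The condition `l < d` protects the current summation index. -/
theorem exists_hasCost (e : Ex) : ∀ l d, l < d → ∃ P : Polynomial ℕ, e.HasCost l d P := by
  induction e with
  | c z =>
    intro l d _
    refine ⟨Polynomial.C (1 + len z + len ((3 * d + 1 : ℕ) : ℤ) + len z),
      fun Z a y s _ _ _ hs _ => ⟨_, _, Runs.move _ _ _, ?_, hs.store_temp _ _, ?_, ?_⟩⟩
    · simp [Operand.cost, Operand.val, Dest.cost]
    · rw [store_reg_mem, if_pos rfl]; rfl
    · intro d' hd'; rw [store_reg_mem, if_neg (by omega)]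
  | v x =>
    intro l d _
    refine ⟨Polynomial.C (1 + len ((3 * x : ℕ) : ℤ) + len ((3 * d + 1 : ℕ) : ℤ)) +
      Polynomial.X + Polynomial.X,
      fun Z a y s ha _ _ hs _ => ⟨_, _, Runs.move _ _ _, ?_, hs.store_temp _ _, ?_, ?_⟩⟩
    · have := ha.var x
      simp only [Operand.cost, Operand.val, Dest.cost, hs.var, Polynomial.eval_add,
        Polynomial.eval_C, Polynomial.eval_X]
      omega
    · rw [store_reg_mem, if_pos rfl]; exact hs.var x
    · intro d' hd'; rw [store_reg_mem, if_neg (by omega)]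
  | loc =>
    intro l d _
    refine ⟨Polynomial.C (1 + len ((3 * l + 1 : ℕ) : ℤ) + len ((3 * d + 1 : ℕ) : ℤ)) +
      Polynomial.X + Polynomial.X,
      fun Z a y s ha hy _ hs hl => ⟨_, _, Runs.move _ _ _, ?_, hs.store_temp _ _, ?_, ?_⟩⟩
    · simp only [Operand.cost, Operand.val, Dest.cost, hl, Polynomial.eval_add,
        Polynomial.eval_C, Polynomial.eval_X]
      omega
    · rw [store_reg_mem, if_pos rfl]; exact hl
    · intro d' hd'; rw [store_reg_mem, if_neg (by omega)]
  | op o e f he hf =>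
    intro l d hld
    obtain ⟨P₁, h₁⟩ := he l d hld
    obtain ⟨P₂, h₂⟩ := hf l (d + 1) (by omega)
    obtain ⟨Q₁, q₁⟩ := e.exists_len_eval_le
    obtain ⟨Q₂, q₂⟩ := f.exists_len_eval_le
    refine ⟨P₁ + P₂ + Q₁ + Q₂ + Q₁ + Q₂ + Polynomial.C (1 + len ((3 * d + 1 : ℕ) : ℤ) +
      len ((3 * (d + 1) + 1 : ℕ) : ℤ) + len ((3 * d + 1 : ℕ) : ℤ)), fun Z a y s ha hy hl hs hy' => ?_⟩
    obtain ⟨t₁, s₁, r1, ht₁, hr₁⟩ := h₁ Z a y s ha hy hl.1 hs hy'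
    obtain ⟨t₂, s₂, r2, ht₂, hr₂⟩ := h₂ Z a y s₁ ha hy hl.2 hr₁.sim (by rw [hr₁.old l hld, hy'])
    have hv : s₂.mem (3 * d + 1) = e.eval a y := by rw [hr₂.old d (by omega), hr₁.val]
    refine ⟨_, _, Runs.seq r1 (Runs.seq r2 (Runs.arith _ _ _ _ _)), ?_, hr₂.sim.store_temp _ _,
      ?_, ?_⟩
    · have h3 := q₁ Z a y ha hy hl.1
      have h4 := q₂ Z a y ha hy hl.2
      have h5 := len_eval_le o (e.eval a y) (f.eval a y)
      simp only [Operand.cost, Operand.val, Dest.cost, hv, hr₂.val, Polynomial.eval_add,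
        Polynomial.eval_C]
      omega
    · rw [store_reg_mem, if_pos rfl]
      simp only [Operand.val, hv, hr₂.val]
      rfl
    · intro d' hd'
      rw [store_reg_mem, if_neg (by omega), hr₂.old d' (by omega), hr₁.old d' hd']
  | arr t e he =>
    intro l d hld
    obtain ⟨P₁, h₁⟩ := he l d hld
    obtain ⟨Q₁, q₁⟩ := e.exists_len_eval_le
    refine ⟨P₁ + Polynomial.C 10 * Q₁ + Polynomial.C 3 * Polynomial.X + Polynomial.C
      (10 * len ((3 * d + 1 : ℕ) : ℤ) + 10 * len ((3 * (t : ℕ) + 2 : ℕ) : ℤ) + 10 * len 48 + 10),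
      fun Z a y s ha hy hl hs hy' => ?_⟩
    obtain ⟨t₁, s₁, r1, ht₁, hr₁⟩ := h₁ Z a y s ha hy hl hs hy'
    have h3 := q₁ Z a y ha hy hl
    have hev : (Ex.arr t e).eval a y =
        if 0 ≤ e.eval a y then a.arr t (e.eval a y).toNat else a.var 0 := rfl
    have hv₁ := hr₁.val
    have ho₁ := hr₁.old
    have hsim₁ := hr₁.sim
    clear hr₁
    generalize e.eval a y = i at h3 hev hv₁
    set s₂ := s₁.store (Dest.reg (3 * d + 1)) (i * 48) with hs₂
    have r2 : Runs (.arith .mul (.reg (3 * d + 1)) (.reg (3 * d + 1)) (.const 48)) s₁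
        (1 + (len ((3 * d + 1 : ℕ) : ℤ) + len i) + len 48 + len ((3 * d + 1 : ℕ) : ℤ)
          + len (i * 48)) s₂ := by
      have := Runs.arith .mul (.reg (3 * d + 1)) (.reg (3 * d + 1)) (.const 48) s₁
      simp only [Operand.cost, Operand.val, Dest.cost, ArithOp.eval, hv₁] at this
      exact this
    have hv₂ : s₂.mem (3 * d + 1) = i * 48 := by rw [hs₂, store_reg_mem, if_pos rfl]
    set s₃ := s₂.store (Dest.reg (3 * d + 1)) (i * 48 + (3 * (t : ℕ) + 2 : ℕ)) with hs₃
    have r3 : Runs (.arith .add (.reg (3 * d + 1)) (.reg (3 * d + 1))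
        (.const (3 * (t : ℕ) + 2 : ℕ))) s₂
        (1 + (len ((3 * d + 1 : ℕ) : ℤ) + len (i * 48)) + len ((3 * (t : ℕ) + 2 : ℕ) : ℤ)
          + len ((3 * d + 1 : ℕ) : ℤ) + len (i * 48 + (3 * (t : ℕ) + 2 : ℕ))) s₃ := by
      have := Runs.arith .add (.reg (3 * d + 1)) (.reg (3 * d + 1))
        (.const (3 * (t : ℕ) + 2 : ℕ)) s₂
      simp only [Operand.cost, Operand.val, Dest.cost, ArithOp.eval, hv₂] at this
      exact this
    have hv₃ : s₃.mem (3 * d + 1) = i * 48 + (3 * (t : ℕ) + 2 : ℕ) := by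
      rw [hs₃, store_reg_mem, if_pos rfl]
    have hsim₃ : Sim a s₃ := (hsim₁.store_temp _ _).store_temp _ _
    have hval : s₃.mem (i * 48 + (3 * (t : ℕ) + 2 : ℕ)).toNat = (Ex.arr t e).eval a y := by
      -- There are sixteen arrays, so `3 * t + 2 < 48`; a negative index therefore gives a negative
      -- address.
      have ht := t.isLt
      rw [hev]
      split_ifs with h0
      · rw [← hsim₃.arr]
        congr 1
        omega
      · rw [← hsim₃.var]
        congr 1
        omega
    refine ⟨_, _, Runs.seq r1 (Runs.seq r2 (Runs.seq r3 (Runs.move _ _ _))), ?_,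
      hsim₃.store_temp _ _, ?_, ?_⟩
    · have h4 := len_mul_le i 48
      have h5 := len_add_le (i * 48) ((3 * (t : ℕ) + 2 : ℕ) : ℤ)
      have h6 : len ((Ex.arr t e).eval a y) ≤ Z := by
        rw [hev]
        split_ifs
        · exact ha.arr _ _
        · exact ha.var _
      simp only [Operand.cost, Operand.val, Dest.cost, hv₃, hval, Polynomial.eval_add,
        Polynomial.eval_C, Polynomial.eval_mul, Polynomial.eval_X]
      omega
    · rw [store_reg_mem, if_pos rfl]
      simp only [Operand.val, hv₃, hval]
    · intro d' hd'
      rw [store_reg_mem, if_neg (by omega), hs₃, store_reg_mem, if_neg (by omega), hs₂,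
        store_reg_mem, if_neg (by omega), ho₁ d' hd']
  | ifle e f p q he hf hp hq =>
    intro l d hld
    obtain ⟨P₁, h₁⟩ := he l d hld
    obtain ⟨P₂, h₂⟩ := hf l (d + 1) (by omega)
    obtain ⟨P₃, h₃⟩ := hp l d hld
    obtain ⟨P₄, h₄⟩ := hq l d hld
    obtain ⟨Q₁, q₁⟩ := e.exists_len_eval_le
    obtain ⟨Q₂, q₂⟩ := f.exists_len_eval_le
    refine ⟨P₁ + P₂ + P₃ + P₄ + Q₁ + Q₂ + Polynomial.C (1 + len ((3 * d + 1 : ℕ) : ℤ) +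
      len ((3 * (d + 1) + 1 : ℕ) : ℤ)), fun Z a y s ha hy hl hs hy' => ?_⟩
    obtain ⟨hl1, hl2, hl3, hl4⟩ := hl
    obtain ⟨t₁, s₁, r1, ht₁, hr₁⟩ := h₁ Z a y s ha hy hl1 hs hy'
    obtain ⟨t₂, s₂, r2, ht₂, hr₂⟩ := h₂ Z a y s₁ ha hy hl2 hr₁.sim (by rw [hr₁.old l hld, hy'])
    have hv : s₂.mem (3 * d + 1) = e.eval a y := by rw [hr₂.old d (by omega), hr₁.val]
    have hy₂ : s₂.mem (3 * l + 1) = y := by rw [hr₂.old l (by omega), hr₁.old l hld, hy']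
    have h5 := q₁ Z a y ha hy hl1
    have h6 := q₂ Z a y ha hy hl2
    by_cases hc : e.eval a y ≤ f.eval a y
    · obtain ⟨t₃, s₃, r3, ht₃, hr₃⟩ := h₃ Z a y s₂ ha hy hl3 hr₂.sim hy₂
      refine ⟨_, _, Runs.seq r1 (Runs.seq r2 (Runs.ite_true ?_ r3)), ?_, hr₃.sim, ?_, ?_⟩
      · simpa only [Test.holds, Operand.val, hv, hr₂.val] using hc
      · simp only [Test.cost, Operand.cost, hv, hr₂.val, Polynomial.eval_add, Polynomial.eval_C]
        omega
      · rw [hr₃.val]; simp only [eval]; rw [if_pos hc]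
      · intro d' hd'
        rw [hr₃.old d' hd', hr₂.old d' (by omega), hr₁.old d' hd']
    · obtain ⟨t₃, s₃, r3, ht₃, hr₃⟩ := h₄ Z a y s₂ ha hy hl4 hr₂.sim hy₂
      refine ⟨_, _, Runs.seq r1 (Runs.seq r2 (Runs.ite_false ?_ r3)), ?_, hr₃.sim, ?_, ?_⟩
      · simpa only [Test.holds, Operand.val, hv, hr₂.val] using hc
      · simp only [Test.cost, Operand.cost, hv, hr₂.val, Polynomial.eval_add, Polynomial.eval_C]
        omega
      · rw [hr₃.val]; simp only [eval]; rw [if_neg hc]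
      · intro d' hd'
        rw [hr₃.old d' hd', hr₂.old d' (by omega), hr₁.old d' hd']
  | sum n e hn he =>
    intro l d hld
    obtain ⟨P₁, h₁⟩ := hn l d hld
    obtain ⟨P₂, h₂⟩ := he d (d + 2) (by omega)
    obtain ⟨Q₁, q₁⟩ := n.exists_len_eval_le
    obtain ⟨Q₂, q₂⟩ := e.exists_len_eval_le
    refine ⟨P₁ + (Polynomial.X + 1) * (P₂ + Polynomial.C 3 * Polynomial.X +
      Polynomial.C 3 * (Polynomial.X * Q₂ + Q₂ + 2) +
      Polynomial.C (10 * len ((3 * d + 7 : ℕ) : ℤ)) + Polynomial.C 15) +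
      Polynomial.C 2 * (Polynomial.X * Q₂ + Q₂ + 2) + Q₁ +
      Polynomial.C (10 + 5 * len ((3 * d + 1 : ℕ) : ℤ) + 5 * len ((3 * (d + 1) + 1 : ℕ) : ℤ)),
      fun Z a y s ha hy hl hs hy' => ?_⟩
    obtain ⟨hl1, hl2, hl3⟩ := hl
    obtain ⟨t₁, s₁, r1, ht₁, hr₁⟩ := h₁ Z a y s ha hy hl1 hs hy'
    set s₂ := s₁.store (Dest.reg (3 * (d + 1) + 1)) 0 with hs₂
    have hlen0 : len 0 = 1 := by decide
    have r2 : Runs (.move (.reg (3 * (d + 1) + 1)) (.const 0)) s₁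
        (1 + 1 + len ((3 * (d + 1) + 1 : ℕ) : ℤ) + 1) s₂ := by
      have := Runs.move (.reg (3 * (d + 1) + 1)) (.const 0) s₁
      simp only [Operand.cost, Operand.val, Dest.cost, hlen0] at this
      exact this
    set N := (n.eval a y).toNat with hN
    have hq : ∀ j < N, len (e.eval a (j : ℕ)) ≤ Q₂.eval Z := fun j hj =>
      q₂ Z a j ha ((len_natCast_le j).trans (by omega)) (hl3 j hj)
    have hNZ : N * Q₂.eval Z ≤ Z * Q₂.eval Z := Nat.mul_le_mul_right _ hl2
    have hn₂ : s₂.mem (3 * d + 1) = n.eval a y := by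
      rw [hs₂, store_reg_mem, if_neg (by omega), hr₁.val]
    have key : ∃ t s', Runs (.loop (.le (.const 1) (.reg (3 * d + 1)))
        (.seq (.arith .sub (.reg (3 * d + 1)) (.reg (3 * d + 1)) (.const 1))
        (.seq (e.code d (d + 2))
          (.arith .add (.reg (3 * (d + 1) + 1)) (.reg (3 * (d + 1) + 1))
            (.reg (3 * (d + 2) + 1)))))) s₂ t s' ∧
        t ≤ (Z + 1) * (P₂.eval Z + 3 * Z + 3 * (Z * Q₂.eval Z + Q₂.eval Z + 2) +
          10 * len ((3 * d + 7 : ℕ) : ℤ) + 15) + Q₁.eval Z ∧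
        Sim a s' ∧ s'.mem (3 * (d + 1) + 1) = 0 + ∑ j ∈ Finset.range N, e.eval a (j : ℕ) ∧
        ∀ d' < d, s'.mem (3 * d' + 1) = s₂.mem (3 * d' + 1) := by
      -- A negative number of terms fails the loop test at once, in agreement with the empty sum.
      by_cases h0 : 0 ≤ n.eval a y
      · obtain ⟨t, s', r, ht, h⟩ := runs_sum_loop e d P₂ h₂ Z a ha (Q₂.eval Z)
          (Z * Q₂.eval Z + Q₂.eval Z + 2) N s₂ 0 hl2 hl3 hq (by omega) (by rw [hlen0]; omega)
          (hr₁.sim.store_temp _ _) (by rw [hn₂, hN, Int.toNat_of_nonneg h0])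
          (by rw [hs₂, store_reg_mem, if_pos rfl])
        refine ⟨t, s', r, ht.trans ?_, h⟩
        have := Nat.mul_le_mul_right (P₂.eval Z + 3 * Z + 3 * (Z * Q₂.eval Z + Q₂.eval Z + 2) +
          10 * len ((3 * d + 7 : ℕ) : ℤ) + 15) (Nat.succ_le_succ hl2)
        exact this.trans (Nat.le_add_right _ _)
      · have hN0 : N = 0 := by omega
        refine ⟨_, s₂, Runs.loop_false ?_, ?_, hr₁.sim.store_temp _ _, ?_, fun _ _ => rfl⟩
        · simp only [Test.holds, Operand.val, hn₂]; omega
        · simp only [Test.cost, Operand.cost, hn₂]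
          have h3 := q₁ Z a y ha hy hl1
          have hlen1 : len 1 = 2 := by decide
          have hm1 : len ((3 * d + 1 : ℕ) : ℤ) ≤ len ((3 * d + 7 : ℕ) : ℤ) :=
            len_le_of_natAbs_le (by simp only [Int.natAbs_natCast]; omega)
          rw [Nat.succ_mul Z]
          omega
        · rw [hs₂, store_reg_mem, if_pos rfl, hN0]; simp
    obtain ⟨t₃, s₃, r3, ht₃, hsim₃, hv₃, ho₃⟩ := key
    have hsum : s₃.mem (3 * (d + 1) + 1) = (Ex.sum n e).eval a y := by
      rw [hv₃, zero_add]; rfl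
    refine ⟨_, _, Runs.seq r1 (Runs.seq r2 (Runs.seq r3 (Runs.move _ _ _))), ?_,
      hsim₃.store_temp _ _, ?_, ?_⟩
    · have h4 : len ((Ex.sum n e).eval a y) ≤ Z * Q₂.eval Z + 1 :=
        (len_sum_le N _ _ hq).trans (Nat.add_le_add_right hNZ 1)
      simp only [Operand.cost, Operand.val, Dest.cost, hsum, Polynomial.eval_add,
        Polynomial.eval_C, Polynomial.eval_mul, Polynomial.eval_X, Polynomial.eval_one,
        Polynomial.eval_ofNat]
      omega
    · rw [store_reg_mem, if_pos rfl]; exact hsum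
    · intro d' hd'
      rw [store_reg_mem, if_neg (by omega), ho₃ d' hd', hs₂, store_reg_mem, if_neg (by omega),
        hr₁.old d' hd']

end Ex

end RAM


namespace RAM

/-! ### Loop-free statements -/

/-- Loop-free statements over the variables and arrays of an array state. -/
inductive Stmt : Type
  | assign (x : ℕ) (e : Ex)
  | aset (t : Fin 16) (i e : Ex)
  | read (x : ℕ)
  | write (e : Ex)
  | seq (p q : Stmt)
  | ite (e f : Ex) (p q : Stmt)

namespace Stmt

def run : Stmt → AState → AState
  | assign x e, a => a.setVar x (e.eval a 0)
  | aset t i e, a => a.setArr t (Function.update (a.arr t) (i.eval a 0).toNat (e.eval a 0))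
  | read x, a => { a.setVar x (a.inp.headD 0) with inp := a.inp.tail }
  | write e, a => { a with out := a.out ++ [e.eval a 0] }
  | seq p q, a => q.run (p.run a)
  | ite e f p q, a => if e.eval a 0 ≤ f.eval a 0 then p.run a else q.run a

/-- Sums have at most `Z` terms, indices are nonnegative, and stored values have length at most
`Z`. -/
def ok (Z : ℕ) : Stmt → AState → Prop
  | assign _ e, a => e.lim Z a 0 ∧ len (e.eval a 0) ≤ Z
  | aset _ i e, a => i.lim Z a 0 ∧ 0 ≤ i.eval a 0 ∧ e.lim Z a 0 ∧ len (e.eval a 0) ≤ Z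
  | read _, _ => True
  | write e, a => e.lim Z a 0
  | seq p q, a => p.ok Z a ∧ q.ok Z (p.run a)
  | ite e f p q, a => e.lim Z a 0 ∧ f.lim Z a 0 ∧
      if e.eval a 0 ≤ f.eval a 0 then p.ok Z a else q.ok Z a

def code : Stmt → Prog
  | assign x e => .seq (.move (.reg (3 * 0 + 1)) (.const 0)) (.seq (e.code 0 1)
      (.move (.reg (3 * x)) (.reg (3 * 1 + 1))))
  | aset t i e => .seq (.move (.reg (3 * 0 + 1)) (.const 0)) (.seq (i.code 0 1) (.seq (e.code 0 2)
      (.seq (.arith .mul (.reg (3 * 1 + 1)) (.reg (3 * 1 + 1)) (.const 48))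
      (.seq (.arith .add (.reg (3 * 1 + 1)) (.reg (3 * 1 + 1)) (.const (3 * (t : ℕ) + 2 : ℕ)))
        (.move (.ind (3 * 1 + 1)) (.reg (3 * 2 + 1)))))))
  | read x => .read (.reg (3 * x))
  | write e => .seq (.move (.reg (3 * 0 + 1)) (.const 0)) (.seq (e.code 0 1)
      (.write (.reg (3 * 1 + 1))))
  | seq p q => .seq p.code q.code
  | ite e f p q => .seq (.move (.reg (3 * 0 + 1)) (.const 0)) (.seq (e.code 0 1)
      (.seq (f.code 0 2) (.ite (.le (.reg (3 * 1 + 1)) (.reg (3 * 2 + 1))) p.code q.code)))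

end Stmt

/-! ### Machine runs of loop-free statements -/

theorem Bdd.setVar {Z : ℕ} {a : AState} (h : Bdd Z a) (x : ℕ) {z : ℤ} (hz : len z ≤ Z) :
    Bdd Z (a.setVar x z) where
  var y := by
    simp only [AState.setVar, Function.update_apply]
    split_ifs
    · exact hz
    · exact h.var y
  arr := h.arr
  inp := h.inp

theorem Bdd.setArr {Z : ℕ} {a : AState} (h : Bdd Z a) (t : Fin 16) {f : ℕ → ℤ}
    (hf : ∀ i, len (f i) ≤ Z) : Bdd Z (a.setArr t f) where
  var := h.var
  arr t' i := by
    simp only [AState.setArr, Function.update_apply]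
    split_ifs
    · exact hf i
    · exact h.arr t' i
  inp := h.inp

theorem Sim.setVar {a : AState} {s : State} (h : Sim a s) (x : ℕ) (z : ℤ) :
    Sim (a.setVar x z) (s.store (Dest.reg (3 * x)) z) where
  var y := by
    rw [store_reg_mem]
    simp only [AState.setVar, Function.update_apply]
    by_cases hxy : y = x
    · subst hxy; simp
    · rw [if_neg (by omega), if_neg hxy, h.var]
  arr t i := by rw [store_reg_mem, if_neg (by omega)]; exact h.arr t i
  inp := h.inp
  out := h.out

/-- From every machine state that represents `a`, the program `p` leads to one that represents the
bounded array state `a'`, at a cost of at most `n`. -/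
structure Tri (Z : ℕ) (a : AState) (p : Prog) (n : ℕ) (a' : AState) : Prop where
  bdd : Bdd Z a'
  runs : ∀ s, Sim a s → ∃ t s', Runs p s t s' ∧ t ≤ n ∧ Sim a' s'

theorem Tri.seq {Z : ℕ} {a a₁ a₂ : AState} {p q : Prog} {n m : ℕ} (h₁ : Tri Z a p n a₁)
    (h₂ : Tri Z a₁ q m a₂) : Tri Z a (.seq p q) (n + m) a₂ where
  bdd := h₂.bdd
  runs s hs := by
    obtain ⟨t, s₁, r1, ht, hs₁⟩ := h₁.runs s hs
    obtain ⟨t', s₂, r2, ht', hs₂⟩ := h₂.runs s₁ hs₁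
    exact ⟨_, _, Runs.seq r1 r2, by omega, hs₂⟩

theorem Tri.mono {Z : ℕ} {a a' : AState} {p : Prog} {n m : ℕ} (h : Tri Z a p n a') (hnm : n ≤ m) :
    Tri Z a p m a' where
  bdd := h.bdd
  runs s hs := by
    obtain ⟨t, s₁, r1, ht, hs₁⟩ := h.runs s hs
    exact ⟨_, _, r1, by omega, hs₁⟩

/-- Outside all sums the index is taken to be 0; temporary 0 is cleared to hold it. -/
theorem runs_clear {a : AState} {s : State} (hs : Sim a s) :
    ∃ s', Runs (.move (.reg (3 * 0 + 1)) (.const 0)) s 5 s' ∧ Sim a s' ∧ s'.mem (3 * 0 + 1) = 0 := by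
  refine ⟨_, ?_, hs.store_temp 0 0, ?_⟩
  · have := Runs.move (.reg (3 * 0 + 1)) (.const 0) s
    have h0 : len 0 = 1 := by decide
    have h1 : len ((3 * 0 + 1 : ℕ) : ℤ) = 2 := by decide
    simp only [Operand.cost, Operand.val, Dest.cost, h0, h1] at this
    exact this
  · rw [store_reg_mem, if_pos rfl]

theorem Bdd.one_le {Z : ℕ} {a : AState} (h : Bdd Z a) : 1 ≤ Z := (one_le_len _).trans (h.var 0)

/-- A statement is a fixed tree of expressions, so its cost is a polynomial in `Z` that does not
depend on the state. -/
theorem Stmt.exists_tri (p : Stmt) : ∃ P : Polynomial ℕ, ∀ (Z : ℕ) (a : AState), Bdd Z a →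
    p.ok Z a → Tri Z a p.code (P.eval Z) (p.run a) := by
  have hlen0 : len 0 = 1 := by decide
  induction p with
  | assign x e =>
    obtain ⟨P, hP⟩ := e.exists_hasCost 0 1 (by omega)
    refine ⟨P + Polynomial.C 2 * Polynomial.X + Polynomial.C (6 + len ((3 * 1 + 1 : ℕ) : ℤ) +
      len ((3 * x : ℕ) : ℤ)), fun Z a ha hok => ⟨ha.setVar x hok.2, fun s hs => ?_⟩⟩
    obtain ⟨s₁, r1, hs₁, h0⟩ := runs_clear hs
    obtain ⟨t₂, s₂, r2, ht₂, hr⟩ := hP Z a 0 s₁ ha (by rw [hlen0]; exact ha.one_le) hok.1 hs₁ h0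
    refine ⟨_, _, Runs.seq r1 (Runs.seq r2 (Runs.move _ _ _)), ?_, ?_⟩
    · have := hok.2
      simp only [Operand.cost, Operand.val, Dest.cost, hr.val, Polynomial.eval_add,
        Polynomial.eval_C, Polynomial.eval_mul, Polynomial.eval_X]
      omega
    · simp only [Operand.val, hr.val]
      exact hr.sim.setVar x _
  | aset t i e =>
    obtain ⟨P₁, h₁⟩ := i.exists_hasCost 0 1 (by omega)
    obtain ⟨P₂, h₂⟩ := e.exists_hasCost 0 2 (by omega)
    obtain ⟨Q, hQ⟩ := i.exists_len_eval_le
    refine ⟨P₁ + P₂ + Polynomial.C 10 * Q + Polynomial.C 3 * Polynomial.X + Polynomial.C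
      (10 * len ((3 * 1 + 1 : ℕ) : ℤ) + 10 * len ((3 * 2 + 1 : ℕ) : ℤ) +
        10 * len ((3 * (t : ℕ) + 2 : ℕ) : ℤ) + 10 * len 48 + 10),
      fun Z a ha hok => ⟨?_, fun s hs => ?_⟩⟩
    · refine ha.setArr t fun j => ?_
      rw [Function.update_apply]
      split_ifs
      · exact hok.2.2.2
      · exact ha.arr t j
    · obtain ⟨hl1, hi0, hl2, hlen⟩ := hok
      have hZ := ha.one_le
      obtain ⟨s₁, r1, hs₁, h0⟩ := runs_clear hs
      obtain ⟨t₂, s₂, r2, ht₂, hr₂⟩ := h₁ Z a 0 s₁ ha (by omega) hl1 hs₁ h0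
      obtain ⟨t₃, s₃, r3, ht₃, hr₃⟩ := h₂ Z a 0 s₂ ha (by omega) hl2 hr₂.sim
        (by rw [hr₂.old 0 (by omega), h0])
      have hv₃ : s₃.mem (3 * 1 + 1) = i.eval a 0 := by rw [hr₃.old 1 (by omega), hr₂.val]
      have hq := hQ Z a 0 ha (by omega) hl1
      have hrun : (Stmt.aset t i e).run a =
        a.setArr t (Function.update (a.arr t) (i.eval a 0).toNat (e.eval a 0)) := rfl
      rw [hrun]
      clear hrun
      generalize i.eval a 0 = j at hv₃ hq hi0 ⊢
      have hv₃' := hr₃.val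
      have hs₃ := hr₃.sim
      clear hr₂ hr₃
      generalize e.eval a 0 = z at hv₃' hlen ⊢
      set s₄ := s₃.store (Dest.reg (3 * 1 + 1)) (j * 48) with hs₄
      have r4 : Runs (.arith .mul (.reg (3 * 1 + 1)) (.reg (3 * 1 + 1)) (.const 48)) s₃
          (1 + (len ((3 * 1 + 1 : ℕ) : ℤ) + len j) + len 48 + len ((3 * 1 + 1 : ℕ) : ℤ)
            + len (j * 48)) s₄ := by
        have := Runs.arith .mul (.reg (3 * 1 + 1)) (.reg (3 * 1 + 1)) (.const 48) s₃
        simp only [Operand.cost, Operand.val, Dest.cost, ArithOp.eval, hv₃] at this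
        exact this
      have hv₄ : s₄.mem (3 * 1 + 1) = j * 48 := by rw [hs₄, store_reg_mem, if_pos rfl]
      set s₅ := s₄.store (Dest.reg (3 * 1 + 1)) (j * 48 + (3 * (t : ℕ) + 2 : ℕ)) with hs₅
      have r5 : Runs (.arith .add (.reg (3 * 1 + 1)) (.reg (3 * 1 + 1))
          (.const (3 * (t : ℕ) + 2 : ℕ))) s₄
          (1 + (len ((3 * 1 + 1 : ℕ) : ℤ) + len (j * 48)) + len ((3 * (t : ℕ) + 2 : ℕ) : ℤ)
            + len ((3 * 1 + 1 : ℕ) : ℤ) + len (j * 48 + (3 * (t : ℕ) + 2 : ℕ))) s₅ := by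
        have := Runs.arith .add (.reg (3 * 1 + 1)) (.reg (3 * 1 + 1))
          (.const (3 * (t : ℕ) + 2 : ℕ)) s₄
        simp only [Operand.cost, Operand.val, Dest.cost, ArithOp.eval, hv₄] at this
        exact this
      have hv₅ : s₅.mem (3 * 1 + 1) = j * 48 + (3 * (t : ℕ) + 2 : ℕ) := by
        rw [hs₅, store_reg_mem, if_pos rfl]
      have hz₅ : s₅.mem (3 * 2 + 1) = z := by
        rw [hs₅, store_reg_mem, if_neg (by omega), hs₄, store_reg_mem, if_neg (by omega), hv₃']
      have hsim₅ : Sim a s₅ := (hs₃.store_temp 1 _).store_temp 1 _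
      refine ⟨_, _, Runs.seq r1 (Runs.seq r2 (Runs.seq r3 (Runs.seq r4 (Runs.seq r5
        (Runs.move _ _ _))))), ?_, ?_⟩
      · have h4 := len_mul_le j 48
        have h5 := len_add_le (j * 48) ((3 * (t : ℕ) + 2 : ℕ) : ℤ)
        simp only [Operand.cost, Operand.val, Dest.cost, hv₅, hz₅, Polynomial.eval_add,
          Polynomial.eval_C, Polynomial.eval_mul, Polynomial.eval_X]
        omega
      · have htl := t.isLt
        have haddr : (j * 48 + (3 * (t : ℕ) + 2 : ℕ)).toNat = 3 * (16 * j.toNat + t) + 2 := by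
          omega
        simp only [State.store, Dest.addr, Operand.val, hv₅, hz₅, haddr]
        refine ⟨fun x => ?_, fun t' i' => ?_, hsim₅.inp, hsim₅.out⟩
        · simp only
          rw [Function.update_apply, if_neg (by omega)]
          exact hsim₅.var x
        · have htl' := t'.isLt
          simp only [AState.setArr]
          rw [Function.update_apply, Function.update_apply]
          by_cases htt : t' = t
          · subst htt
            rw [if_pos rfl, Function.update_apply]
            by_cases hi : i' = j.toNat
            · rw [if_pos (by rw [hi]), if_pos hi]
            · rw [if_neg (by omega), if_neg hi]
              exact hsim₅.arr t' i'
          · have : (t' : ℕ) ≠ t := fun h => htt (Fin.ext h)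
            rw [if_neg (by omega), if_neg htt]
            exact hsim₅.arr t' i'
  | read x =>
    refine ⟨Polynomial.X + Polynomial.C (2 + len ((3 * x : ℕ) : ℤ)), fun Z a ha _ => ?_⟩
    have hlen : len (a.inp.headD 0) ≤ Z := by
      rcases h : a.inp with _ | ⟨z, l⟩
      · exact ha.one_le
      · exact ha.inp z (by rw [h]; simp)
    refine ⟨?_, fun s hs => ⟨_, _, Runs.read _ _, ?_, ?_⟩⟩
    · have h1 := ha.setVar x hlen
      exact ⟨h1.var, h1.arr, fun z hz => ha.inp z (List.mem_of_mem_tail hz)⟩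
    · simp only [Dest.cost, hs.inp, Polynomial.eval_add, Polynomial.eval_C, Polynomial.eval_X]
      omega
    · have h1 := hs.setVar x (a.inp.headD 0)
      rw [hs.inp]
      exact ⟨h1.var, h1.arr, rfl, h1.out⟩
  | write e =>
    obtain ⟨P, hP⟩ := e.exists_hasCost 0 1 (by omega)
    obtain ⟨Q, hQ⟩ := e.exists_len_eval_le
    refine ⟨P + Q + Polynomial.C (6 + len ((3 * 1 + 1 : ℕ) : ℤ)), fun Z a ha hok =>
      ⟨⟨ha.var, ha.arr, ha.inp⟩, fun s hs => ?_⟩⟩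
    have hZ := ha.one_le
    obtain ⟨s₁, r1, hs₁, h0⟩ := runs_clear hs
    obtain ⟨t₂, s₂, r2, ht₂, hr⟩ := hP Z a 0 s₁ ha (by omega) hok hs₁ h0
    have hq := hQ Z a 0 ha (by omega) hok
    refine ⟨_, _, Runs.seq r1 (Runs.seq r2 (Runs.write _ _)), ?_, ?_⟩
    · simp only [Operand.cost, hr.val, Polynomial.eval_add, Polynomial.eval_C]
      omega
    · refine ⟨hr.sim.var, hr.sim.arr, hr.sim.inp, ?_⟩
      simp only [Operand.val, hr.val, hr.sim.out]
      rfl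
  | seq p q hp hq =>
    obtain ⟨P, hP⟩ := hp
    obtain ⟨Q, hQ⟩ := hq
    refine ⟨P + Q, fun Z a ha hok => ?_⟩
    have h1 := hP Z a ha hok.1
    rw [Polynomial.eval_add]
    exact h1.seq (hQ Z _ h1.bdd hok.2)
  | ite e f p q hp hq =>
    obtain ⟨P₁, h₁⟩ := e.exists_hasCost 0 1 (by omega)
    obtain ⟨P₂, h₂⟩ := f.exists_hasCost 0 2 (by omega)
    obtain ⟨Q₁, q₁⟩ := e.exists_len_eval_le
    obtain ⟨Q₂, q₂⟩ := f.exists_len_eval_le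
    obtain ⟨P₃, h₃⟩ := hp
    obtain ⟨P₄, h₄⟩ := hq
    refine ⟨P₁ + P₂ + Q₁ + Q₂ + P₃ + P₄ + Polynomial.C (6 + len ((3 * 1 + 1 : ℕ) : ℤ) +
      len ((3 * 2 + 1 : ℕ) : ℤ)), fun Z a ha hok => ?_⟩
    obtain ⟨hl1, hl2, hok⟩ := hok
    have hZ := ha.one_le
    have pre : ∀ s, Sim a s → ∃ t s', (∀ t' s'', Runs (.ite (.le (.reg (3 * 1 + 1))
        (.reg (3 * 2 + 1))) p.code q.code) s' t' s'' → Runs (Stmt.ite e f p q).code s (t + t') s'') ∧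
        t ≤ 5 + P₁.eval Z + P₂.eval Z ∧ Sim a s' ∧ s'.mem (3 * 1 + 1) = e.eval a 0 ∧
        s'.mem (3 * 2 + 1) = f.eval a 0 := by
      intro s hs
      obtain ⟨s₁, r1, hs₁, h0⟩ := runs_clear hs
      obtain ⟨t₂, s₂, r2, ht₂, hr₂⟩ := h₁ Z a 0 s₁ ha (by omega) hl1 hs₁ h0
      obtain ⟨t₃, s₃, r3, ht₃, hr₃⟩ := h₂ Z a 0 s₂ ha (by omega) hl2 hr₂.sim
        (by rw [hr₂.old 0 (by omega), h0])
      refine ⟨5 + t₂ + t₃, s₃, fun t' s'' r => ?_, by omega, hr₃.sim,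
        by rw [hr₃.old 1 (by omega), hr₂.val], hr₃.val⟩
      have := Runs.seq r1 (Runs.seq r2 (Runs.seq r3 r))
      rw [show 5 + t₂ + t₃ + t' = 5 + (t₂ + (t₃ + t')) by ring]
      exact this
    have h5 := q₁ Z a 0 ha (by omega) hl1
    have h6 := q₂ Z a 0 ha (by omega) hl2
    by_cases hc : e.eval a 0 ≤ f.eval a 0
    · rw [if_pos hc] at hok
      have h := h₃ Z a ha hok
      have hrun : (Stmt.ite e f p q).run a = p.run a := if_pos hc
      rw [hrun]
      refine ⟨h.bdd, fun s hs => ?_⟩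
      obtain ⟨t, s', hr, ht, hs', hv1, hv2⟩ := pre s hs
      obtain ⟨t'', s'', r, ht'', hs''⟩ := h.runs s' hs'
      refine ⟨_, _, hr _ _ (Runs.ite_true ?_ r), ?_, hs''⟩
      · simpa only [Test.holds, Operand.val, hv1, hv2] using hc
      · simp only [Test.cost, Operand.cost, hv1, hv2, Polynomial.eval_add, Polynomial.eval_C]
        omega
    · rw [if_neg hc] at hok
      have h := h₄ Z a ha hok
      have hrun : (Stmt.ite e f p q).run a = q.run a := if_neg hc
      rw [hrun]
      refine ⟨h.bdd, fun s hs => ?_⟩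
      obtain ⟨t, s', hr, ht, hs', hv1, hv2⟩ := pre s hs
      obtain ⟨t'', s'', r, ht'', hs''⟩ := h.runs s' hs'
      refine ⟨_, _, hr _ _ (Runs.ite_false ?_ r), ?_, hs''⟩
      · simpa only [Test.holds, Operand.val, hv1, hv2] using hc
      · simp only [Test.cost, Operand.cost, hv1, hv2, Polynomial.eval_add, Polynomial.eval_C]
        omega

/-! ### Loops -/

/-- Repeat a loop-free statement while the variable `x` is positive. -/
def whilePos (x : ℕ) (p : Stmt) : Prog := .loop (.le (.const 1) (.reg (3 * x))) p.code

/-- The invariant is indexed by the number of rounds still to come, which yields termination and the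
number of rounds at once. The polynomial is chosen before the invariant. -/
theorem exists_tri_whilePos (x : ℕ) (p : Stmt) : ∃ P : Polynomial ℕ, ∀ (Z : ℕ)
    (I : ℕ → AState → Prop),
    (∀ n a, I (n + 1) a → 1 ≤ a.var x ∧ p.ok Z a ∧ I n (p.run a)) →
    (∀ a, I 0 a → a.var x < 1) → ∀ n a, Bdd Z a → I n a →
      ∃ a', Tri Z a (whilePos x p) ((n + 1) * P.eval Z) a' ∧ I 0 a' := by
  obtain ⟨P, hP⟩ := p.exists_tri
  refine ⟨P + Polynomial.X + Polynomial.C (3 + len ((3 * x : ℕ) : ℤ)),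
    fun Z I hstep h0 n => ?_⟩
  have hlen1 : len 1 = 2 := by decide
  induction n with
  | zero =>
    intro a ha hI
    refine ⟨a, ⟨ha, fun s hs => ⟨_, s, Runs.loop_false ?_, ?_, hs⟩⟩, hI⟩
    · have := h0 a hI
      simp only [Test.holds, Operand.val, hs.var]
      omega
    · have := ha.var x
      simp only [Test.cost, Operand.cost, hs.var, hlen1, Polynomial.eval_add, Polynomial.eval_C,
        Polynomial.eval_X]
      omega
  | succ n ih =>
    intro a ha hI
    obtain ⟨hx, hok, hI'⟩ := hstep n a hI
    have h1 := hP Z a ha hok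
    obtain ⟨a', h2, hI''⟩ := ih _ h1.bdd hI'
    refine ⟨a', ⟨h2.bdd, fun s hs => ?_⟩, hI''⟩
    obtain ⟨t₁, s₁, r1, ht₁, hs₁⟩ := h1.runs s hs
    obtain ⟨t₂, s₂, r2, ht₂, hs₂⟩ := h2.runs s₁ hs₁
    refine ⟨_, _, Runs.loop_true ?_ r1 r2, ?_, hs₂⟩
    · simpa only [Test.holds, Operand.val, hs.var] using hx
    · have := ha.var x
      rw [Nat.succ_mul (n + 1)]
      simp only [Test.cost, Operand.cost, hs.var, hlen1, Polynomial.eval_add, Polynomial.eval_C,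
        Polynomial.eval_X] at ht₂ ⊢
      omega

/-- The body of a counting loop that sets one array entry in each round. -/
def fillBody (x : ℕ) (t : Fin 16) (i e : Ex) : Stmt :=
  .seq (.assign x (.op .sub (.v x) (.c 1))) (.aset t i e)

/-- Let the variable `x` run from `n - 1` down to `0` and set one entry of the array `t` in each
round. -/
def fill (x : ℕ) (n : Ex) (t : Fin 16) (i e : Ex) : Prog :=
  .seq (Stmt.assign x n).code (whilePos x (fillBody x t i e))

/-- `J k` describes the array once the rounds with index at least `k` are done. A new entry may
depend on the entries set so far, so a recurrence becomes a single application with `J` saying which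
entries are correct. -/
theorem exists_tri_fill (x : ℕ) (n : Ex) (t : Fin 16) (i e : Ex) : ∃ P : Polynomial ℕ,
    ∀ (Z N : ℕ) (a : AState) (J : ℕ → (ℕ → ℤ) → Prop), Bdd Z a → n.lim Z a 0 →
      n.eval a 0 = N → len (N : ℤ) ≤ Z → J N (a.arr t) →
      (∀ k τ, k < N → J (k + 1) τ → ∃ j : ℕ, ∃ z : ℤ,
        i.lim Z ((a.setArr t τ).setVar x k) 0 ∧ e.lim Z ((a.setArr t τ).setVar x k) 0 ∧
        i.eval ((a.setArr t τ).setVar x k) 0 = j ∧ e.eval ((a.setArr t τ).setVar x k) 0 = z ∧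
        len z ≤ Z ∧ J k (Function.update τ j z)) →
      ∃ τ, Tri Z a (fill x n t i e) ((N + 1) * P.eval Z) ((a.setArr t τ).setVar x 0) ∧ J 0 τ := by
  obtain ⟨P₁, h₁⟩ := (Stmt.assign x n).exists_tri
  obtain ⟨P₂, h₂⟩ := exists_tri_whilePos x (fillBody x t i e)
  refine ⟨P₁ + P₂, fun Z N a J ha hl hn hlen hJ hstep => ?_⟩
  have t1 := h₁ Z a ha ⟨hl, by rw [hn]; exact hlen⟩
  have hrun : (Stmt.assign x n).run a = a.setVar x N := by simp only [Stmt.run, hn]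
  rw [hrun] at t1
  have hset : ∀ (τ : ℕ → ℤ) (y z : ℤ), ((a.setArr t τ).setVar x y).setVar x z =
      (a.setArr t τ).setVar x z := by
    intro τ y z; simp only [AState.setVar, Function.update_idem]
  have hset' : ∀ (τ τ' : ℕ → ℤ) (y : ℤ), ((a.setArr t τ).setVar x y).setArr t τ' =
      (a.setArr t τ').setVar x y := by
    intro τ y z; simp only [AState.setVar, AState.setArr, Function.update_idem]
  have harr : ∀ (τ : ℕ → ℤ) (y : ℤ), ((a.setArr t τ).setVar x y).arr t = τ := by
    intro τ y; simp only [AState.setVar, AState.setArr, Function.update_self]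
  have hlen' : ∀ k ≤ N, len (k : ℤ) ≤ Z := fun k hk =>
    (len_le_of_natAbs_le (by simpa using hk)).trans hlen
  have h3 := h₂ Z (fun k a' => ∃ τ, k ≤ N ∧ a' = (a.setArr t τ).setVar x k ∧ J k τ) ?_ ?_ N
      (a.setVar x N) t1.bdd
      ⟨a.arr t, le_rfl, by simp only [AState.setVar, AState.setArr, Function.update_eq_self], hJ⟩
  · obtain ⟨a', t2, ⟨τ, -, rfl, hJ0⟩⟩ := h3
    refine ⟨τ, (t1.seq t2).mono ?_, hJ0⟩
    rw [Polynomial.eval_add, mul_add]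
    have : P₁.eval Z ≤ (N + 1) * P₁.eval Z := Nat.le_mul_of_pos_left _ (by omega)
    omega
  · rintro k _ ⟨τ, hk, rfl, hJk⟩
    obtain ⟨j, z, hli, hle, hi, he, hz, hJ'⟩ := hstep k τ hk hJk
    have hx : ((a.setArr t τ).setVar x ((k + 1 : ℕ) : ℤ)).var x = ((k + 1 : ℕ) : ℤ) := by
      simp only [AState.setVar, Function.update_self]
    have hsub : (Ex.op .sub (.v x) (.c 1)).eval ((a.setArr t τ).setVar x ((k + 1 : ℕ) : ℤ)) 0 = k := by
      simp only [Ex.eval, ArithOp.eval, hx]; push_cast; ring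
    refine ⟨by rw [hx]; push_cast; omega, ⟨⟨⟨trivial, trivial⟩, ?_⟩, ?_⟩, ?_⟩
    · rw [hsub]; exact hlen' k (by omega)
    · simp only [Stmt.run, hsub, hset]
      exact ⟨hli, by rw [hi]; positivity, hle, by rw [he]; exact hz⟩
    · refine ⟨Function.update τ j z, by omega, ?_, hJ'⟩
      simp only [fillBody, Stmt.run, hsub, hset, hi, he, harr, hset', Int.toNat_natCast]
  · rintro _ ⟨τ, -, rfl, -⟩
    simp [AState.setVar]
end RAM


namespace CWExpr

variable {c : ℕ}

/-! ### Preorder listings -/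

def children : CWExpr c → List (CWExpr c)
  | intro _ => []
  | join _ _ e => [e]
  | rename _ _ e => [e]
  | union e₁ e₂ => [e₁, e₂]

/-- All subexpressions in preorder. -/
def preorder : CWExpr c → List (CWExpr c)
  | intro l => [intro l]
  | join a b e => join a b e :: e.preorder
  | rename a b e => rename a b e :: e.preorder
  | union e₁ e₂ => union e₁ e₂ :: (e₁.preorder ++ e₂.preorder)

def size (e : CWExpr c) : ℕ := e.preorder.length

theorem preorder_eq (e : CWExpr c) : e.preorder = e :: e.children.flatMap preorder := by
  cases e <;> simp [preorder, children]

theorem size_pos (e : CWExpr c) : 0 < e.size := by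
  rw [size, preorder_eq]; simp

theorem preorder_map {cw : ℕ} (ψ : Fin c → Fin cw) (e : CWExpr c) :
    (e.map ψ).preorder = e.preorder.map (map ψ) := by
  induction e with
  | intro l => rfl
  | join a b e ih => simp [preorder, map, ih]
  | rename a b e ih => simp [preorder, map, ih]
  | union e₁ e₂ h₁ h₂ => simp [preorder, map, h₁, h₂]

/-- The number of leaves in a list of subexpressions. -/
def leaves (l : List (CWExpr c)) : ℕ :=
  l.countP fun e => match e with
    | intro _ => true
    | _ => false

theorem card_vert (e : CWExpr c) : Fintype.card e.Vert = leaves e.preorder := by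
  induction e with
  | intro l => rfl
  | join a b e ih => exact ih.trans (by simp [leaves, preorder])
  | rename a b e ih => exact ih.trans (by simp [leaves, preorder])
  | union e₁ e₂ h₁ h₂ =>
    refine (Fintype.card_sum (α := e₁.Vert) (β := e₂.Vert)).trans ?_
    rw [h₁, h₂]
    simp [leaves, preorder]

theorem card_vert_le (e : CWExpr c) : Fintype.card e.Vert ≤ e.size := by
  rw [card_vert]; exact List.countP_le_length

/-- `o`, `x`, `y` are the tag and the labels of the root, where `R z l` means that the number `z`
stands for the label `l`. -/
def NodeRep (R : ℤ → Fin c → Prop) (o x y : ℤ) : CWExpr c → Prop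
  | intro l => o = 0 ∧ R x l
  | join a b _ => o = 1 ∧ R x a ∧ R y b
  | rename a b _ => o = 2 ∧ R x a ∧ R y b
  | union _ _ => o = 3

theorem NodeRep.mono {R R' : ℤ → Fin c → Prop} (h : ∀ z l, R z l → R' z l) {o x y : ℤ}
    {e : CWExpr c} (he : NodeRep R o x y e) : NodeRep R' o x y e := by
  cases e with
  | intro l => exact ⟨he.1, h _ _ he.2⟩
  | join a b e => exact ⟨he.1, h _ _ he.2.1, h _ _ he.2.2⟩
  | rename a b e => exact ⟨he.1, h _ _ he.2.1, h _ _ he.2.2⟩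
  | union e₁ e₂ => exact he

theorem NodeRep.of_map {cw : ℕ} {ψ : Fin c → Fin cw} {R : ℤ → Fin cw → Prop}
    {R' : ℤ → Fin c → Prop} (h : ∀ z l, R z (ψ l) → R' z l) {o x y : ℤ}
    {e : CWExpr c} (he : NodeRep R o x y (e.map ψ)) : NodeRep R' o x y e := by
  cases e with
  | intro l => exact ⟨he.1, h _ _ he.2⟩
  | join a b e => exact ⟨he.1, h _ _ he.2.1, h _ _ he.2.2⟩
  | rename a b e => exact ⟨he.1, h _ _ he.2.1, h _ _ he.2.2⟩
  | union e₁ e₂ => exact he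

/-- Pulls an expression back to the positions in the dictionary, given that every label written at a
node has one. -/
theorem exists_map_eq {cw : ℕ} (ψ : Fin c → Fin cw) {R : ℤ → Fin cw → Prop}
    (hR : ∀ z l, R z l → l ∈ Set.range ψ) (e : CWExpr cw)
    (h : ∀ x ∈ e.preorder, ∃ o y z, NodeRep R o y z x) : ∃ e', map ψ e' = e := by
  induction e with
  | intro l =>
    obtain ⟨o, y, z, -, h1⟩ := h (intro l) (by simp [preorder])
    obtain ⟨x, rfl⟩ := hR _ _ h1
    exact ⟨intro x, rfl⟩
  | join a b e ih =>
    obtain ⟨o, y, z, -, h1, h2⟩ := h (join a b e) (by simp [preorder])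
    obtain ⟨x, rfl⟩ := hR _ _ h1
    obtain ⟨y, rfl⟩ := hR _ _ h2
    obtain ⟨e', rfl⟩ := ih fun x hx => h x (by simp [preorder, hx])
    exact ⟨join x y e', rfl⟩
  | rename a b e ih =>
    obtain ⟨o, y, z, -, h1, h2⟩ := h (rename a b e) (by simp [preorder])
    obtain ⟨x, rfl⟩ := hR _ _ h1
    obtain ⟨y, rfl⟩ := hR _ _ h2
    obtain ⟨e', rfl⟩ := ih fun x hx => h x (by simp [preorder, hx])
    exact ⟨rename x y e', rfl⟩
  | union e₁ e₂ ih₁ ih₂ =>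
    obtain ⟨x, rfl⟩ := ih₁ fun x hx => h x (by simp [preorder, hx])
    obtain ⟨y, rfl⟩ := ih₂ fun x hx => h x (by simp [preorder, hx])
    exact ⟨union x y, rfl⟩

/-! ### Which label classes get further neighbours -/

/-- The labels that get neighbours later on, below a join. -/
def joinFlags (a b : Fin c) (e : CWExpr c) (h : Fin c → Prop) : Fin c → Prop := fun l =>
  h l ∨ (e.Occurs a ∧ e.Occurs b ∧ (l = a ∨ l = b))

/-- All subexpressions in preorder, with the labels that get neighbours later on. -/
def nodes : CWExpr c → (Fin c → Prop) → List (CWExpr c × (Fin c → Prop))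
  | intro l, h => [(intro l, h)]
  | join a b e, h => (join a b e, h) :: e.nodes (joinFlags a b e h)
  | rename a b e, h => (rename a b e, h) :: e.nodes (Function.update h a (h b))
  | union e₁ e₂, h => (union e₁ e₂, h) :: (e₁.nodes h ++ e₂.nodes h)

theorem nodes_map_fst (e : CWExpr c) (h : Fin c → Prop) : (e.nodes h).map Prod.fst = e.preorder := by
  induction e generalizing h with
  | intro l => rfl
  | join a b e ih => simp [nodes, preorder, ih]
  | rename a b e ih => simp [nodes, preorder, ih]
  | union e₁ e₂ h₁ h₂ => simp [nodes, preorder, h₁, h₂]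

theorem nodes_length (e : CWExpr c) (h : Fin c → Prop) : (e.nodes h).length = e.size := by
  rw [size, ← nodes_map_fst e h, List.length_map]

theorem nodes_zero (e : CWExpr c) (h : Fin c → Prop) : (e.nodes h)[0]? = some (e, h) := by
  cases e <;> rfl

/-- In preorder every subexpression is a contiguous segment. The positions of children are therefore
found by adding sizes. -/
theorem nodes_drop (T : CWExpr c) (h : Fin c → Prop) (i : ℕ) (x : CWExpr c × (Fin c → Prop))
    (hx : (T.nodes h)[i]? = some x) : ∃ l, (T.nodes h).drop i = x.1.nodes x.2 ++ l := by
  have h0 : ∀ (T : CWExpr c) h, (T.nodes h)[0]? = some x →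
      ∃ l, (T.nodes h).drop 0 = x.1.nodes x.2 ++ l := by
    intro T h hx
    rw [nodes_zero] at hx
    cases hx
    exact ⟨[], by simp⟩
  induction T generalizing h i with
  | intro l =>
    rcases i with _ | i
    · exact h0 _ _ hx
    · simp [nodes] at hx
  | join a b e ih =>
    rcases i with _ | i
    · exact h0 _ _ hx
    · exact ih _ i (by simpa [nodes] using hx)
  | rename a b e ih =>
    rcases i with _ | i
    · exact h0 _ _ hx
    · exact ih _ i (by simpa [nodes] using hx)
  | union e₁ e₂ h₁ h₂ =>
    rcases i with _ | i
    · exact h0 _ _ hx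
    · simp only [nodes, List.getElem?_cons_succ] at hx
      simp only [nodes, List.drop_succ_cons]
      rcases Nat.lt_or_ge i (e₁.nodes h).length with hi | hi
      · rw [List.getElem?_append_left hi] at hx
        obtain ⟨l, hl⟩ := h₁ _ i hx
        refine ⟨l ++ e₂.nodes h, ?_⟩
        rw [List.drop_append_of_le_length hi.le, hl, List.append_assoc]
      · rw [List.getElem?_append_right hi] at hx
        obtain ⟨l, hl⟩ := h₂ _ _ hx
        refine ⟨l, ?_⟩
        rw [List.drop_append, List.drop_eq_nil_of_le hi, List.nil_append, hl]

theorem getElem?_nodes_add {T : CWExpr c} {h : Fin c → Prop} {i : ℕ} {x : CWExpr c × (Fin c → Prop)}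
    (hx : (T.nodes h)[i]? = some x) {j : ℕ} {y : CWExpr c × (Fin c → Prop)}
    (hy : (x.1.nodes x.2)[j]? = some y) : (T.nodes h)[i + j]? = some y := by
  obtain ⟨l, hl⟩ := nodes_drop T h i x hx
  rw [← List.getElem?_drop, hl, List.getElem?_append_left, hy]
  exact (List.getElem?_eq_some_iff.1 hy).1

/-- `(j, y)` is the position and the data of a child of the node with position `i` and data `x`. -/
def IsChild (i : ℕ) (x : CWExpr c × (Fin c → Prop)) (j : ℕ) (y : CWExpr c × (Fin c → Prop)) : Prop :=
  match x with
  | (intro _, _) => False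
  | (join a b e, h) => j = i + 1 ∧ y = (e, joinFlags a b e h)
  | (rename a b e, h) => j = i + 1 ∧ y = (e, Function.update h a (h b))
  | (union e₁ e₂, h) => j = i + 1 ∧ y = (e₁, h) ∨ j = i + 1 + e₁.size ∧ y = (e₂, h)

theorem IsChild.lt {i j : ℕ} {x y : CWExpr c × (Fin c → Prop)} (h : IsChild i x j y) : i < j := by
  obtain ⟨e, f⟩ := x
  cases e with
  | intro l => exact h.elim
  | join a b e => have := h.1; omega
  | rename a b e => have := h.1; omega
  | union e₁ e₂ => rcases h with h | h <;> have := h.1 <;> omega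

theorem getElem?_of_isChild {T : CWExpr c} {h : Fin c → Prop} {i j : ℕ}
    {x y : CWExpr c × (Fin c → Prop)} (hx : (T.nodes h)[i]? = some x) (hxy : IsChild i x j y) :
    (T.nodes h)[j]? = some y := by
  obtain ⟨e, f⟩ := x
  cases e with
  | intro l => exact hxy.elim
  | join a b e =>
    obtain ⟨rfl, rfl⟩ := hxy
    exact getElem?_nodes_add hx (by simpa [nodes] using nodes_zero _ _)
  | rename a b e =>
    obtain ⟨rfl, rfl⟩ := hxy
    exact getElem?_nodes_add hx (by simpa [nodes] using nodes_zero _ _)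
  | union e₁ e₂ =>
    rcases hxy with ⟨rfl, rfl⟩ | ⟨rfl, rfl⟩
    · refine getElem?_nodes_add hx ?_
      simp only [nodes, List.getElem?_cons_succ]
      rw [List.getElem?_append_left (by rw [nodes_length]; exact e₁.size_pos)]
      exact nodes_zero _ _
    · rw [Nat.add_assoc]
      refine getElem?_nodes_add hx ?_
      rw [Nat.add_comm]
      simp only [nodes, List.getElem?_cons_succ]
      rw [List.getElem?_append_right (by rw [nodes_length]), nodes_length, Nat.sub_self]
      exact nodes_zero _ _

theorem IsChild.add {i j : ℕ} {x y : CWExpr c × (Fin c → Prop)} (h : IsChild i x j y) (k : ℕ) :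
    IsChild (i + k) x (j + k) y := by
  obtain ⟨e, f⟩ := x
  cases e with
  | intro l => exact h
  | join a b e => exact ⟨by have := h.1; omega, h.2⟩
  | rename a b e => exact ⟨by have := h.1; omega, h.2⟩
  | union e₁ e₂ =>
    rcases h with h | h
    · exact Or.inl ⟨by have := h.1; omega, h.2⟩
    · exact Or.inr ⟨by have := h.1; omega, h.2⟩

/-- Flags are passed from parents to children, so every node other than the root has to receive them
from some parent. -/
theorem exists_parent (T : CWExpr c) (h : Fin c → Prop) (j : ℕ) (y : CWExpr c × (Fin c → Prop))
    (hy : (T.nodes h)[j]? = some y) (hj : j ≠ 0) :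
    ∃ i x, (T.nodes h)[i]? = some x ∧ IsChild i x j y := by
  induction T generalizing h j with
  | intro l =>
    rcases j with _ | j
    · exact absurd rfl hj
    · simp [nodes] at hy
  | join a b e ih =>
    obtain ⟨j, rfl⟩ := Nat.exists_eq_succ_of_ne_zero hj
    simp only [nodes, Nat.succ_eq_add_one, List.getElem?_cons_succ] at hy
    by_cases h0 : j = 0
    · subst h0
      rw [nodes_zero] at hy
      cases hy
      exact ⟨0, _, nodes_zero _ _, rfl, rfl⟩
    · obtain ⟨i, x, hx, hc⟩ := ih _ j hy h0
      exact ⟨i + 1, x, by simpa [nodes] using hx, hc.add 1⟩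
  | rename a b e ih =>
    obtain ⟨j, rfl⟩ := Nat.exists_eq_succ_of_ne_zero hj
    simp only [nodes, Nat.succ_eq_add_one, List.getElem?_cons_succ] at hy
    by_cases h0 : j = 0
    · subst h0
      rw [nodes_zero] at hy
      cases hy
      exact ⟨0, _, nodes_zero _ _, rfl, rfl⟩
    · obtain ⟨i, x, hx, hc⟩ := ih _ j hy h0
      exact ⟨i + 1, x, by simpa [nodes] using hx, hc.add 1⟩
  | union e₁ e₂ h₁ h₂ =>
    obtain ⟨j, rfl⟩ := Nat.exists_eq_succ_of_ne_zero hj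
    simp only [nodes, Nat.succ_eq_add_one, List.getElem?_cons_succ] at hy
    rcases Nat.lt_or_ge j (e₁.nodes h).length with hlt | hge
    · rw [List.getElem?_append_left hlt] at hy
      by_cases h0 : j = 0
      · subst h0
        rw [nodes_zero] at hy
        cases hy
        exact ⟨0, _, nodes_zero _ _, Or.inl ⟨rfl, rfl⟩⟩
      · obtain ⟨i, x, hx, hc⟩ := h₁ _ j hy h0
        refine ⟨i + 1, x, ?_, hc.add 1⟩
        simp only [nodes, List.getElem?_cons_succ]
        rw [List.getElem?_append_left (List.getElem?_eq_some_iff.1 hx).1, hx]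
    · rw [List.getElem?_append_right hge] at hy
      have hlen := nodes_length e₁ h
      by_cases h0 : j - (e₁.nodes h).length = 0
      · rw [h0, nodes_zero] at hy
        cases hy
        exact ⟨0, _, nodes_zero _ _, Or.inr ⟨by omega, rfl⟩⟩
      · obtain ⟨i, x, hx, hc⟩ := h₂ _ _ hy h0
        refine ⟨i + (1 + e₁.size), x, ?_, ?_⟩
        · rw [← Nat.add_assoc, Nat.add_right_comm]
          simp only [nodes, List.getElem?_cons_succ]
          rw [List.getElem?_append_right (by omega), hlen, Nat.add_sub_cancel, hx]
        · have := hc.add (1 + e₁.size)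
          rwa [show j - (e₁.nodes h).length + (1 + e₁.size) = j + 1 by omega] at this

theorem size_union_lt {T : CWExpr c} {h : Fin c → Prop} {i : ℕ} {x : CWExpr c × (Fin c → Prop)}
    (hx : (T.nodes h)[i]? = some x) : i + x.1.size ≤ T.size := by
  obtain ⟨l, hl⟩ := nodes_drop T h i x hx
  have h1 := congrArg List.length hl
  rw [List.length_drop, List.length_append, nodes_length, nodes_length] at h1
  have h2 := (List.getElem?_eq_some_iff.1 hx).1
  rw [nodes_length] at h2
  omega

/-! ### Contexts as digits -/

/-- The context encoded by a digit. -/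
def digitCtx (q : ℕ) : ℕ × ℕ := (q + 2 - 2 * ((q + 1) / 3 + 1), (q + 1) / 3 + 1)

/-- The three possible values of `m` give the codes `3M - 4`, `3M - 3` and `3M - 2`. These blocks
are disjoint for different `M`, and `M - 1` is the quotient of code plus one by 3. -/
theorem digitCtx_eq {m M : ℕ} (h₁ : 1 ≤ M) (h₂ : m ≤ M) (h₃ : M ≤ m + 2) :
    digitCtx (2 * M + m - 2) = (m, M) := by
  unfold digitCtx
  have : (2 * M + m - 2 + 1) / 3 + 1 = M := by omega
  rw [this]
  refine Prod.ext ?_ rfl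
  simp only
  omega

open Classical in
/-- The contexts encoded by a function that gives a digit for every label; labels that do not get
further neighbours have the trivial context. -/
noncomputable def ctx (r : ℕ) (h : Fin c → Prop) (f : Fin c → Fin (3 * r + 1)) (l : Fin c) : ℕ × ℕ :=
  if h l then digitCtx (f l) else (0, r + 1)

theorem one_le_ctx (r : ℕ) (h : Fin c → Prop) (f : Fin c → Fin (3 * r + 1)) (l : Fin c) :
    1 ≤ (ctx r h f l).2 := by
  unfold ctx digitCtx
  split_ifs <;> simp

theorem ctx_congr (r : ℕ) {h h' : Fin c → Prop} {f f' : Fin c → Fin (3 * r + 1)} {l l' : Fin c}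
    (h₁ : h l ↔ h' l') (h₂ : f l = f' l') : ctx r h f l = ctx r h' f' l' := by
  classical
  unfold ctx
  rw [h₂]
  exact if_congr h₁ rfl rfl

/-- Flag and digit of `b` are copied to `a` together, so the new contexts are again given by a table
position. -/
theorem ctx_rename (r : ℕ) (h : Fin c → Prop) (f : Fin c → Fin (3 * r + 1)) (a b : Fin c) :
    Function.update (ctx r h f) a (ctx r h f b) =
      ctx r (Function.update h a (h b)) (Function.update f a (f b)) := by
  funext l
  by_cases hl : l = a
  · subst hl
    rw [Function.update_self]
    exact ctx_congr r (by rw [Function.update_self]) (by rw [Function.update_self])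
  · rw [Function.update_of_ne hl]
    exact ctx_congr r (by rw [Function.update_of_ne hl]) (by rw [Function.update_of_ne hl])

/-- After the join has narrowed them, the windows satisfy `m ≥ s' - 1` and `M ≤ s' + 1` (with `s`
for class `b`), so nonempty ones have width at most 2 and can be written as digits, even if the
context above was the wide trivial one. The flags of both labels are on below the join; other labels
keep flag and digit. -/
theorem joinCtx_ctx (r : ℕ) (h : Fin c → Prop) (f : Fin c → Fin (3 * r + 1)) (a b : Fin c)
    (e : CWExpr c) (ha : e.Occurs a) (hb : e.Occurs b) (s s' i j la ua lb ub : ℕ)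
    (hla : la = max (max (ctx r h f a).1 (s' - 1)) (s + i)) (hua : ua = min (ctx r h f a).2 (s' + 1))
    (hlb : lb = max (max (ctx r h f b).1 (s - 1)) (s' + j)) (hub : ub = min (ctx r h f b).2 (s + 1))
    (h₁ : la ≤ ua) (h₂ : lb ≤ ub) (qa qb : Fin (3 * r + 1)) (hqa : (qa : ℕ) = 2 * ua + la - 2)
    (hqb : (qb : ℕ) = 2 * ub + lb - 2) :
    joinCtx (ctx r h f) a b s s' i j =
      ctx r (joinFlags a b e h) (Function.update (Function.update f b qb) a qa) := by
  have h3 := one_le_ctx r h f a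
  have h4 := one_le_ctx r h f b
  funext l
  by_cases hl : l = a
  · subst hl
    simp only [joinCtx, ctx, joinFlags, ha, hb, true_and, true_or, or_true, if_true,
      Function.update_self]
    rw [hqa, digitCtx_eq (by omega) h₁ (by omega), hla, hua]
    rfl
  · by_cases hl' : l = b
    · subst hl'
      simp only [joinCtx, ctx, joinFlags, ha, hb, true_and, or_true, if_true, ne_eq, hl,
        not_false_eq_true, Function.update_of_ne, Function.update_self]
      rw [hqb, digitCtx_eq (by omega) h₂ (by omega), hlb, hub]
      rfl
    · have h5 : joinCtx (ctx r h f) a b s s' i j l = ctx r h f l := by simp [joinCtx, hl, hl']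
      rw [h5]
      exact ctx_congr r (by simp [joinFlags, hl, hl']) (by simp [hl, hl'])

theorem finFunctionFinEquiv_div_mod {n m : ℕ} (f : Fin n → Fin m) (l : Fin n) :
    (finFunctionFinEquiv f : ℕ) / m ^ (l : ℕ) % m = f l := by
  have := congrArg (fun g : Fin n → Fin m => (g l : ℕ)) (finFunctionFinEquiv.symm_apply_apply f)
  exact this

/-- Replacing one digit shifts the table position by a multiple of a power, so the program finds the
entries of a child without decoding all digits. The shift may be negative, hence the integers. -/
theorem finFunctionFinEquiv_update {n m : ℕ} (f : Fin n → Fin m) (l : Fin n) (q : Fin m) :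
    ((finFunctionFinEquiv (Function.update f l q) : ℕ) : ℤ) =
      (finFunctionFinEquiv f : ℕ) + ((q : ℕ) - (f l : ℕ)) * (m : ℤ) ^ (l : ℕ) := by
  rw [finFunctionFinEquiv_apply_val, finFunctionFinEquiv_apply_val]
  rw [← Finset.add_sum_erase _ _ (Finset.mem_univ l),
    ← Finset.add_sum_erase (a := l) _ (fun i => (f i : ℕ) * m ^ (i : ℕ)) (Finset.mem_univ l)]
  have : ∑ x ∈ Finset.univ.erase l, ((Function.update f l q x : Fin m) : ℕ) * m ^ (x : ℕ) =
      ∑ x ∈ Finset.univ.erase l, (f x : ℕ) * m ^ (x : ℕ) := by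
    refine Finset.sum_congr rfl fun x hx => ?_
    rw [Function.update_of_ne (Finset.ne_of_mem_erase hx)]
  rw [this, Function.update_self]
  push_cast
  ring

end CWExpr


/-! ### Variables and arrays of the program -/

-- Variables: `vK`, `vR` the parameters; `vP` the number of expressions still to be read; `vN`,
-- `vC`, `vL` the numbers of nodes, dictionary labels and leaves; `vX` the weight of a zero; `vT`,
-- `vS`, `vJ` the tag, label and dictionary position being read; `vD` the number of digits `3r + 1`;
-- `vW` its `c`-th power; `vI` the loop index. Arrays: `aO`, `aA`, `aB` tags and labels of the
-- nodes; `aD` the dictionary; `aE` ends of subexpressions; `aN` occurring labels; `aH` flags; `aP`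
-- powers of `vD`; `aT` the table; `aQ` quotients.
notation "vK" => (0 : ℕ)
notation "vR" => (1 : ℕ)
notation "vP" => (2 : ℕ)
notation "vN" => (3 : ℕ)
notation "vC" => (4 : ℕ)
notation "vL" => (5 : ℕ)
notation "vX" => (6 : ℕ)
notation "vT" => (7 : ℕ)
notation "vS" => (8 : ℕ)
notation "vJ" => (9 : ℕ)
notation "vD" => (10 : ℕ)
notation "vW" => (11 : ℕ)
notation "vI" => (12 : ℕ)
notation "aO" => (0 : Fin 16)
notation "aA" => (1 : Fin 16)
notation "aB" => (2 : Fin 16)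
notation "aD" => (3 : Fin 16)
notation "aE" => (4 : Fin 16)
notation "aN" => (5 : Fin 16)
notation "aH" => (6 : Fin 16)
notation "aP" => (7 : Fin 16)
notation "aT" => (8 : Fin 16)
notation "aQ" => (9 : Fin 16)

namespace RAM

namespace Ex

instance : Add Ex := ⟨op .add⟩
instance : Sub Ex := ⟨op .sub⟩
instance : Mul Ex := ⟨op .mul⟩
instance : Div Ex := ⟨op .div⟩
instance (n : ℕ) : OfNat Ex n := ⟨c n⟩

/-- `if e = f then p else q` -/
def ifeq (e f p q : Ex) : Ex := ifle e f (ifle f e p q) q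

/-- The remainder of `e` modulo `f`. -/
def mod (e f : Ex) : Ex := e - f * (e / f)

variable {a : AState} {y : ℤ} {Z : ℕ}

@[simp] theorem eval_add (e f : Ex) : (e + f).eval a y = e.eval a y + f.eval a y := rfl
@[simp] theorem eval_sub (e f : Ex) : (e - f).eval a y = e.eval a y - f.eval a y := rfl
@[simp] theorem eval_mul (e f : Ex) : (e * f).eval a y = e.eval a y * f.eval a y := rfl
@[simp] theorem eval_div (e f : Ex) : (e / f).eval a y = e.eval a y / f.eval a y := rfl
@[simp] theorem eval_two : (2 : Ex).eval a y = 2 := rfl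
@[simp] theorem eval_three : (3 : Ex).eval a y = 3 := rfl
@[simp] theorem eval_zero : (0 : Ex).eval a y = 0 := rfl
@[simp] theorem eval_one : (1 : Ex).eval a y = 1 := rfl
@[simp] theorem eval_c (z : ℤ) : (c z).eval a y = z := rfl
@[simp] theorem eval_v (x : ℕ) : (v x).eval a y = a.var x := rfl
@[simp] theorem eval_loc : loc.eval a y = y := rfl
@[simp] theorem eval_ifle (e f p q : Ex) : (ifle e f p q).eval a y =
    if e.eval a y ≤ f.eval a y then p.eval a y else q.eval a y := rfl
@[simp] theorem eval_ifeq (e f p q : Ex) : (ifeq e f p q).eval a y =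
    if e.eval a y = f.eval a y then p.eval a y else q.eval a y := by
  simp only [ifeq, eval_ifle]
  split_ifs <;> first | rfl | omega
@[simp] theorem eval_mod (e f : Ex) : (mod e f).eval a y = e.eval a y % f.eval a y :=
  (Int.emod_def _ _).symm
@[simp] theorem eval_sum (n e : Ex) : (sum n e).eval a y =
    ∑ j ∈ Finset.range (n.eval a y).toNat, e.eval a (j : ℕ) := rfl
theorem eval_arr {t : Fin 16} {e : Ex} {n : ℕ} (h : e.eval a y = n) :
    (arr t e).eval a y = a.arr t n := by
  simp [eval, h]

@[simp] theorem lim_add (e f : Ex) : (e + f).lim Z a y ↔ e.lim Z a y ∧ f.lim Z a y := Iff.rfl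
@[simp] theorem lim_sub (e f : Ex) : (e - f).lim Z a y ↔ e.lim Z a y ∧ f.lim Z a y := Iff.rfl
@[simp] theorem lim_mul (e f : Ex) : (e * f).lim Z a y ↔ e.lim Z a y ∧ f.lim Z a y := Iff.rfl
@[simp] theorem lim_div (e f : Ex) : (e / f).lim Z a y ↔ e.lim Z a y ∧ f.lim Z a y := Iff.rfl
@[simp] theorem lim_two : (2 : Ex).lim Z a y := trivial
@[simp] theorem lim_three : (3 : Ex).lim Z a y := trivial
@[simp] theorem lim_zero : (0 : Ex).lim Z a y := trivial
@[simp] theorem lim_one : (1 : Ex).lim Z a y := trivial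
@[simp] theorem lim_c (z : ℤ) : (c z).lim Z a y := trivial
@[simp] theorem lim_v (x : ℕ) : (v x).lim Z a y := trivial
@[simp] theorem lim_loc : loc.lim Z a y := trivial
@[simp] theorem lim_arr (t : Fin 16) (e : Ex) : (arr t e).lim Z a y ↔ e.lim Z a y := Iff.rfl
@[simp] theorem lim_ifle (e f p q : Ex) : (ifle e f p q).lim Z a y ↔
    e.lim Z a y ∧ f.lim Z a y ∧ p.lim Z a y ∧ q.lim Z a y := Iff.rfl
@[simp] theorem lim_ifeq (e f p q : Ex) : (ifeq e f p q).lim Z a y ↔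
    e.lim Z a y ∧ f.lim Z a y ∧ p.lim Z a y ∧ q.lim Z a y := by
  simp only [ifeq, lim_ifle]; tauto
@[simp] theorem lim_mod (e f : Ex) : (mod e f).lim Z a y ↔ e.lim Z a y ∧ f.lim Z a y := by
  simp only [mod, lim_sub, lim_mul, lim_div]; tauto
@[simp] theorem lim_sum (n e : Ex) : (sum n e).lim Z a y ↔ n.lim Z a y ∧ (n.eval a y).toNat ≤ Z ∧
      ∀ j < (n.eval a y).toNat, e.lim Z a (j : ℕ) := Iff.rfl

end Ex

open Ex

@[simp] theorem setVar_var (a : AState) (x y : ℕ) (z : ℤ) :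
    (a.setVar x z).var y = if y = x then z else a.var y := Function.update_apply _ _ _ _
@[simp] theorem setVar_arr (a : AState) (x : ℕ) (z : ℤ) : (a.setVar x z).arr = a.arr := rfl
@[simp] theorem setVar_inp (a : AState) (x : ℕ) (z : ℤ) : (a.setVar x z).inp = a.inp := rfl
@[simp] theorem setVar_out (a : AState) (x : ℕ) (z : ℤ) : (a.setVar x z).out = a.out := rfl
@[simp] theorem setArr_var (a : AState) (t : Fin 16) (f : ℕ → ℤ) : (a.setArr t f).var = a.var := rfl
@[simp] theorem setArr_arr (a : AState) (t t' : Fin 16) (f : ℕ → ℤ) :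
    (a.setArr t f).arr t' = if t' = t then f else a.arr t' := Function.update_apply _ _ _ _
@[simp] theorem setArr_inp (a : AState) (t : Fin 16) (f : ℕ → ℤ) : (a.setArr t f).inp = a.inp := rfl
@[simp] theorem setArr_out (a : AState) (t : Fin 16) (f : ℕ → ℤ) : (a.setArr t f).out = a.out := rfl

/-! ### Reading the input -/

/-- Read a label, look it up in the dictionary (extending the dictionary if necessary), and store
its position in the array `t`. -/
def lookup (t : Fin 16) : Stmt :=
  .seq (.read vS) (.seq (.aset aD (v vC) (v vS))
  (.seq (.assign vJ (v vC + sum (v vC) (ifeq (arr aD loc) (v vS) (loc - v vC) 0)))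
  (.seq (.aset t (v vN) (v vJ)) (.assign vC (ifle (v vJ + 1) (v vC) (v vC) (v vC + 1))))))

/-- Read the tag of a node and update the counters. -/
def parseTag : Stmt :=
  .seq (.read vT) (.seq (.aset aO (v vN) (v vT))
  (.seq (.assign vL (v vL + ifle (v vT) 0 1 0))
  (.seq (.assign vX (v vX * ifle (v vT) 0 2 1))
    (.assign vP (v vP + ifle (v vT) 0 (c (-1)) (ifle (v vT) 2 0 1))))))

/-- Read the labels of a node with tag in variable `vT`. -/
def parseLabels : Stmt :=
  .ite (v vT) 2 (.seq (lookup aA) (.ite 1 (v vT) (lookup aB) (.assign vJ 0))) (.assign vJ 0)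

/-- Read a node. -/
def parseNode : Stmt :=
  .seq parseTag (.seq parseLabels (.assign vN (v vN + 1)))

/-- The array `aD` holds the labels in `dict`. -/
structure DictRep {cw : ℕ} (a : AState) (dict : List (Fin cw)) : Prop where
  length : a.var vC = dict.length
  get : ∀ (i : ℕ) (l : Fin cw), dict[i]? = some l → a.arr aD i = (l : ℕ)

/-- `z` is the position of `l` in `dict`. -/
def Position {cw : ℕ} (dict : List (Fin cw)) (z : ℤ) (l : Fin cw) : Prop :=
  ∃ i : ℕ, z = i ∧ dict[i]? = some l

theorem Position.mono {cw : ℕ} {dict dict' : List (Fin cw)} (h : dict <+: dict') (z : ℤ) (l : Fin cw)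
    (hz : Position dict z l) : Position dict' z l := by
  obtain ⟨i, rfl, hi⟩ := hz
  obtain ⟨d, rfl⟩ := h
  exact ⟨i, rfl, by rw [List.getElem?_append_left (List.getElem?_eq_some_iff.1 hi).1, hi]⟩

/-- A dictionary without repetitions has at most one matching entry, so the sum has at most one
nonzero term. Added to the length it gives the position of the label, or the length itself for a new
label. -/
theorem sum_lookup {cw : ℕ} (dict : List (Fin cw)) (hd : dict.Nodup) (f : ℕ → ℤ)
    (hf : ∀ (i : ℕ) (l : Fin cw), dict[i]? = some l → f i = (l : ℕ)) (l : Fin cw) :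
    (∃ i : ℕ, dict[i]? = some l ∧ (∑ j ∈ Finset.range dict.length,
      if f j = (l : ℕ) then (j : ℤ) - dict.length else 0) = i - dict.length) ∨
    l ∉ dict ∧ (∑ j ∈ Finset.range dict.length,
      if f j = (l : ℕ) then (j : ℤ) - dict.length else 0) = 0 := by
  have key : ∀ j < dict.length, f j = (l : ℕ) → dict[j]? = some l := by
    intro j hj h
    have h1 := hf j dict[j] (List.getElem?_eq_getElem hj)
    rw [h1] at h
    have : dict[j] = l := Fin.ext (by exact_mod_cast h)
    rw [← this]
    exact List.getElem?_eq_getElem hj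
  by_cases hl : l ∈ dict
  · left
    obtain ⟨i, hi⟩ := List.mem_iff_getElem?.1 hl
    refine ⟨i, hi, ?_⟩
    have hil := (List.getElem?_eq_some_iff.1 hi).1
    rw [Finset.sum_eq_single_of_mem i (Finset.mem_range.2 hil), if_pos (hf i l hi)]
    intro j hj hji
    rw [if_neg]
    intro h
    have h1 := key j (Finset.mem_range.1 hj) h
    exact hji ((List.getElem?_inj (Finset.mem_range.1 hj) hd).1 (h1.trans hi.symm))
  · right
    refine ⟨hl, Finset.sum_eq_zero fun j hj => if_neg fun h => hl ?_⟩
    exact List.mem_iff_getElem?.2 ⟨j, key j (Finset.mem_range.1 hj) h⟩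

theorem len_le_of_le {x : ℤ} {n Z : ℕ} (h : x.natAbs ≤ n) (hZ : n + 1 ≤ Z) : len x ≤ Z :=
  ((len_le_of_natAbs_le (y := (n : ℤ)) (by simpa using h)).trans (len_natCast_le n)).trans hZ

/-- The label is written behind the end of the dictionary before the search. If the search fails,
this entry becomes part of the dictionary; otherwise it stays outside the represented range and does
no harm. -/
theorem lookup_spec {cw : ℕ} (Z : ℕ) (t : Fin 16) (ht : t ≠ aD) (a : AState)
    (dict : List (Fin cw)) (hd : dict.Nodup) (hr : DictRep a dict) (l : Fin cw) (rest : List ℤ)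
    (n : ℕ) (hinp : a.inp = ((l : ℕ) : ℤ) :: rest) (hn : a.var vN = n)
    (hl : len ((l : ℕ) : ℤ) ≤ Z) (hZ : dict.length + 3 ≤ Z) :
    (lookup t).ok Z a ∧ ∃ dict' : List (Fin cw), dict <+: dict' ∧ dict'.Nodup ∧
      dict'.length ≤ dict.length + 1 ∧ DictRep ((lookup t).run a) dict' ∧
      ((lookup t).run a).inp = rest ∧ ((lookup t).run a).out = a.out ∧
      (∃ z, Position dict' z l ∧ ((lookup t).run a).arr t = Function.update (a.arr t) n z) ∧
      (∀ t', t' ≠ t → t' ≠ aD → ((lookup t).run a).arr t' = a.arr t') ∧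
      ∀ x, x ≠ vS → x ≠ vJ → x ≠ vC → ((lookup t).run a).var x = a.var x := by
  have hC := hr.length
  set f := Function.update (a.arr aD) dict.length ((l : ℕ) : ℤ) with hf
  have hfd : ∀ (i : ℕ) (l : Fin cw), dict[i]? = some l → f i = (l : ℕ) := by
    intro i l' hi
    have hil := (List.getElem?_eq_some_iff.1 hi).1
    rw [hf, Function.update_of_ne (by omega)]
    exact hr.get i l' hi
  set z := (dict.length : ℤ) + ∑ j ∈ Finset.range dict.length,
      (if f j = (l : ℕ) then (j : ℤ) - dict.length else 0) with hz
  obtain ⟨i, hzi, hi⟩ : ∃ i : ℕ, z = i ∧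
      (dict[i]? = some l ∧ i < dict.length ∨ l ∉ dict ∧ i = dict.length) := by
    rcases sum_lookup dict hd f hfd l with ⟨i, hi, hs⟩ | ⟨hl, hs⟩
    · exact ⟨i, by rw [hz, hs]; ring, Or.inl ⟨hi, (List.getElem?_eq_some_iff.1 hi).1⟩⟩
    · exact ⟨dict.length, by rw [hz, hs]; ring, Or.inr ⟨hl, rfl⟩⟩
  have hile : i ≤ dict.length := by rcases hi with hi | hi <;> omega
  have ht' : aD ≠ t := ht.symm
  have hsum : ∀ b : AState, b.var vC = dict.length → b.arr aD = f → b.var vS = (l : ℕ) →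
      (v vC + sum (v vC) (ifeq (arr aD loc) (v vS) (loc - v vC) 0)).eval b 0 = i := by
    intro b h1 h2 h3
    rw [← hzi, hz]
    simp only [eval_add, eval_v, eval_sum, h1, Int.toNat_natCast]
    congr 1
    refine Finset.sum_congr rfl fun j _ => ?_
    rw [eval_ifeq, eval_arr (n := j) rfl]
    simp only [h2, h3, h1, eval_v, eval_sub, eval_loc, eval_zero]
  set a₁ : AState := { a.setVar vS ((l : ℕ) : ℤ) with inp := rest } with ha₁
  set a₂ := a₁.setArr aD f with ha₂
  set a₃ := a₂.setVar vJ (i : ℤ) with ha₃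
  set a₄ := a₃.setArr t (Function.update (a.arr t) n (i : ℤ)) with ha₄
  set a₅ := a₄.setVar vC (if (i : ℤ) + 1 ≤ dict.length then (dict.length : ℤ)
    else dict.length + 1) with ha₅
  have r1 : (Stmt.read vS).run a = a₁ := by
    simp only [Stmt.run, hinp, List.headD_cons, List.tail_cons, ha₁]
  have r2 : (Stmt.aset aD (v vC) (v vS)).run a₁ = a₂ := by
    simp [Stmt.run, ha₁, ha₂, hC, hf]
  have e3 : (v vC + sum (v vC) (ifeq (arr aD loc) (v vS) (loc - v vC) 0)).eval a₂ 0 = i := by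
    refine hsum a₂ ?_ ?_ ?_
    · simp [ha₁, ha₂, hC]
    · simp [ha₂]
    · simp [ha₂, ha₁]
  have r3 : (Stmt.assign vJ (v vC + sum (v vC) (ifeq (arr aD loc) (v vS) (loc - v vC) 0))).run a₂ =
      a₃ := by
    simp only [Stmt.run, e3, ha₃]
  have r4 : (Stmt.aset t (v vN) (v vJ)).run a₃ = a₄ := by
    simp [Stmt.run, ha₄, ha₃, ha₂, ha₁, hn, ht]
  have e5 : (ifle (v vJ + 1) (v vC) (v vC) (v vC + 1)).eval a₄ 0 =
      if (i : ℤ) + 1 ≤ dict.length then (dict.length : ℤ) else dict.length + 1 := by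
    simp [ha₄, ha₃, ha₂, ha₁, hC]
  have r5 : (Stmt.assign vC (ifle (v vJ + 1) (v vC) (v vC) (v vC + 1))).run a₄ = a₅ := by
    simp only [Stmt.run, e5, ha₅]
  have hrun : (lookup t).run a = a₅ := by
    show Stmt.run _ (Stmt.run _ (Stmt.run _ (Stmt.run _ (Stmt.run _ a)))) = a₅
    rw [r1, r2, r3, r4, r5]
  have hok : (lookup t).ok Z a := by
    refine ⟨trivial, ?_⟩
    rw [r1]
    refine ⟨⟨trivial, ?_, trivial, ?_⟩, ?_⟩
    · simp [ha₁, hC]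
    · simpa [ha₁] using hl
    rw [r2]
    refine ⟨⟨?_, ?_⟩, ?_⟩
    · have : a₂.var vC = dict.length := by simp [ha₁, ha₂, hC]
      simp [this]; omega
    · rw [e3]; exact len_le_of_le (n := dict.length) (by simpa using hile) (by omega)
    rw [r3]
    refine ⟨⟨trivial, ?_, trivial, ?_⟩, ?_⟩
    · simp [ha₃, ha₂, ha₁, hn]
    · have : (v vJ).eval a₃ 0 = i := by simp [ha₃]
      rw [this]; exact len_le_of_le (n := dict.length) (by simpa using hile) (by omega)
    rw [r4]
    refine ⟨by simp, ?_⟩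
    rw [e5]
    refine len_le_of_le (n := dict.length + 1) ?_ (by omega)
    split_ifs <;> omega
  refine ⟨hok, ?_⟩
  rw [hrun]
  have hD : a₅.arr aD = f := by simp [ha₅, ha₄, ha₃, ha₂, ht']
  have hvC : a₅.var vC = if (i : ℤ) + 1 ≤ dict.length then (dict.length : ℤ)
    else dict.length + 1 := by simp [ha₅]
  have hrest : a₅.inp = rest ∧ a₅.out = a.out ∧
      a₅.arr t = Function.update (a.arr t) n (i : ℤ) ∧
      (∀ t', t' ≠ t → t' ≠ aD → a₅.arr t' = a.arr t') ∧
      ∀ x, x ≠ vS → x ≠ vJ → x ≠ vC → a₅.var x = a.var x := by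
    refine ⟨rfl, rfl, by simp [ha₅, ha₄], fun t' h1 h2 => ?_, fun x h1 h2 h3 => ?_⟩
    · simp [ha₅, ha₄, ha₃, ha₂, ha₁, h1, h2]
    · simp [ha₅, ha₄, ha₃, ha₂, ha₁, h1, h2, h3]
  obtain ⟨hp1, hp2, hp3, hp4, hp5⟩ := hrest
  rcases hi with ⟨hi, hil⟩ | ⟨hnot, hil⟩
  · refine ⟨dict, List.prefix_refl _, hd, by omega, ⟨?_, ?_⟩, hp1, hp2, ⟨i, ⟨i, rfl, hi⟩, hp3⟩, hp4,
      hp5⟩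
    · rw [hvC, if_pos (by omega)]
    · rw [hD]; exact hfd
  · refine ⟨dict ++ [l], List.prefix_append _ _, ?_, by simp, ⟨?_, ?_⟩, hp1, hp2,
      ⟨i, ⟨i, rfl, by rw [hil]; simp⟩, hp3⟩, hp4, hp5⟩
    · rw [List.nodup_append]
      refine ⟨hd, by simp, ?_⟩
      rintro x hx y hy rfl
      have hxl : x = l := by simpa using hy
      exact hnot (hxl ▸ hx)
    · rw [hvC, if_neg (by omega)]; simp
    · intro j l' hj
      rw [hD]
      rcases Nat.lt_or_ge j dict.length with hjl | hjl
      · rw [List.getElem?_append_left hjl] at hj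
        exact hfd j l' hj
      · rw [List.getElem?_append_right hjl] at hj
        have hj0 : j = dict.length := by
          have := (List.getElem?_eq_some_iff.1 hj).1
          simp at this
          omega
        subst hj0
        simp at hj
        rw [hf, Function.update_self, hj]

end RAM


/-! ### Reading the nodes of the preorder listing -/

namespace CWExpr

variable {cw : ℕ}

/-- The numbers that describe the root in the preorder listing. -/
def head : CWExpr cw → List ℕ
  | intro l => [0, l]
  | join a b _ => [1, a, b]
  | rename a b _ => [2, a, b]
  | union _ _ => [3]

theorem encode_eq (e : CWExpr cw) : e.encode = e.head ++ e.children.flatMap encode := by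
  cases e <;> simp [encode, head, children]

/-- The tag of the root. -/
def tag : CWExpr cw → ℕ
  | intro _ => 0
  | join _ _ _ => 1
  | rename _ _ _ => 2
  | union _ _ => 3

/-- The labels at the root. -/
def rootLabels : CWExpr cw → List (Fin cw)
  | intro l => [l]
  | join a b _ => [a, b]
  | rename a b _ => [a, b]
  | union _ _ => []

theorem head_eq (e : CWExpr cw) : e.head = e.tag :: e.rootLabels.map Fin.val := by
  cases e <;> rfl

end CWExpr

namespace RAM

open Ex CWExpr

/-- A leaf completes one pending expression and a union opens an additional one. The weight `vX`
doubles at every leaf, which turns the initial value 2 into `2^(n+1)`. -/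
theorem parseTag_spec (Z : ℕ) (a : AState) (o : ℕ) (rest : List ℤ) (n p L X : ℕ)
    (hinp : a.inp = (o : ℤ) :: rest) (hn : a.var vN = n) (hp : a.var vP = p) (hL : a.var vL = L)
    (hX : a.var vX = X) (ho : o ≤ 3) (hZ₁ : p + 4 ≤ Z) (hZ₂ : L + 4 ≤ Z)
    (hZ₃ : len ((2 * X : ℕ) : ℤ) ≤ Z) :
    parseTag.ok Z a ∧ (parseTag.run a).inp = rest ∧ (parseTag.run a).out = a.out ∧
      (parseTag.run a).arr aO = Function.update (a.arr aO) n o ∧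
      (∀ t, t ≠ aO → (parseTag.run a).arr t = a.arr t) ∧
      (parseTag.run a).var vT = o ∧ (parseTag.run a).var vL = (if o = 0 then L + 1 else L : ℕ) ∧
      (parseTag.run a).var vX = (if o = 0 then 2 * X else X : ℕ) ∧
      (parseTag.run a).var vP = (p : ℤ) + (if o = 0 then -1 else if o = 3 then 1 else 0) ∧
      ∀ x, x ≠ vT → x ≠ vL → x ≠ vX → x ≠ vP → (parseTag.run a).var x = a.var x := by
  have hlX : len ((X : ℕ) : ℤ) ≤ Z := (len_le_of_natAbs_le (by simp; omega)).trans hZ₃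
  have ho' : o = 0 ∨ o = 1 ∨ o = 2 ∨ o = 3 := by omega
  have h1 : len (L : ℤ) ≤ Z := len_le_of_le (n := L) (by simp) (by omega)
  have h2 : len ((L : ℤ) + 1) ≤ Z := len_le_of_le (n := L + 1) (by omega) (by omega)
  have h3 : len (p : ℤ) ≤ Z := len_le_of_le (n := p) (by simp) (by omega)
  have h4 : len ((p : ℤ) + 1) ≤ Z := len_le_of_le (n := p + 1) (by omega) (by omega)
  have h5 : len ((p : ℤ) + -1) ≤ Z := len_le_of_le (n := p + 1) (by omega) (by omega)
  have h6 : len (o : ℤ) ≤ Z := len_le_of_le (n := o) (by simp) (by omega)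
  have h7 : len ((X : ℤ) * 2) ≤ Z := by rw [mul_comm]; exact_mod_cast hZ₃
  refine ⟨?_, ?_, ?_, ?_, ?_, ?_, ?_, ?_, ?_, ?_⟩
  · rcases ho' with rfl | rfl | rfl | rfl <;>
      simp_all [parseTag, Stmt.ok, Stmt.run]
  · simp [parseTag, Stmt.run, hinp]
  · simp [parseTag, Stmt.run]
  · simp [parseTag, Stmt.run, hinp, hn]
  · intro t ht; simp [parseTag, Stmt.run, ht]
  · simp [parseTag, Stmt.run, hinp]
  · rcases ho' with rfl | rfl | rfl | rfl <;> simp [parseTag, Stmt.run, hinp, hL]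
  · rcases ho' with rfl | rfl | rfl | rfl <;> simp [parseTag, Stmt.run, hinp, hX, mul_comm]
  · rcases ho' with rfl | rfl | rfl | rfl <;> simp [parseTag, Stmt.run, hinp, hp]
  · intro x h1 h2 h3 h4; simp [parseTag, Stmt.run, h1, h2, h3, h4]

theorem parseLabels_spec {cw : ℕ} (Z : ℕ) (a : AState) (e : CWExpr cw)
    (dict : List (Fin cw)) (hd : dict.Nodup) (hr : DictRep a dict) (rest : List ℤ)
    (n : ℕ) (hinp : a.inp = (e.rootLabels.map fun l : Fin cw => ((l : ℕ) : ℤ)) ++ rest) (hn : a.var vN = n)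
    (ht : a.var vT = e.tag)
    (hl : ∀ l ∈ e.rootLabels, len ((l : ℕ) : ℤ) ≤ Z) (hZ : dict.length + 4 ≤ Z) :
    parseLabels.ok Z a ∧ ∃ dict' : List (Fin cw), dict <+: dict' ∧ dict'.Nodup ∧
      dict'.length ≤ dict.length + 2 ∧ DictRep (parseLabels.run a) dict' ∧
      (parseLabels.run a).inp = rest ∧ (parseLabels.run a).out = a.out ∧
      (∃ x y, NodeRep (Position dict') e.tag x y e ∧ (parseLabels.run a).arr aA n = x ∧
        (parseLabels.run a).arr aB n = y) ∧
      (∀ i ≠ n, (parseLabels.run a).arr aA i = a.arr aA i) ∧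
      (∀ i ≠ n, (parseLabels.run a).arr aB i = a.arr aB i) ∧
      (∀ t, t ≠ aA → t ≠ aB → t ≠ aD → (parseLabels.run a).arr t = a.arr t) ∧
      ∀ x, x ≠ vS → x ≠ vJ → x ≠ vC → (parseLabels.run a).var x = a.var x := by
  have hlen0 : len 0 ≤ Z := by have : len 0 = 1 := by decide
                               omega
  -- Joins and renames are read alike, which leaves the cases of two labels, one label and none.
  have hcase : (∃ l l' : Fin cw, e.rootLabels = [l, l'] ∧ (e.tag = 1 ∨ e.tag = 2) ∧
      (∀ (R : ℤ → Fin cw → Prop) x y, R x l → R y l' → NodeRep R (e.tag : ℕ) x y e)) ∨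
      (∃ l, e = intro l) ∨ ∃ e₁ e₂, e = union e₁ e₂ := by
    cases e with
    | join l l' e => exact Or.inl ⟨l, l', rfl, Or.inl rfl, fun R x y h h' => ⟨rfl, h, h'⟩⟩
    | rename l l' e => exact Or.inl ⟨l, l', rfl, Or.inr rfl, fun R x y h h' => ⟨rfl, h, h'⟩⟩
    | intro l => exact Or.inr (Or.inl ⟨l, rfl⟩)
    | union e₁ e₂ => exact Or.inr (Or.inr ⟨e₁, e₂, rfl⟩)
  rcases hcase with ⟨l, l', hroot, htag, hrep⟩ | ⟨l, rfl⟩ | ⟨e₁, e₂, rfl⟩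
  · rw [hroot] at hinp hl
    have hle : (v vT).eval a 0 ≤ (2 : Ex).eval a 0 := by
      simp only [eval_v, ht, eval_two]; omega
    obtain ⟨ok₁, dict₁, p₁, nd₁, len₁, rep₁, inp₁, out₁, ⟨x, hx, ax⟩, arr₁, var₁⟩ :=
      lookup_spec Z aA (by decide) a dict hd hr l _ n hinp hn (hl l (by simp)) (by omega)
    generalize hb : (lookup aA).run a = b at *
    have hle' : (1 : Ex).eval b 0 ≤ (v vT).eval b 0 := by
      simp only [eval_v, var₁ vT (by decide) (by decide) (by decide), ht, eval_one]; omega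
    have hn₁ : b.var vN = n := by rw [var₁ vN (by decide) (by decide) (by decide), hn]
    obtain ⟨ok₂, dict₂, p₂, nd₂, len₂, rep₂, inp₂, out₂, ⟨y, hy, ay⟩, arr₂, var₂⟩ :=
      lookup_spec Z aB (by decide) b dict₁ nd₁ rep₁ l' _ n inp₁ hn₁ (hl l' (by simp)) (by omega)
    have hrun : parseLabels.run a = (lookup aB).run b := by
      simp only [parseLabels, Stmt.run]
      rw [if_pos hle, hb, if_pos hle']
    have hok : parseLabels.ok Z a := by
      simp only [parseLabels, Stmt.ok]
      rw [if_pos hle, hb, if_pos hle']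
      exact ⟨trivial, trivial, ok₁, trivial, trivial, ok₂⟩
    refine ⟨hok, ?_⟩
    rw [hrun]
    refine ⟨dict₂, p₁.trans p₂, nd₂, by omega, rep₂, inp₂, out₂.trans out₁, ⟨x, y, ?_, ?_, ?_⟩,
      ?_, ?_, ?_, ?_⟩
    · exact hrep _ _ _ (hx.mono p₂) hy
    · rw [arr₂ aA (by decide) (by decide), ax, Function.update_self]
    · rw [ay, Function.update_self]
    · intro i hi; rw [arr₂ aA (by decide) (by decide), ax, Function.update_of_ne hi]
    · intro i hi; rw [ay, Function.update_of_ne hi, arr₁ aB (by decide) (by decide)]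
    · intro t h1 h2 h3; rw [arr₂ t h2 h3, arr₁ t h1 h3]
    · intro x h1 h2 h3; rw [var₂ x h1 h2 h3, var₁ x h1 h2 h3]
  · have hle : (v vT).eval a 0 ≤ (2 : Ex).eval a 0 := by
      simp [ht, tag]
    obtain ⟨ok₁, dict₁, p₁, nd₁, len₁, rep₁, inp₁, out₁, ⟨x, hx, ax⟩, arr₁, var₁⟩ :=
      lookup_spec Z aA (by decide) a dict hd hr l _ n hinp hn (hl l (by simp [rootLabels])) (by omega)
    generalize hb : (lookup aA).run a = b at *
    have hle' : ¬ (1 : Ex).eval b 0 ≤ (v vT).eval b 0 := by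
      simp [var₁ vT (by decide) (by decide) (by decide), ht, tag]
    have hrun : parseLabels.run a = b.setVar vJ 0 := by
      simp only [parseLabels, Stmt.run]
      rw [if_pos hle, hb, if_neg hle', eval_zero]
    have hok : parseLabels.ok Z a := by
      simp only [parseLabels, Stmt.ok]
      rw [if_pos hle, hb, if_neg hle']
      exact ⟨trivial, trivial, ok₁, trivial, trivial, trivial, hlen0⟩
    refine ⟨hok, ?_⟩
    rw [hrun]
    refine ⟨dict₁, p₁, nd₁, by omega, ⟨?_, rep₁.get⟩, inp₁, out₁, ⟨x, _, ⟨rfl, hx⟩, ?_, rfl⟩,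
      ?_, ?_, ?_, ?_⟩
    · simpa using rep₁.length
    · rw [setVar_arr, ax, Function.update_self]
    · intro i hi; rw [setVar_arr, ax, Function.update_of_ne hi]
    · intro i hi; rw [setVar_arr, arr₁ aB (by decide) (by decide)]
    · intro t h1 h2 h3; rw [setVar_arr, arr₁ t h1 h3]
    · intro x h1 h2 h3; rw [setVar_var, if_neg h2, var₁ x h1 h2 h3]
  · have hle : ¬ (v vT).eval a 0 ≤ (2 : Ex).eval a 0 := by
      simp [ht, tag]
    have hrun : parseLabels.run a = a.setVar vJ 0 := by
      simp only [parseLabels, Stmt.run]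
      rw [if_neg hle, eval_zero]
    have hok : parseLabels.ok Z a := by
      simp only [parseLabels, Stmt.ok]
      rw [if_neg hle]
      exact ⟨trivial, trivial, trivial, hlen0⟩
    refine ⟨hok, ?_⟩
    rw [hrun]
    refine ⟨dict, List.prefix_refl _, hd, by omega, ⟨?_, hr.get⟩, hinp, rfl, ⟨_, _, rfl, rfl, rfl⟩,
      fun _ _ => rfl, fun _ _ => rfl, fun _ _ _ _ => rfl, ?_⟩
    · simpa using hr.length
    · intro x h1 h2 h3; rw [setVar_var, if_neg h2]

/-- The state of the parser: `done` lists the nodes that have been read, `st` the expressions that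
are still to be read. -/
structure ParseState {cw : ℕ} (k r : ℕ) (done st : List (CWExpr cw)) (dict : List (Fin cw))
    (a : AState) : Prop where
  inp : a.inp = (st.flatMap encode).map fun n : ℕ => (n : ℤ)
  out : a.out = []
  varK : a.var vK = k
  varR : a.var vR = r
  varP : a.var vP = st.length
  varN : a.var vN = done.length
  varL : a.var vL = leaves done
  varX : a.var vX = (2 ^ (leaves done + 1) : ℕ)
  nodup : dict.Nodup
  dictRep : DictRep a dict
  dict_le : dict.length ≤ 2 * done.length
  node : ∀ (i : ℕ) e, done[i]? = some e →
    NodeRep (Position dict) (a.arr aO i) (a.arr aA i) (a.arr aB i) e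
  flags : ∀ i, a.arr aH i = 0

theorem length_le_flatMap_preorder {cw : ℕ} (st : List (CWExpr cw)) :
    st.length ≤ (st.flatMap preorder).length := by
  induction st with
  | nil => simp
  | cons e st ih =>
    have := e.size_pos
    simp only [List.length_cons, List.flatMap_cons, List.length_append]
    unfold size at this
    omega

theorem leaves_append {cw : ℕ} (l l' : List (CWExpr cw)) : leaves (l ++ l') = leaves l + leaves l' :=
  List.countP_append ..

theorem leaves_singleton {cw : ℕ} (e : CWExpr cw) : leaves [e] = if e.tag = 0 then 1 else 0 := by
  cases e <;> rfl

theorem leaves_le {cw : ℕ} (l : List (CWExpr cw)) : leaves l ≤ l.length := List.countP_le_length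

theorem length_children {cw : ℕ} (e : CWExpr cw) : (e.children.length : ℤ) =
    1 + if e.tag = 0 then -1 else if e.tag = 3 then 1 else 0 := by
  cases e <;> rfl

theorem tag_le {cw : ℕ} (e : CWExpr cw) : e.tag ≤ 3 := by
  cases e <;> simp [tag]

/-- Reading the root of the first pending expression replaces it by its children. The stack of
pending expressions exists only in the invariant; the machine stores just its height. -/
theorem ParseState.step {cw : ℕ} {k r : ℕ} {done st : List (CWExpr cw)} {dict : List (Fin cw)}
    {a : AState} {e : CWExpr cw} (h : ParseState k r done (e :: st) dict a) {Z N : ℕ}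
    (hN : done.length + ((e :: st).flatMap preorder).length ≤ N) (hZ : 2 * N + 8 ≤ Z)
    (hcw : len (cw : ℤ) ≤ Z) :
    parseNode.ok Z a ∧
      ∃ dict', ParseState k r (done ++ [e]) (e.children ++ st) dict' (parseNode.run a) := by
  have h1 := length_le_flatMap_preorder (e :: st)
  have h2 := leaves_le done
  rw [List.length_cons] at h1
  have hinp : a.inp = (e.tag : ℤ) :: ((e.rootLabels.map fun l : Fin cw => ((l : ℕ) : ℤ)) ++
      ((e.children ++ st).flatMap encode).map fun n : ℕ => (n : ℤ)) := by
    rw [h.inp, List.flatMap_cons, encode_eq, head_eq]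
    simp
  obtain ⟨ok₁, inp₁, out₁, arr₁, arr₁', varT, varL, varX, varP, var₁⟩ :=
    parseTag_spec Z a e.tag _ _ _ _ _ hinp h.varN h.varP h.varL h.varX (tag_le e)
      (by rw [List.length_cons]; omega) (by omega)
      ((len_le_of_abs_lt (n := leaves done + 3) (by
        rw [Int.natAbs_natCast, pow_succ _ (leaves done + 2), pow_succ _ (leaves done + 1)]
        have := Nat.pos_of_ne_zero (pow_ne_zero (leaves done + 1) (two_ne_zero (α := ℕ)))
        omega)).trans (by omega))
  generalize hb : parseTag.run a = b at *
  obtain ⟨ok₂, dict', hp, nd, hlen, rep, inp₂, out₂, ⟨x, y, hxy, ax, ay⟩, arrA, arrB, arr₂, var₂⟩ :=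
    parseLabels_spec Z b e dict h.nodup
      ⟨by rw [var₁ vC (by decide) (by decide) (by decide) (by decide), h.dictRep.length],
        by rw [arr₁' aD (by decide)]; exact h.dictRep.get⟩ _ done.length inp₁
      (by rw [var₁ vN (by decide) (by decide) (by decide) (by decide), h.varN]) varT
      (fun l _ => (len_le_of_natAbs_le (by simp)).trans hcw)
      (by have := h.dict_le; omega)
  generalize hb' : parseLabels.run b = b' at *
  have hN' : b'.var vN = done.length := by
    rw [var₂ vN (by decide) (by decide) (by decide),
      var₁ vN (by decide) (by decide) (by decide) (by decide), h.varN]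
  have hrun : parseNode.run a = b'.setVar vN (done.length + 1) := by
    show Stmt.run _ (parseLabels.run (parseTag.run a)) = _
    rw [hb, hb']
    simp [Stmt.run, hN']
  refine ⟨⟨ok₁, ?_⟩, dict', ?_⟩
  · rw [hb]
    refine ⟨ok₂, ?_⟩
    show Stmt.ok _ _ (parseLabels.run b)
    rw [hb']
    refine ⟨⟨trivial, trivial⟩, ?_⟩
    simp only [eval_add, eval_v, eval_one, hN']
    exact len_le_of_le (n := done.length + 1) (by omega) (by omega)
  rw [hrun]
  have hO : b'.arr aO = Function.update (a.arr aO) done.length e.tag := by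
    rw [arr₂ aO (by decide) (by decide) (by decide), arr₁]
  refine ⟨?_, ?_, ?_, ?_, ?_, ?_, ?_, ?_, nd, ⟨?_, ?_⟩, ?_, ?_, ?_⟩
  · rw [setVar_inp, inp₂]
  · rw [setVar_out, out₂, out₁, h.out]
  · rw [setVar_var, if_neg (by decide), var₂ _ (by decide) (by decide) (by decide),
      var₁ _ (by decide) (by decide) (by decide) (by decide), h.varK]
  · rw [setVar_var, if_neg (by decide), var₂ _ (by decide) (by decide) (by decide),
      var₁ _ (by decide) (by decide) (by decide) (by decide), h.varR]
  · rw [setVar_var, if_neg (by decide), var₂ _ (by decide) (by decide) (by decide), varP,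
      List.length_append, List.length_cons, Nat.cast_add, Nat.cast_add, length_children]
    push_cast
    ring
  · rw [setVar_var, if_pos rfl, List.length_append]; simp
  · rw [setVar_var, if_neg (by decide), var₂ _ (by decide) (by decide) (by decide), varL,
      leaves_append, leaves_singleton]
    split_ifs <;> simp
  · rw [setVar_var, if_neg (by decide), var₂ _ (by decide) (by decide) (by decide), varX,
      leaves_append, leaves_singleton]
    split_ifs <;> simp [pow_succ]
    ring
  · rw [setVar_var, if_neg (by decide), rep.length]
  · rw [setVar_arr]; exact rep.get
  · have := h.dict_le
    simp
    omega
  · intro i e' hi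
    rw [setVar_arr, hO]
    rcases Nat.lt_or_ge i done.length with hil | hil
    · rw [List.getElem?_append_left hil] at hi
      rw [Function.update_of_ne (by omega), arrA i (by omega), arrB i (by omega),
        arr₁' aA (by decide), arr₁' aB (by decide)]
      exact (h.node i e' hi).mono fun z l => Position.mono hp z l
    · have hi0 : i = done.length := by
        have := (List.getElem?_eq_some_iff.1 hi).1
        simp at this
        omega
      subst hi0
      simp at hi
      subst hi
      rw [Function.update_self, ax, ay]
      exact hxy
  · intro i
    rw [setVar_arr, arr₂ aH (by decide) (by decide) (by decide), arr₁' aH (by decide), h.flags]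

end RAM


/-! ### From the input tape to an expression over the dictionary -/

namespace RAM

open Ex CWExpr

/-- The initial array state. -/
def AState.init (inp : List ℤ) : AState := ⟨fun _ => 0, fun _ _ => 0, inp, []⟩

theorem sim_init (inp : List ℕ) : Sim (AState.init (inp.map fun n : ℕ => (n : ℤ))) (initState inp) :=
  ⟨fun _ => rfl, fun _ _ => rfl,
    -- In `initState` the cast acts on the list, as a bind, before the identity is mapped over it.
    (List.map_id' _).trans (List.map_eq_flatMap (f := fun n : ℕ => (n : ℤ))).symm, rfl⟩

theorem bdd_init {Z : ℕ} {inp : List ℤ} (hZ : 1 ≤ Z) (h : ∀ z ∈ inp, len z ≤ Z) :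
    Bdd Z (AState.init inp) := by
  have h0 : len 0 = 1 := by decide
  exact ⟨fun _ => h0.trans_le hZ, fun _ _ => h0.trans_le hZ, h⟩

/-- The state after parsing an expression. -/
structure Parsed {c : ℕ} (T : CWExpr c) (k r : ℕ) (a : AState) : Prop where
  out : a.out = []
  varK : a.var vK = k
  varR : a.var vR = r
  varN : a.var vN = T.size
  varC : a.var vC = c
  varL : a.var vL = Fintype.card T.Vert
  varX : a.var vX = (2 ^ (Fintype.card T.Vert + 1) : ℕ)
  node : ∀ (i : ℕ) e, T.preorder[i]? = some e →
    NodeRep (fun z l => z = (l : ℕ)) (a.arr aO i) (a.arr aA i) (a.arr aB i) e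

/-- Labels are replaced by their dictionary positions. The dictionary has no repetitions, so mapping
positions back to labels is injective and the constructed graph stays the same up to isomorphism. -/
theorem ParseState.parsed {cw k r : ℕ} {T : CWExpr cw} {dict : List (Fin cw)} {a : AState}
    (h : ParseState k r T.preorder [] dict a) :
    ∃ (T' : CWExpr dict.length) (ψ : Fin dict.length → Fin cw), Function.Injective ψ ∧
      T'.map ψ = T ∧ Parsed T' k r a := by
  have hinj := List.nodup_iff_injective_get.1 h.nodup
  obtain ⟨T', hT⟩ := exists_map_eq dict.get (R := Position dict) (fun z l ⟨i, _, hi⟩ => by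
    obtain ⟨hil, rfl⟩ := List.getElem?_eq_some_iff.1 hi
    exact ⟨⟨i, hil⟩, rfl⟩) T (fun x hx => by
      obtain ⟨i, hi⟩ := List.mem_iff_getElem?.1 hx
      exact ⟨_, _, _, h.node i x hi⟩)
  have hpre : T.preorder = T'.preorder.map (map dict.get) := by rw [← hT, preorder_map]
  have hleaves : leaves T.preorder = Fintype.card T'.Vert := by
    rw [card_vert, hpre, leaves, List.countP_map, leaves]
    refine List.countP_congr fun e _ => ?_
    cases e <;> rfl
  refine ⟨T', dict.get, hinj, hT, h.out, h.varK, h.varR, ?_, h.dictRep.length, ?_, ?_, ?_⟩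
  · rw [h.varN, hpre, List.length_map, size]
  · rw [h.varL, hleaves]
  · rw [h.varX, hleaves]
  · intro i e hi
    have h1 := h.node i (e.map dict.get) (by rw [hpre, List.getElem?_map, hi]; rfl)
    refine h1.of_map ?_
    rintro z l ⟨j, rfl, hj⟩
    obtain ⟨hj, hjl⟩ := List.getElem?_eq_some_iff.1 hj
    have := hinj (a₁ := ⟨j, hj⟩) (a₂ := l) hjl
    rw [← this]

/-- Read the numbers in front of the expression. -/
def parseInit : Stmt :=
  .seq (.read vK) (.seq (.read vR) (.seq (.read vT) (.seq (.assign vP 1) (.assign vX 2))))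

/-- Read the input. -/
def parse : Prog := .seq parseInit.code (whilePos vP parseNode)

/-- The number of rounds left is the number of nodes of the pending expressions. It vanishes only
when nothing is pending, because every expression has a node. -/
theorem exists_tri_parse : ∃ P : Polynomial ℕ, ∀ (Z k r cw : ℕ) (T : CWExpr cw),
    Bdd Z (AState.init ((centerInput k r T).map fun n : ℕ => (n : ℤ))) → 2 * T.size + 8 ≤ Z →
    ∃ (c : ℕ) (T' : CWExpr c) (ψ : Fin c → Fin cw) (a : AState), Function.Injective ψ ∧
      c ≤ 2 * T.size ∧ T'.map ψ = T ∧ Parsed T' k r a ∧ (∀ i, a.arr aH i = 0) ∧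
      Tri Z (AState.init ((centerInput k r T).map fun n : ℕ => (n : ℤ))) parse (P.eval Z) a := by
  obtain ⟨P₁, h₁⟩ := parseInit.exists_tri
  obtain ⟨P₂, h₂⟩ := exists_tri_whilePos vP parseNode
  refine ⟨P₁ + (Polynomial.X + 1) * P₂, fun Z k r cw T hb hZ => ?_⟩
  set a₀ := AState.init ((centerInput k r T).map fun n : ℕ => (n : ℤ)) with ha₀
  have hcw : len (cw : ℤ) ≤ Z := hb.inp _ (by simp [ha₀, AState.init, centerInput])
  have hl1 : len 1 ≤ Z := by have : len 1 = 2 := by decide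
                             omega
  have hl2 : len 2 ≤ Z := by have : len 2 = 3 := by decide
                             omega
  have t₁ := h₁ Z a₀ hb (by simp [parseInit, Stmt.ok, hl1, hl2])
  have hI : ParseState k r [] [T] [] (parseInit.run a₀) := by
    refine ⟨?_, ?_, ?_, ?_, ?_, ?_, ?_, ?_, List.nodup_nil, ⟨?_, ?_⟩, ?_, ?_, ?_⟩ <;>
      simp [parseInit, Stmt.run, ha₀, AState.init, centerInput, leaves]
  obtain ⟨a, t₂, done, st, dict, hT, hn, hP⟩ := h₂ Z (fun n a => ∃ done st dict,
    T.preorder = done ++ st.flatMap preorder ∧ n = (st.flatMap preorder).length ∧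
      ParseState k r done st dict a) (by
    rintro n a ⟨done, st, dict, hT, hn, hP⟩
    rcases st with _ | ⟨e, st⟩
    · simp at hn
    · obtain ⟨hok, dict', hP'⟩ := hP.step (Z := Z) (N := T.size)
        (by rw [size, hT, List.length_append]) hZ hcw
      refine ⟨?_, hok, done ++ [e], e.children ++ st, dict', ?_, ?_, hP'⟩
      · rw [hP.varP, List.length_cons]; push_cast; omega
      · rw [hT, List.flatMap_cons, preorder_eq e]; simp
      · rw [List.flatMap_cons, preorder_eq e] at hn
        rw [List.flatMap_append]
        simp only [List.length_append, List.cons_append, List.length_cons] at hn ⊢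
        omega) (by
    rintro a ⟨done, st, dict, hT, hn, hP⟩
    have := length_le_flatMap_preorder st
    rw [hP.varP]
    omega) T.size _ t₁.bdd ⟨[], [T], [], by simp, by simp [size], hI⟩
  have hst : st = [] := by
    have := length_le_flatMap_preorder st
    exact List.eq_nil_of_length_eq_zero (by omega)
  subst hst
  have hdone : T.preorder = done := by simpa using hT
  subst hdone
  obtain ⟨T', ψ, hψ, hmap, hp⟩ := hP.parsed
  refine ⟨_, T', ψ, a, hψ, hP.dict_le, hmap, hp, hP.flags, (t₁.seq t₂).mono ?_⟩
  rw [Polynomial.eval_add, Polynomial.eval_mul, Polynomial.eval_add, Polynomial.eval_X,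
    Polynomial.eval_one]
  have : (T.size + 1) * P₂.eval Z ≤ (Z + 1) * P₂.eval Z := Nat.mul_le_mul_right _ (by omega)
  omega

end RAM


namespace RAM

open Ex CWExpr

theorem len_mono {m n : ℕ} (h : m ≤ n) : len (m : ℤ) ≤ len (n : ℤ) :=
  len_le_of_natAbs_le (by simpa using h)

theorem Parsed.fill {c k r : ℕ} {T : CWExpr c} {a : AState} (h : Parsed T k r a) {t : Fin 16}
    (ht : aB < t) (τ : ℕ → ℤ) (z : ℤ) : Parsed T k r ((a.setArr t τ).setVar vI z) := by
  have h0 : aO ≠ t := by rintro rfl; exact absurd ht (by decide)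
  have h1 : aA ≠ t := by rintro rfl; exact absurd ht (by decide)
  have h2 : aB ≠ t := by rintro rfl; exact absurd ht (by decide)
  refine ⟨h.out, ?_, ?_, ?_, ?_, ?_, ?_, ?_⟩
  · simpa using h.varK
  · simpa using h.varR
  · simpa using h.varN
  · simpa using h.varC
  · simpa using h.varL
  · simpa using h.varX
  · simpa [h0, h1, h2] using h.node

/-! ### Powers -/

/-- Fill the array `aP` with the powers of `vD`. -/
def powFill : Prog :=
  fill vI (v vC + 1) aP (v vC - v vI)
    (ifle (v vC - v vI) 0 1 (arr aP (v vC - v vI - 1) * v vD))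

/-- The loop index runs down, so setting entry `c - vI` produces the powers in increasing order,
each from the one before. -/
theorem exists_tri_powFill : ∃ P : Polynomial ℕ, ∀ (Z c D : ℕ) (a : AState), Bdd Z a →
    a.var vC = c → a.var vD = D → 1 ≤ D → c + 3 ≤ Z → len ((D ^ c : ℕ) : ℤ) ≤ Z →
      ∃ τ, Tri Z a powFill ((c + 1 + 1) * P.eval Z) ((a.setArr aP τ).setVar vI 0) ∧
        ∀ l ≤ c, τ l = (D ^ l : ℕ) := by
  obtain ⟨P, hP⟩ := exists_tri_fill vI (v vC + 1) aP (v vC - v vI)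
    (ifle (v vC - v vI) 0 1 (arr aP (v vC - v vI - 1) * v vD))
  refine ⟨P, fun Z c D a ha hC hD hD1 hZ hW => ?_⟩
  have h := hP Z (c + 1) a (fun k τ => ∀ l, l + k ≤ c → τ l = (D ^ l : ℕ)) ha (by simp)
    (by simp [hC]) ((len_natCast_le _).trans (by omega)) (by intro l hl; omega) ?_
  · obtain ⟨τ, ht, hτ⟩ := h
    exact ⟨τ, ht, fun l hl => hτ l (by omega)⟩
  intro k τ hk hJ
  generalize hb : (a.setArr aP τ).setVar vI k = b
  have hbI : b.var vI = k := by simp [← hb]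
  have hbC : b.var vC = c := by simp [← hb, hC]
  have hbD : b.var vD = D := by simp [← hb, hD]
  have hbP : b.arr aP = τ := by simp [← hb]
  refine ⟨c - k, (D ^ (c - k) : ℕ), by simp, by simp, ?_, ?_, ?_, ?_⟩
  · simp only [eval_sub, eval_v, hbI, hbC]; omega
  · simp only [eval_ifle, eval_sub, eval_v, hbI, hbC, eval_zero, eval_one, eval_mul, hbD]
    split_ifs with h
    · have : c - k = 0 := by omega
      rw [this]; simp
    · rw [eval_arr (n := c - k - 1) (by simp only [eval_sub, eval_v, hbI, hbC, eval_one]; omega), hbP,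
        hJ (c - k - 1) (by omega)]
      obtain ⟨m, hm⟩ : ∃ m, c - k = m + 1 := ⟨c - k - 1, by omega⟩
      rw [hm, Nat.add_sub_cancel, pow_succ]
      push_cast
      rfl
  · exact (len_mono (Nat.pow_le_pow_right hD1 (by omega))).trans hW
  · intro l hl
    by_cases h : l = c - k
    · rw [h, Function.update_self]
    · rw [Function.update_of_ne h]
      exact hJ l (by omega)

/-! ### Ends of subexpressions -/

/-- All subexpressions with the labels that get neighbours later on. -/
abbrev nodeList {c : ℕ} (T : CWExpr c) : List (CWExpr c × (Fin c → Prop)) := T.nodes fun _ => False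

theorem getElem?_preorder {c : ℕ} {T : CWExpr c} {i : ℕ} {x : CWExpr c × (Fin c → Prop)}
    (h : (nodeList T)[i]? = some x) : T.preorder[i]? = some x.1 := by
  rw [← nodes_map_fst T fun _ => False, List.getElem?_map, h]
  rfl

theorem lt_size {c : ℕ} {T : CWExpr c} {i : ℕ} {x : CWExpr c × (Fin c → Prop)}
    (h : (nodeList T)[i]? = some x) : i < T.size := by
  rw [← nodes_length T fun _ => False]
  exact (List.getElem?_eq_some_iff.1 h).1

theorem exists_node {c : ℕ} (T : CWExpr c) {i : ℕ} (h : i < T.size) :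
    ∃ x, (nodeList T)[i]? = some x := by
  rw [← nodes_length T fun _ => False] at h
  exact ⟨_, List.getElem?_eq_getElem h⟩

/-- `τ` gives for every node the position behind its subexpression. -/
def EndArr {c : ℕ} (T : CWExpr c) (τ : ℕ → ℤ) : Prop :=
  ∀ i x, (nodeList T)[i]? = some x → τ i = (i + x.1.size : ℕ)

/-- Fill the array `aE`. -/
def endFill : Prog :=
  fill vI (v vN) aE (v vI) (ifeq (arr aO (v vI)) 0 (v vI + 1) (ifeq (arr aO (v vI)) 3
    (arr aE (arr aE (v vI + 1))) (arr aE (v vI + 1))))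

/-- Children come later in preorder, so their ends are known when nodes are treated from the last to
the first. The second child of a union begins where the first one ends, and its end is the end of
the union. -/
theorem exists_tri_endFill : ∃ P : Polynomial ℕ, ∀ (Z c k r : ℕ) (T : CWExpr c) (a : AState),
    Bdd Z a → Parsed T k r a → T.size + 3 ≤ Z →
      ∃ τ, Tri Z a endFill ((T.size + 1) * P.eval Z) ((a.setArr aE τ).setVar vI 0) ∧
        EndArr T τ := by
  obtain ⟨P, hP⟩ := exists_tri_fill vI (v vN) aE (v vI) (ifeq (arr aO (v vI)) 0 (v vI + 1)
    (ifeq (arr aO (v vI)) 3 (arr aE (arr aE (v vI + 1))) (arr aE (v vI + 1))))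
  refine ⟨P, fun Z c k₀ r T a ha hp hZ => ?_⟩
  have h := hP Z T.size a (fun k τ => ∀ i x, (nodeList T)[i]? = some x → k ≤ i →
    τ i = (i + x.1.size : ℕ)) ha (by simp) (by simp [hp.varN]) ((len_natCast_le _).trans (by omega))
    (fun i x hx hi => absurd (lt_size hx) (by omega)) ?_
  · obtain ⟨τ, ht, hτ⟩ := h
    exact ⟨τ, ht, fun i x hx => hτ i x hx (Nat.zero_le _)⟩
  intro k τ hk hJ
  generalize hb : (a.setArr aE τ).setVar vI k = b
  have hbI : b.var vI = k := by simp [← hb]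
  have hbE : b.arr aE = τ := by simp [← hb]
  have hp' : Parsed T k₀ r b := hb ▸ hp.fill (by decide) _ _
  obtain ⟨x, hx⟩ := exists_node T hk
  have hrep := hp'.node k _ (getElem?_preorder hx)
  have hO : ∀ y, (arr aO (v vI)).eval b y = b.arr aO k := fun y => eval_arr (by simp [hbI])
  have hE : ∀ y, (arr aE (v vI + 1)).eval b y = τ (k + 1) := fun y => by
    rw [eval_arr (n := k + 1) (by simp [hbI]), hbE]
  have hsize := size_union_lt hx
  refine ⟨k, (k + x.1.size : ℕ), by simp, by simp, by simp [hbI], ?_,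
    (len_natCast_le _).trans (by omega), ?_⟩
  · simp only [eval_ifeq, hO, eval_zero, eval_three, eval_add, eval_v, eval_one, hbI, hE]
    obtain ⟨e, h⟩ := x
    cases e with
    | intro l =>
      rw [if_pos hrep.1]
      simp [size, preorder]
    | join l l' e =>
      rw [hrep.1, if_neg (by decide), if_neg (by decide),
        hJ (k + 1) _ (getElem?_of_isChild hx ⟨rfl, rfl⟩) le_rfl]
      simp only [size, preorder, List.length_cons]
      congr 1; omega
    | rename l l' e =>
      rw [hrep.1, if_neg (by decide), if_neg (by decide),
        hJ (k + 1) _ (getElem?_of_isChild hx ⟨rfl, rfl⟩) le_rfl]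
      simp only [size, preorder, List.length_cons]
      congr 1; omega
    | union e₁ e₂ =>
      rw [show b.arr aO k = 3 from hrep, if_neg (by decide), if_pos rfl]
      have h1 := hJ (k + 1) _ (getElem?_of_isChild hx (Or.inl ⟨rfl, rfl⟩)) le_rfl
      rw [eval_arr ((hE 0).trans h1), hbE,
        hJ (k + 1 + e₁.size) _ (getElem?_of_isChild hx (Or.inr ⟨rfl, rfl⟩)) (by omega)]
      simp only [size, preorder, List.length_cons, List.length_append]
      congr 1; omega
  · intro i y hy hi
    by_cases h : i = k
    · subst h
      rw [hx] at hy
      cases hy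
      rw [Function.update_self]
    · rw [Function.update_of_ne h]
      exact hJ i y hy (by omega)

end RAM


namespace RAM

open Ex CWExpr

open Classical in
/-- The indicator of a proposition. -/
noncomputable def ind (p : Prop) : ℤ := if p then 1 else 0

theorem ind_true {p : Prop} (h : p) : ind p = 1 := if_pos h

theorem ind_false {p : Prop} (h : ¬ p) : ind p = 0 := if_neg h

theorem len_ind_le {p : Prop} {Z : ℕ} (hZ : 2 ≤ Z) : len (ind p) ≤ Z := by
  have h0 : len 0 = 1 := by decide
  have h1 : len 1 = 2 := by decide
  unfold ind
  split_ifs <;> omega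

/-- The entry of the array `t` for node `i` and label `l`. -/
def Ex.cell (t : Fin 16) (i l : Ex) : Ex := arr t (i * v vC + l)

theorem Ex.eval_cell {t : Fin 16} {i l : Ex} {b : AState} {y : ℤ} {c m q : ℕ} (hC : b.var vC = c)
    (hi : i.eval b y = m) (hl : l.eval b y = q) : (cell t i l).eval b y = b.arr t (m * c + q) :=
  eval_arr (by simp [hC, hi, hl])

@[simp] theorem Ex.lim_cell {t : Fin 16} {i l : Ex} {b : AState} {y : ℤ} {Z : ℕ} :
    (cell t i l).lim Z b y ↔ i.lim Z b y ∧ l.lim Z b y := by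
  simp [cell]

theorem mul_add_inj {c i l i' l' : ℕ} (hl : l < c) (hl' : l' < c) (h : i * c + l = i' * c + l') :
    i = i' ∧ l = l' := by
  have h1 : (i * c + l) / c = i := by
    rw [mul_comm, Nat.mul_add_div (by omega), Nat.div_eq_of_lt hl, add_zero]
  have h2 : (i' * c + l') / c = i' := by
    rw [mul_comm, Nat.mul_add_div (by omega), Nat.div_eq_of_lt hl', add_zero]
  have h3 : i = i' := by rw [← h1, h, h2]
  subst h3
  exact ⟨rfl, by omega⟩

/-! ### Occurring labels -/

/-- `τ` gives for every node and label whether the label occurs. -/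
def OccArr {c : ℕ} (T : CWExpr c) (τ : ℕ → ℤ) : Prop :=
  ∀ i x, (nodeList T)[i]? = some x → ∀ l : Fin c, τ (i * c + l) = ind (x.1.Occurs l)

/-- One branch per kind of node; a disjunction of two indicators is the test that their sum is at
least 1. -/
def occExpr (i l : Ex) : Ex :=
  ifeq (arr aO i) 0 (ifeq (arr aA i) l 1 0)
  (ifeq (arr aO i) 1 (cell aN (i + 1) l)
  (ifeq (arr aO i) 2 (ifeq (arr aB i) l
      (ifle 1 (cell aN (i + 1) (arr aA i) + cell aN (i + 1) (arr aB i)) 1 0)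
      (ifeq (arr aA i) l 0 (cell aN (i + 1) l)))
    (ifle 1 (cell aN (i + 1) l + cell aN (arr aE (i + 1)) l) 1 0)))

/-- Fill the array `aN`. -/
def occFill : Prog := fill vI (v vN * v vC) aN (v vI) (occExpr (v vI / v vC) (mod (v vI) (v vC)))

theorem ite_one_le_ind_add (p q : Prop) :
    (if 1 ≤ ind p + ind q then 1 else 0) = ind (p ∨ q) := by
  unfold ind; split_ifs <;> simp_all

theorem eval_occExpr {c k r : ℕ} {T : CWExpr c} {b : AState} (hp : Parsed T k r b)
    (hE : EndArr T (b.arr aE)) {i : ℕ} {x : CWExpr c × (Fin c → Prop)}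
    (hx : (nodeList T)[i]? = some x) (iE lE : Ex) (l : Fin c) (hi : iE.eval b 0 = i)
    (hl : lE.eval b 0 = (l : ℕ)) (hN : ∀ j y, (nodeList T)[j]? = some y → i < j → ∀ l : Fin c,
      b.arr aN (j * c + l) = ind (y.1.Occurs l)) :
    (occExpr iE lE).eval b 0 = ind (x.1.Occurs l) := by
  have hrep := hp.node i _ (getElem?_preorder hx)
  have hi1 : (iE + 1).eval b 0 = (i + 1 : ℕ) := by simp [hi]
  have hO : (arr aO iE).eval b 0 = b.arr aO i := eval_arr hi
  have hA : (arr aA iE).eval b 0 = b.arr aA i := eval_arr hi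
  have hB : (arr aB iE).eval b 0 = b.arr aB i := eval_arr hi
  have hE' : (arr aE (iE + 1)).eval b 0 = b.arr aE (i + 1) := eval_arr hi1
  have hl1 := eval_cell (t := aN) hp.varC hi1 hl
  simp only [occExpr, eval_ifeq, hO, eval_zero, eval_one, eval_two, eval_ifle, hA, hB, hl,
    eval_add (cell _ _ _), hl1]
  obtain ⟨e, h⟩ := x
  have heq : ∀ l l' : Fin c, ((l : ℕ) : ℤ) = (l' : ℕ) ↔ l = l' := fun l l' => by
    rw [Nat.cast_inj, Fin.ext_iff]
  cases e with
  | intro l' =>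
    rw [if_pos hrep.1, hrep.2]
    simp only [heq, occurs_intro, ind]
  | join a b' e =>
    rw [hrep.1, if_neg (by decide), if_pos rfl,
      hN (i + 1) _ (getElem?_of_isChild hx ⟨rfl, rfl⟩) (by omega), occurs_join]
  | rename a b' e =>
    have h1 := hN (i + 1) _ (getElem?_of_isChild hx ⟨rfl, rfl⟩) (by omega)
    rw [eval_cell hp.varC hi1 (hA.trans hrep.2.1), eval_cell hp.varC hi1 (hB.trans hrep.2.2),
      hrep.1, if_neg (by decide), if_neg (by decide), if_pos rfl, h1, h1, h1, hrep.2.1, hrep.2.2,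
      ite_one_le_ind_add, occurs_rename]
    simp only [heq, eq_comm (b := l)]
    split_ifs <;> first | rfl | exact (ind_false id).symm
  | union e₁ e₂ =>
    have h1 := hE (i + 1) _ (getElem?_of_isChild hx (Or.inl ⟨rfl, rfl⟩))
    rw [eval_cell hp.varC (hE'.trans h1) hl, show b.arr aO i = 3 from hrep, if_neg (by decide),
      if_neg (by decide), if_neg (by decide),
      hN (i + 1) _ (getElem?_of_isChild hx (Or.inl ⟨rfl, rfl⟩)) (by omega),
      hN (i + 1 + e₁.size) _ (getElem?_of_isChild hx (Or.inr ⟨rfl, rfl⟩)) (by omega),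
      ite_one_le_ind_add, occurs_union]

theorem exists_tri_occFill : ∃ P : Polynomial ℕ, ∀ (Z c k r : ℕ) (T : CWExpr c) (a : AState),
    Bdd Z a → Parsed T k r a → EndArr T (a.arr aE) → len ((T.size * c : ℕ) : ℤ) ≤ Z → 2 ≤ Z →
      ∃ τ, Tri Z a occFill ((T.size * c + 1) * P.eval Z) ((a.setArr aN τ).setVar vI 0) ∧
        OccArr T τ := by
  obtain ⟨P, hP⟩ := exists_tri_fill vI (v vN * v vC) aN (v vI)
    (occExpr (v vI / v vC) (mod (v vI) (v vC)))
  refine ⟨P, fun Z c k₀ r T a ha hp hE hZ hZ2 => ?_⟩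
  have h := hP Z (T.size * c) a (fun k τ => ∀ i x, (nodeList T)[i]? = some x → ∀ l : Fin c,
    k ≤ i * c + l → τ (i * c + l) = ind (x.1.Occurs l)) ha (by simp) (by simp [hp.varN, hp.varC]) hZ
    (fun i x hx l hi => absurd hi ?_) ?_
  · obtain ⟨τ, ht, hτ⟩ := h
    exact ⟨τ, ht, fun i x hx l => hτ i x hx l (Nat.zero_le _)⟩
  · have h1 := lt_size hx
    have h2 := Nat.mul_le_mul_right c (Nat.succ_le_of_lt h1)
    rw [Nat.succ_mul] at h2
    omega
  intro k τ hk hJ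
  generalize hb : (a.setArr aN τ).setVar vI k = b
  have hbI : b.var vI = k := by simp [← hb]
  have hbN : b.arr aN = τ := by simp [← hb]
  have hbE : EndArr T (b.arr aE) := by simpa [← hb] using hE
  have hp' : Parsed T k₀ r b := hb ▸ hp.fill (by decide) _ _
  have hc : 0 < c := Nat.pos_of_ne_zero (by rintro rfl; simp at hk)
  obtain ⟨x, hx⟩ := exists_node T (i := k / c) (Nat.div_lt_of_lt_mul (by rwa [mul_comm]))
  have hkc : k / c * c + k % c = k := Nat.div_add_mod' k c
  refine ⟨k, ind (x.1.Occurs ⟨k % c, Nat.mod_lt _ hc⟩), by simp, by simp [occExpr], by simp [hbI],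
    eval_occExpr hp' hbE hx _ _ _ (by simp [hbI, hp'.varC]) (by simp [hbI, hp'.varC]) ?_,
    len_ind_le hZ2, ?_⟩
  · intro j y hy hj l
    rw [hbN]
    refine hJ j y hy l ?_
    have h1 := Nat.mul_le_mul_right c (Nat.succ_le_of_lt hj)
    have := Nat.mod_lt k hc
    rw [Nat.succ_mul] at h1
    omega
  · intro i y hy l hi
    by_cases h : i * c + l = k
    · obtain ⟨h1, h2⟩ := mul_add_inj l.2 (Nat.mod_lt k hc) (h.trans hkc.symm)
      subst h1
      rw [hx] at hy
      cases hy
      rw [h, Function.update_self]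
      congr 2
      exact Fin.ext h2.symm
    · rw [Function.update_of_ne h]
      exact hJ i y hy l (by omega)

/-! ### Labels that get further neighbours -/

/-- `τ` gives for every node and label whether the label gets neighbours later on. -/
def FlagArr {c : ℕ} (T : CWExpr c) (τ : ℕ → ℤ) : Prop :=
  ∀ i x, (nodeList T)[i]? = some x → ∀ l : Fin c, τ (i * c + l) = ind (x.2 l)

/-- The cell for label `l` of child number `w` of node `p`. If there is no such child, the cell lies
in the row of the root, and `flagExpr` writes back the value found there, so the round has no
effect. -/
def flagIndex (p w l : Ex) : Ex :=
  ifeq (arr aO p) 0 l (ifeq w 0 ((p + 1) * v vC + l) (ifeq (arr aO p) 3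
    (arr aE (p + 1) * v vC + l) l))

def flagExpr (p w l : Ex) : Ex :=
  ifeq (arr aO p) 0 (cell aH 0 l) (ifeq (arr aO p) 3 (cell aH p l) (ifeq w 0
    (ifeq (arr aO p) 2 (cell aH p (ifeq (arr aA p) l (arr aB p) l))
      (ifle 1 (cell aH p l + cell aN (p + 1) (arr aA p) * cell aN (p + 1) (arr aB p) *
        ifeq (arr aA p) l 1 (ifeq (arr aB p) l 1 0)) 1 0)) (cell aH 0 l)))

theorem ite_one_le_ind (p q q' s s' : Prop) [Decidable s] [Decidable s'] :
    (if 1 ≤ ind p + ind q * ind q' * (if s then 1 else if s' then 1 else 0) then 1 else 0) =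
      ind (p ∨ (q ∧ q' ∧ (s ∨ s'))) := by
  unfold ind; split_ifs <;> simp_all

/-- The last clause guarantees that the round belonging to a child indeed writes into the row of
that child. -/
theorem eval_flagExpr {c k r : ℕ} {T : CWExpr c} {b : AState} (hp : Parsed T k r b)
    (hE : EndArr T (b.arr aE)) (hN : OccArr T (b.arr aN)) {p : ℕ}
    {x : CWExpr c × (Fin c → Prop)}
    (hx : (nodeList T)[p]? = some x) (pE wE lE : Ex) (w : ℕ) (l : Fin c) (hpE : pE.eval b 0 = p)
    (hw : wE.eval b 0 = w) (hl : lE.eval b 0 = (l : ℕ)) (h0 : b.arr aH l = 0)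
    (hH : ∀ l : Fin c, b.arr aH (p * c + l) = ind (x.2 l)) :
    ∃ q y, (nodeList T)[q]? = some y ∧ (flagIndex pE wE lE).eval b 0 = (q * c + l : ℕ) ∧
      (flagExpr pE wE lE).eval b 0 = ind (y.2 l) ∧
      ∀ q' y', IsChild p x q' y' → (if q' = p + 1 then 0 else 1) = w → q' = q := by
  have hrep := hp.node p _ (getElem?_preorder hx)
  have hp1 : (pE + 1).eval b 0 = (p + 1 : ℕ) := by simp [hpE]
  have hO : (arr aO pE).eval b 0 = b.arr aO p := eval_arr hpE
  have hA : (arr aA pE).eval b 0 = b.arr aA p := eval_arr hpE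
  have hB : (arr aB pE).eval b 0 = b.arr aB p := eval_arr hpE
  have hE' : (arr aE (pE + 1)).eval b 0 = b.arr aE (p + 1) := eval_arr hp1
  have hl1 := eval_cell (t := aH) hp.varC hpE hl
  have hroot : (cell aH 0 lE).eval b 0 = ind False := by
    rw [eval_cell (m := 0) hp.varC rfl hl, zero_mul, zero_add, h0, ind_false id]
  have hT0 : (nodeList T)[0]? = some (T, fun _ => False) := nodes_zero _ _
  have heq : ∀ l l' : Fin c, ((l : ℕ) : ℤ) = (l' : ℕ) ↔ l = l' := fun l l' => by
    rw [Nat.cast_inj, Fin.ext_iff]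
  simp only [flagIndex, flagExpr, eval_ifeq, hO, eval_zero, eval_one, eval_two, eval_three,
    eval_ifle, hl, eval_add _ lE, eval_mul _ (v vC), hp1, eval_v, hp.varC, hE', hw, hroot,
    hl1, hH]
  obtain ⟨e, h⟩ := x
  cases e with
  | intro l' =>
    refine ⟨0, _, hT0, ?_, ?_, fun q' y' hc => hc.elim⟩
    · rw [if_pos hrep.1]; simp
    · rw [if_pos hrep.1]
  | join a a' e =>
    rw [hrep.1]
    simp only [show (1 : ℤ) ≠ 0 by decide, show (1 : ℤ) ≠ 3 by decide, show (1 : ℤ) ≠ 2 by decide,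
      if_false, Nat.cast_eq_zero]
    by_cases h0 : w = 0
    · have hc := getElem?_of_isChild hx (j := p + 1) ⟨rfl, rfl⟩
      refine ⟨p + 1, _, hc, ?_, ?_, fun q' y' hc _ => hc.1⟩
      · rw [if_pos h0]; push_cast; ring
      · rw [if_pos h0]
        simp only [eval_add (cell _ _ _), eval_mul, eval_ifeq, hA, hB, hl, eval_one, eval_zero, hl1,
          eval_cell hp.varC hp1 (hA.trans hrep.2.1), eval_cell hp.varC hp1 (hB.trans hrep.2.2)]
        rw [hN _ _ hc, hN _ _ hc, hH, hrep.2.1, hrep.2.2]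
        simp only [heq]
        rw [ite_one_le_ind]
        simp only [joinFlags, eq_comm]
    · refine ⟨0, _, hT0, ?_, ?_, fun q' y' hc hq => absurd ?_ h0⟩
      · rw [if_neg h0]; simp
      · rw [if_neg h0]
      · rw [← hq, if_pos hc.1]
  | rename a a' e =>
    rw [hrep.1]
    simp only [show (2 : ℤ) ≠ 0 by decide, show (2 : ℤ) ≠ 3 by decide, if_false, if_true,
      Nat.cast_eq_zero]
    by_cases h0 : w = 0
    · have hc := getElem?_of_isChild hx (j := p + 1) ⟨rfl, rfl⟩
      refine ⟨p + 1, _, hc, ?_, ?_, fun q' y' hc _ => hc.1⟩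
      · rw [if_pos h0]; push_cast; ring
      · rw [if_pos h0, eval_cell (q := (if a = l then a' else l : Fin c)) hp.varC hpE (by
          simp only [eval_ifeq, hA, hB, hl, hrep.2.1, hrep.2.2, heq]
          split_ifs <;> rfl), hH]
        simp only [Function.update_apply, eq_comm (a := l)]
        split_ifs <;> rfl
    · refine ⟨0, _, hT0, ?_, ?_, fun q' y' hc hq => absurd ?_ h0⟩
      · rw [if_neg h0]; simp
      · rw [if_neg h0]
      · rw [← hq, if_pos hc.1]
  | union e₁ e₂ =>
    rw [show b.arr aO p = 3 from hrep]
    simp only [show (3 : ℤ) ≠ 0 by decide, if_false, if_true, Nat.cast_eq_zero]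
    have hc₁ := getElem?_of_isChild hx (Or.inl ⟨rfl, rfl⟩)
    have hc₂ := getElem?_of_isChild hx (Or.inr ⟨rfl, rfl⟩)
    have hs := e₁.size_pos
    by_cases h0 : w = 0
    · refine ⟨_, _, hc₁, ?_, rfl, fun q' y' hc hq => ?_⟩
      · rw [if_pos h0]; push_cast; ring
      · split_ifs at hq with hq'
        · exact hq'
        · omega
    · refine ⟨_, _, hc₂, ?_, rfl, fun q' y' hc hq => ?_⟩
      · rw [if_neg h0, hE _ _ hc₁]; push_cast; ring
      · rcases hc with hc | hc
        · rw [if_pos hc.1] at hq; omega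
        · exact hc.1

/-- Fill the array `aH`: every node sets the flags of its children. -/
def flagFill : Prog :=
  fill vI (v vN * v vC * 2) aH
    (flagIndex ((v vN * v vC * 2 - 1 - v vI) / v vC / 2) (mod ((v vN * v vC * 2 - 1 - v vI) / v vC) 2)
      (mod (v vN * v vC * 2 - 1 - v vI) (v vC)))
    (flagExpr ((v vN * v vC * 2 - 1 - v vI) / v vC / 2) (mod ((v vN * v vC * 2 - 1 - v vI) / v vC) 2)
      (mod (v vN * v vC * 2 - 1 - v vI) (v vC)))

/-- Rounds are ordered by parent, then child number, then label. A parent precedes its children in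
preorder, so its own flags have been set in earlier rounds. The row of the root stays zero
throughout: no label gets neighbours after the root. -/
theorem exists_tri_flagFill : ∃ P : Polynomial ℕ, ∀ (Z c k r : ℕ) (T : CWExpr c) (a : AState),
    Bdd Z a → Parsed T k r a → EndArr T (a.arr aE) → OccArr T (a.arr aN) → (∀ i, a.arr aH i = 0) →
    len ((T.size * c * 2 : ℕ) : ℤ) ≤ Z → 2 ≤ Z →
      ∃ τ, Tri Z a flagFill ((T.size * c * 2 + 1) * P.eval Z) ((a.setArr aH τ).setVar vI 0) ∧
        FlagArr T τ := by
  obtain ⟨P, hP⟩ := exists_tri_fill vI (v vN * v vC * 2) aH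
    (flagIndex ((v vN * v vC * 2 - 1 - v vI) / v vC / 2) (mod ((v vN * v vC * 2 - 1 - v vI) / v vC) 2)
      (mod (v vN * v vC * 2 - 1 - v vI) (v vC)))
    (flagExpr ((v vN * v vC * 2 - 1 - v vI) / v vC / 2) (mod ((v vN * v vC * 2 - 1 - v vI) / v vC) 2)
      (mod (v vN * v vC * 2 - 1 - v vI) (v vC)))
  refine ⟨P, fun Z c k₀ r T a ha hp hE hN h0 hZ hZ2 => ?_⟩
  have hT0 : (nodeList T)[0]? = some (T, fun _ => False) := nodes_zero _ _
  have h := hP Z (T.size * c * 2) a (fun k τ => (∀ l : Fin c, τ l = 0) ∧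
    ∀ p x q y, (nodeList T)[p]? = some x → IsChild p x q y → ∀ l : Fin c,
      (2 * p + if q = p + 1 then 0 else 1) * c + l + k < T.size * c * 2 →
      τ (q * c + l) = ind (y.2 l)) ha (by simp) (by simp [hp.varN, hp.varC]) hZ
    ⟨fun l => h0 l, fun p x q y _ _ l hl => by omega⟩ ?_
  · obtain ⟨τ, ht, hτ0, hτ⟩ := h
    refine ⟨τ, ht, fun i x hx l => ?_⟩
    by_cases hi : i = 0
    · subst hi
      rw [hT0] at hx
      cases hx
      rw [zero_mul, zero_add, hτ0, ind_false id]
    · obtain ⟨p, x', hx', hc⟩ := exists_parent T _ i x hx hi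
      refine hτ p x' i x hx' hc l ?_
      have h1 := Nat.mul_le_mul_right c (Nat.succ_le_of_lt (lt_size hx'))
      have h2 := l.2
      have h3 : (2 * p + if i = p + 1 then 0 else 1) * c ≤ (2 * p + 1) * c :=
        Nat.mul_le_mul_right _ (by split_ifs <;> omega)
      have h4 : (2 * p + 1) * c + c = (p.succ * c) * 2 := by rw [Nat.succ_eq_add_one]; ring
      omega
  rintro k τ hk ⟨hJ0, hJ⟩
  generalize hb : (a.setArr aH τ).setVar vI k = b
  have hbI : b.var vI = k := by simp [← hb]
  have hbH : b.arr aH = τ := by simp [← hb]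
  have hbE : EndArr T (b.arr aE) := by simpa [← hb] using hE
  have hbN : OccArr T (b.arr aN) := by simpa [← hb] using hN
  have hp' : Parsed T k₀ r b := hb ▸ hp.fill (by decide) _ _
  have hc : 0 < c := Nat.pos_of_ne_zero (by rintro rfl; simp at hk)
  -- The loop index counts down while flags have to be passed from the root downwards, so the order
  -- is reversed.
  set j := T.size * c * 2 - 1 - k with hj
  have hjE : (v vN * v vC * 2 - 1 - v vI).eval b 0 = j := by
    simp only [eval_sub, eval_mul, eval_v, hbI, hp'.varN, hp'.varC, eval_two, eval_one]
    rw [hj]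
    push_cast [show k ≤ T.size * c * 2 - 1 by omega, show 1 ≤ T.size * c * 2 by omega]
    ring
  set p := j / c / 2 with hpd
  set w := j / c % 2 with hwd
  have hjc : j / c * c + j % c = j := Nat.div_add_mod' j c
  have hpw : 2 * p + w = j / c := by omega
  have hpN : p < T.size := by
    rw [hpd, Nat.div_div_eq_div_mul]
    refine Nat.div_lt_of_lt_mul ?_
    rw [show c * 2 * T.size = T.size * c * 2 by ring]
    omega
  obtain ⟨x, hx⟩ := exists_node T hpN
  set l : Fin c := ⟨j % c, Nat.mod_lt _ hc⟩ with hl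
  have hH : ∀ l : Fin c, b.arr aH (p * c + l) = ind (x.2 l) := by
    intro l
    rw [hbH]
    by_cases hp0 : p = 0
    · rw [hp0, hT0] at hx
      cases hx
      rw [hp0, zero_mul, zero_add, hJ0, ind_false id]
    · obtain ⟨p', x', hx', hc'⟩ := exists_parent T _ p x hx hp0
      refine hJ p' x' p x hx' hc' l ?_
      have hlt := hc'.lt
      have h2 := l.2
      have h3 : (2 * p' + if p = p' + 1 then 0 else 1) * c + c ≤ j / c * c := by
        rw [← Nat.succ_mul]
        exact Nat.mul_le_mul_right _ (by split_ifs <;> omega)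
      omega
  obtain ⟨q, y, hy, hidx, hval, huniq⟩ := eval_flagExpr hp' hbE hbN hx
    ((v vN * v vC * 2 - 1 - v vI) / v vC / 2) (mod ((v vN * v vC * 2 - 1 - v vI) / v vC) 2)
    (mod (v vN * v vC * 2 - 1 - v vI) (v vC)) w l
    (by rw [eval_div, eval_div, hjE, eval_v, hp'.varC, eval_two]; rfl)
    (by rw [eval_mod, eval_div, hjE, eval_v, hp'.varC, eval_two]; rfl)
    (by rw [eval_mod, hjE, eval_v, hp'.varC]; rfl) (by rw [hbH, hJ0]) hH
  refine ⟨q * c + l, ind (y.2 l), by simp [flagIndex], by simp [flagExpr], hidx, hval, len_ind_le hZ2,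
    ?_, ?_⟩
  · intro l'
    by_cases h : (l' : ℕ) = q * c + l
    -- A write into the row of the root writes a flag of the root, which is 0.
    · obtain ⟨h1, h2⟩ := mul_add_inj (i := 0) (i' := q) l'.2 l.2 (by omega)
      subst h1
      rw [hT0] at hy
      cases hy
      rw [h, Function.update_self, ind_false id]
    · rw [Function.update_of_ne h, hJ0]
  · intro p' x' q' y' hx' hc' l' hlt
    by_cases h : q' * c + l' = q * c + l
    · obtain ⟨h1, h2⟩ := mul_add_inj l'.2 l.2 h
      subst h1
      have hy' := getElem?_of_isChild hx' hc'
      rw [hy] at hy'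
      cases hy'
      rw [h, Function.update_self, Fin.ext h2]
    · rw [Function.update_of_ne h]
      refine hJ p' x' q' y' hx' hc' l' ?_
      -- A slot that was not treated before must be the current one, and then its cell is the one
      -- just written.
      by_contra hge
      have heq : (2 * p' + if q' = p' + 1 then 0 else 1) * c + l' = j / c * c + j % c := by omega
      obtain ⟨h1, h2⟩ := mul_add_inj l'.2 (Nat.mod_lt _ hc) heq
      have hpp : p' = p := by split_ifs at h1 <;> omega
      subst hpp
      rw [hx] at hx'
      cases hx'
      have hq := huniq q' y' hc' (by split_ifs at h1 ⊢ <;> omega)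
      apply h
      rw [hq]
      congr 1

end RAM


namespace RAM

open Ex CWExpr

namespace Ex

def emax (e f : Ex) : Ex := ifle e f f e
def emin (e f : Ex) : Ex := ifle e f e f

@[simp] theorem eval_emax (e f : Ex) (a : AState) (y : ℤ) :
    (emax e f).eval a y = max (e.eval a y) (f.eval a y) := (max_def _ _).symm
@[simp] theorem eval_emin (e f : Ex) (a : AState) (y : ℤ) :
    (emin e f).eval a y = min (e.eval a y) (f.eval a y) := (min_def _ _).symm
@[simp] theorem lim_emax (e f : Ex) (Z : ℕ) (a : AState) (y : ℤ) :
    (emax e f).lim Z a y ↔ e.lim Z a y ∧ f.lim Z a y := by simp [emax]; tauto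
@[simp] theorem lim_emin (e f : Ex) (Z : ℕ) (a : AState) (y : ℤ) :
    (emin e f).lim Z a y ↔ e.lim Z a y ∧ f.lim Z a y := by simp [emin]; tauto

end Ex

/-! ### The table -/

/-- The current node. -/
def nodeE : Ex := v vI / v vW

def labA : Ex := arr aA nodeE

def labB : Ex := arr aB nodeE

/-- The digit of a label. -/
def digE (l : Ex) : Ex := mod (mod (v vI) (v vW) / arr aP l) (v vD)

/-- The context of a label. -/
def loE (l : Ex) : Ex := ifeq (cell aH nodeE l) 1 (digE l + 2 - 2 * ((digE l + 1) / 3 + 1)) 0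

def hiE (l : Ex) : Ex := ifeq (cell aH nodeE l) 1 ((digE l + 1) / 3 + 1) (v vR + 1)

/-- The entry of node `j` for the current index shifted by `s`. -/
def tabE (j s : Ex) : Ex := arr aT (j * v vW + mod (v vI) (v vW) + s)

def introE : Ex :=
  ifeq (loE labA) 0 (v vX) 0 + ifle (loE labA) (hiE labA) (ifle (hiE labA) (v vR) 1 0) 0

def renameE : Ex := tabE (nodeE + 1) ((digE labB - digE labA) * arr aP labA)

def unionE : Ex := tabE (nodeE + 1) 0 * tabE (arr aE (nodeE + 1)) 0

def sE : Ex := loc / 2 / 2 / (v vR + 1)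

def sE' : Ex := mod (loc / 2 / 2) (v vR + 1)

def iE : Ex := mod (loc / 2) 2

def jE : Ex := mod loc 2

def joinLoA : Ex := emax (emax (loE labA) (sE' - 1)) (sE + iE)

def joinHiA : Ex := emin (hiE labA) (sE' + 1)

def joinLoB : Ex := emax (emax (loE labB) (sE - 1)) (sE' + jE)

def joinHiB : Ex := emin (hiE labB) (sE + 1)

/-- The tests discard windows that are empty or begin above `r`; they have no digit and count 0. The
digit of the second label is replaced first, so if both labels coincide, the digit replaced for the
first label is the one just put in. -/
def joinTermE : Ex :=
  ifle joinLoA joinHiA (ifle joinLoA (v vR) (ifle joinLoB joinHiB (ifle joinLoB (v vR)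
    ((1 - 2 * iE) * (1 - 2 * jE) * tabE (nodeE + 1)
      ((2 * joinHiB + joinLoB - 2 - digE labB) * arr aP labB +
       (2 * joinHiA + joinLoA - 2 - ifeq labA labB (2 * joinHiB + joinLoB - 2) (digE labA)) *
          arr aP labA)) 0) 0) 0) 0

def joinE : Ex :=
  ifeq (cell aN (nodeE + 1) labA * cell aN (nodeE + 1) labB) 0 (tabE (nodeE + 1) 0)
    (sum ((v vR + 1) * (v vR + 1) * 2 * 2)
      (ifeq labA labB (ifeq sE sE' (ifeq jE 0 joinTermE 0) 0) joinTermE))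

def tableE : Ex :=
  ifeq (arr aO nodeE) 0 introE (ifeq (arr aO nodeE) 3 unionE (ifeq (arr aO nodeE) 2 renameE joinE))

/-- The position of a function in the table. -/
def enc {c m : ℕ} (f : Fin c → Fin m) : ℕ := (finFunctionFinEquiv f : ℕ)

theorem enc_lt {c m : ℕ} (f : Fin c → Fin m) : enc f < m ^ c := (finFunctionFinEquiv f).2

/-- The state in which the entry of node `i` with data `x` for `f` is computed. -/
structure TableState {c : ℕ} (T : CWExpr c) (k r X : ℕ) (i : ℕ) (x : CWExpr c × (Fin c → Prop))
    (f : Fin c → Fin (3 * r + 1)) (b : AState) : Prop where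
  parsed : Parsed T k r b
  varX : b.var vX = X
  ends : EndArr T (b.arr aE)
  occ : OccArr T (b.arr aN)
  flags : FlagArr T (b.arr aH)
  pow : ∀ l ≤ c, b.arr aP l = ((3 * r + 1) ^ l : ℕ)
  varD : b.var vD = (3 * r + 1 : ℕ)
  varW : b.var vW = ((3 * r + 1) ^ c : ℕ)
  varI : b.var vI = (i * (3 * r + 1) ^ c + enc f : ℕ)
  node : (nodeList T)[i]? = some x
  table : ∀ j y, (nodeList T)[j]? = some y → i < j → ∀ g : Fin c → Fin (3 * r + 1),
    b.arr aT (j * (3 * r + 1) ^ c + enc g) = count r X y.1 (ctx r y.2 g)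

/-! ### Values of the table expressions -/

namespace TableState

variable {c k r X i : ℕ} {T : CWExpr c} {x : CWExpr c × (Fin c → Prop)} {f : Fin c → Fin (3 * r + 1)}
  {b : AState} (h : TableState T k r X i x f b)

include h

theorem eval_nodeE (y : ℤ) : nodeE.eval b y = i := by
  simp only [nodeE, eval_div, eval_v, h.varI, h.varW]
  rw [← Int.natCast_ediv, mul_comm, Nat.mul_add_div (by positivity), Nat.div_eq_of_lt (enc_lt f),
    add_zero]

theorem eval_nodeE_add (y : ℤ) : (nodeE + 1).eval b y = (i + 1 : ℕ) := by
  simp [h.eval_nodeE]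

theorem eval_index (y : ℤ) : (mod (v vI) (v vW)).eval b y = enc f := by
  simp only [eval_mod, eval_v, h.varI, h.varW]
  rw [← Int.natCast_emod, mul_comm, Nat.mul_add_mod, Nat.mod_eq_of_lt (enc_lt f)]

theorem eval_digE {lE : Ex} {y : ℤ} {l : Fin c} (hl : lE.eval b y = (l : ℕ)) :
    (digE lE).eval b y = (f l : ℕ) := by
  rw [digE, eval_mod, eval_div, h.eval_index, eval_arr hl, h.pow l l.2.le, eval_v, h.varD,
    ← Int.natCast_ediv, ← Int.natCast_emod, enc, finFunctionFinEquiv_div_mod]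

theorem eval_flag {lE : Ex} {y : ℤ} {l : Fin c} (hl : lE.eval b y = (l : ℕ)) :
    (cell aH nodeE lE).eval b y = ind (x.2 l) := by
  rw [eval_cell h.parsed.varC (h.eval_nodeE y) hl, h.flags i x h.node]

theorem eval_loE {lE : Ex} {y : ℤ} {l : Fin c} (hl : lE.eval b y = (l : ℕ)) :
    (loE lE).eval b y = ((ctx r x.2 f l).1 : ℕ) := by
  have hf := h.eval_flag hl
  by_cases hp : x.2 l
  · rw [ind_true hp] at hf
    simp only [loE, eval_ifeq, hf, eval_one, if_true, eval_sub, eval_add, h.eval_digE hl, eval_two,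
      eval_mul, eval_div, eval_three, ctx, if_pos hp, digitCtx]
    omega
  · rw [ind_false hp] at hf
    simp only [loE, eval_ifeq, hf, eval_one, zero_ne_one, if_false, eval_zero, ctx, if_neg hp]
    rfl

theorem eval_hiE {lE : Ex} {y : ℤ} {l : Fin c} (hl : lE.eval b y = (l : ℕ)) :
    (hiE lE).eval b y = ((ctx r x.2 f l).2 : ℕ) := by
  have hf := h.eval_flag hl
  by_cases hp : x.2 l
  · rw [ind_true hp] at hf
    simp only [hiE, eval_ifeq, hf, eval_one, if_true, eval_add, h.eval_digE hl, eval_div, eval_three,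
      ctx, if_pos hp, digitCtx]
    omega
  · rw [ind_false hp] at hf
    simp only [hiE, eval_ifeq, hf, eval_one, zero_ne_one, if_false, eval_add, eval_v,
      h.parsed.varR, ctx, if_neg hp]
    omega

theorem eval_tabE {jE sE : Ex} {y : ℤ} {j : ℕ} {z : CWExpr c × (Fin c → Prop)}
    {g : Fin c → Fin (3 * r + 1)} (hj : jE.eval b y = j) (hs : enc f + sE.eval b y = enc g)
    (hz : (nodeList T)[j]? = some z) (hij : i < j) :
    (tabE jE sE).eval b y = count r X z.1 (ctx r z.2 g) := by
  rw [tabE, eval_arr (n := j * (3 * r + 1) ^ c + enc g), h.table j z hz hij g]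
  rw [eval_add, eval_add, h.eval_index, eval_mul, hj, eval_v, h.varW, add_assoc, hs]
  push_cast
  rfl

theorem eval_tag (y : ℤ) : (arr aO nodeE).eval b y = b.arr aO i := eval_arr (h.eval_nodeE y)

theorem eval_labA (y : ℤ) : labA.eval b y = b.arr aA i := eval_arr (h.eval_nodeE y)

theorem eval_labB (y : ℤ) : labB.eval b y = b.arr aB i := eval_arr (h.eval_nodeE y)

theorem rep : NodeRep (fun z l => z = (l : ℕ)) (b.arr aO i) (b.arr aA i) (b.arr aB i) x.1 :=
  h.parsed.node i _ (getElem?_preorder h.node)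

end TableState

theorem TableState.eval_introE {c k r X i : ℕ} {T : CWExpr c} {l : Fin c} {p : Fin c → Prop}
    {f : Fin c → Fin (3 * r + 1)} {b : AState} (h : TableState T k r X i (intro l, p) f b) :
    introE.eval b 0 = count r X (intro l) (ctx r p f) := by
  have hl : labA.eval b 0 = (l : ℕ) := (h.eval_labA 0).trans h.rep.2
  simp only [introE, eval_add, eval_ifeq, eval_ifle, h.eval_loE hl, h.eval_hiE hl, eval_zero, eval_v,
    eval_one, h.varX, h.parsed.varR]
  rw [count_intro _ _ _ _ (one_le_ctx r p f l)]
  push_cast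
  congr 1
  · simp only [Nat.cast_eq_zero]
  · simp only [Nat.cast_le, ite_and]

theorem TableState.eval_renameE {c k r X i : ℕ} {T e : CWExpr c} {l l' : Fin c} {p : Fin c → Prop}
    {f : Fin c → Fin (3 * r + 1)} {b : AState} (h : TableState T k r X i (rename l l' e, p) f b) :
    renameE.eval b 0 = count r X (rename l l' e) (ctx r p f) := by
  have hl : labA.eval b 0 = (l : ℕ) := (h.eval_labA 0).trans h.rep.2.1
  have hl' : labB.eval b 0 = (l' : ℕ) := (h.eval_labB 0).trans h.rep.2.2
  rw [count_rename, ctx_rename, renameE]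
  refine h.eval_tabE (h.eval_nodeE_add 0) ?_ (getElem?_of_isChild h.node ⟨rfl, rfl⟩) (by omega)
  rw [enc, enc, finFunctionFinEquiv_update, eval_mul, eval_sub, h.eval_digE hl, h.eval_digE hl',
    eval_arr hl, h.pow l l.2.le]
  push_cast
  rfl

theorem TableState.eval_unionE {c k r X i : ℕ} {T e₁ e₂ : CWExpr c} {p : Fin c → Prop}
    {f : Fin c → Fin (3 * r + 1)} {b : AState} (h : TableState T k r X i (union e₁ e₂, p) f b) :
    unionE.eval b 0 = count r X (union e₁ e₂) (ctx r p f) := by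
  have h₁ := getElem?_of_isChild h.node (Or.inl ⟨rfl, rfl⟩)
  have h₂ := getElem?_of_isChild h.node (Or.inr ⟨rfl, rfl⟩)
  rw [count_union, unionE, eval_mul, h.eval_tabE (g := f) (h.eval_nodeE_add 0) (by simp) h₁ (by omega),
    h.eval_tabE (g := f) ((eval_arr (h.eval_nodeE_add 0)).trans (h.ends _ _ h₁)) (by simp) h₂
      (by omega)]
  push_cast
  rfl

theorem ctx_le {c : ℕ} (r : ℕ) (h : Fin c → Prop) (f : Fin c → Fin (3 * r + 1)) (l : Fin c) :
    (ctx r h f l).2 ≤ r + 1 := by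
  have := (f l).2
  unfold ctx digitCtx
  split_ifs
  · simp only; omega
  · simp

theorem exists_fin_eq {m n : ℕ} (h : m < n) : ∃ q : Fin n, (q : ℕ) = m := ⟨⟨m, h⟩, rfl⟩

/-- Truncated and integer subtraction differ only at `s = 0`, where the maximum with `a ≥ 0` hides
the difference. -/
theorem cast_max_sub (a s t : ℕ) :
    ((max (max a (s - 1)) t : ℕ) : ℤ) = max (max (a : ℤ) (s - 1)) t := by
  rcases s with _ | s
  · simp
  · simp

/-- The largest code belongs to the window `(r, r + 1)` and equals `3r`; hence `3r + 1` digits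
suffice. -/
theorem code_lt {u l r : ℕ} (hu : u ≤ r + 1) (hl : l ≤ r) : 2 * u + l - 2 < 3 * r + 1 := by omega

theorem cast_code {u l : ℕ} (hu : 1 ≤ u) : 2 * (u : ℤ) + l - 2 = (2 * u + l - 2 : ℕ) := by omega

/-- Either one of the tests fails and the count vanishes, because both labels occur, or both windows
have digits and the required count is an entry of the child. -/
theorem TableState.eval_joinTermE {c k r X i : ℕ} {T e : CWExpr c} {l l' : Fin c} {p : Fin c → Prop}
    {f : Fin c → Fin (3 * r + 1)} {b : AState} (h : TableState T k r X i (join l l' e, p) f b)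
    (ho : e.Occurs l) (ho' : e.Occurs l') (z : ℕ)
    (hz : l = l' → z / 2 / 2 / (r + 1) = z / 2 / 2 % (r + 1) ∧ z % 2 = 0) :
    joinTermE.eval b (z : ℕ) = ((1 - 2 * (z / 2 % 2 : ℕ)) * (1 - 2 * (z % 2 : ℕ)) : ℤ) *
      count r X e (joinCtx (ctx r p f) l l' (z / 2 / 2 / (r + 1)) (z / 2 / 2 % (r + 1)) (z / 2 % 2)
        (z % 2)) := by
  have hl : labA.eval b (z : ℕ) = (l : ℕ) := (h.eval_labA _).trans h.rep.2.1
  have hl' : labB.eval b (z : ℕ) = (l' : ℕ) := (h.eval_labB _).trans h.rep.2.2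
  have hsE : sE.eval b (z : ℕ) = (z / 2 / 2 / (r + 1) : ℕ) := by simp [sE, h.parsed.varR]
  have hsE' : sE'.eval b (z : ℕ) = (z / 2 / 2 % (r + 1) : ℕ) := by simp [sE', h.parsed.varR]
  have hiE : iE.eval b (z : ℕ) = (z / 2 % 2 : ℕ) := by simp [iE]
  have hjE : jE.eval b (z : ℕ) = (z % 2 : ℕ) := by simp [jE]
  generalize z / 2 / 2 / (r + 1) = s at *
  generalize z / 2 / 2 % (r + 1) = s' at *
  generalize z / 2 % 2 = ii at *
  generalize z % 2 = jj at *
  obtain ⟨la, hla⟩ : ∃ n, n = max (max (ctx r p f l).1 (s' - 1)) (s + ii) := ⟨_, rfl⟩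
  obtain ⟨ua, hua⟩ : ∃ n, n = min (ctx r p f l).2 (s' + 1) := ⟨_, rfl⟩
  obtain ⟨lb, hlb⟩ : ∃ n, n = max (max (ctx r p f l').1 (s - 1)) (s' + jj) := ⟨_, rfl⟩
  obtain ⟨ub, hub⟩ : ∃ n, n = min (ctx r p f l').2 (s + 1) := ⟨_, rfl⟩
  have h3 := ctx_le r p f l
  have h4 := ctx_le r p f l'
  have h1 := one_le_ctx r p f l
  have h2 := one_le_ctx r p f l'
  have eLA : joinLoA.eval b (z : ℕ) = la := by
    simp only [joinLoA, eval_emax, h.eval_loE hl, eval_sub, hsE', eval_one, eval_add, hsE, hiE,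
      hla, cast_max_sub, Nat.cast_add]
  have eHA : joinHiA.eval b (z : ℕ) = ua := by
    simp only [joinHiA, eval_emin, h.eval_hiE hl, hsE', eval_one, eval_add, hua]
    push_cast
    rfl
  have eLB : joinLoB.eval b (z : ℕ) = lb := by
    simp only [joinLoB, eval_emax, h.eval_loE hl', eval_sub, hsE', eval_one, eval_add, hsE, hjE,
      hlb, cast_max_sub, Nat.cast_add]
  have eHB : joinHiB.eval b (z : ℕ) = ub := by
    simp only [joinHiB, eval_emin, h.eval_hiE hl', hsE, eval_one, eval_add, hub]
    push_cast
    rfl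
  have cA : joinCtx (ctx r p f) l l' s s' ii jj l = (la, ua) := by
    rw [joinCtx, Function.update_self, hla, hua]
  have cB : l ≠ l' → joinCtx (ctx r p f) l l' s s' ii jj l' = (lb, ub) := fun hne => by
    rw [joinCtx, Function.update_of_ne hne.symm, Function.update_self, hlb, hub]
  have zA : ua < la ∨ r < la → count r X e (joinCtx (ctx r p f) l l' s s' ii jj) = 0 := fun h0 =>
    count_eq_zero _ _ _ _ l ho (by rwa [cA])
  have zB : ub < lb ∨ r < lb → count r X e (joinCtx (ctx r p f) l l' s s' ii jj) = 0 := fun h0 => by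
    -- For equal labels `joinCtx` only uses the window of the first. As `s = s'` and `j = 0`, it is
    -- contained in that of the second, so it is bad whenever the latter is.
    by_cases hll : l = l'
    · subst hll
      refine zA ?_
      obtain ⟨rfl, rfl⟩ := hz rfl
      have hlab : lb ≤ la := by
        rw [hla, hlb, add_zero]
        exact max_le_max le_rfl (Nat.le_add_right _ _)
      have huab : ua = ub := by rw [hua, hub]
      rw [huab]
      exact h0.imp (fun h => h.trans_le hlab) fun h => h.trans_le hlab
    · exact count_eq_zero _ _ _ _ l' ho' (by rwa [cB hll])
  simp only [joinTermE, eval_ifle, eLA, eHA, eLB, eHB, eval_v, h.parsed.varR, Nat.cast_le]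
  split_ifs with g1 g2 g3 g4
  · obtain ⟨qa, hqa⟩ := exists_fin_eq (code_lt (hua.trans_le ((min_le_left _ _).trans h3)) g2)
    obtain ⟨qb, hqb⟩ := exists_fin_eq (code_lt (hub.trans_le ((min_le_left _ _).trans h4)) g4)
    rw [joinCtx_ctx r p f l l' e ho ho' s s' ii jj la ua lb ub hla hua hlb hub g1 g3 qa qb hqa hqb]
    simp only [eval_mul, eval_sub (1 : Ex), eval_one, eval_two, hiE, hjE]
    refine congrArg (HMul.hMul _) ?_
    refine h.eval_tabE (z := (e, joinFlags l l' e p)) (h.eval_nodeE_add _) ?_ (getElem?_of_isChild h.node ⟨rfl, rfl⟩) (by omega)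
    have hqa' : (2 * (ua : ℤ) + la - 2) = (qa : ℕ) := by
      rw [hqa, cast_code (hua ▸ le_min h1 (Nat.le_add_left _ _))]
    have hqb' : (2 * (ub : ℤ) + lb - 2) = (qb : ℕ) := by
      rw [hqb, cast_code (hub ▸ le_min h2 (Nat.le_add_left _ _))]
    have hdig : (((Function.update f l' qb l : Fin (3 * r + 1)) : ℕ) : ℤ) =
        if ((l : ℕ) : ℤ) = (l' : ℕ) then ((qb : ℕ) : ℤ) else (f l : ℕ) := by
      simp only [Function.update_apply, Nat.cast_inj, ← Fin.ext_iff]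
      split_ifs <;> rfl
    rw [enc, enc, finFunctionFinEquiv_update, finFunctionFinEquiv_update, hdig]
    simp only [eval_add, eval_mul, eval_sub, eval_two, eval_ifeq, eHA, eLA, eHB, eLB, hl, hl',
      h.eval_digE hl, h.eval_digE hl', hqa', hqb', eval_arr hl, eval_arr hl', h.pow l l.2.le,
      h.pow l' l'.2.le]
    push_cast
    ring
  · rw [zB (Or.inr (not_le.1 g4)), Nat.cast_zero, mul_zero, eval_zero]
  · rw [zB (Or.inl (not_le.1 g3)), Nat.cast_zero, mul_zero, eval_zero]
  · rw [zA (Or.inr (not_le.1 g2)), Nat.cast_zero, mul_zero, eval_zero]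
  · rw [zA (Or.inl (not_le.1 g1)), Nat.cast_zero, mul_zero, eval_zero]


theorem TableState.eval_joinE {c k r X i : ℕ} {T e : CWExpr c} {l l' : Fin c} {p : Fin c → Prop}
    {f : Fin c → Fin (3 * r + 1)} {b : AState} (h : TableState T k r X i (join l l' e, p) f b) :
    joinE.eval b 0 = count r X (join l l' e) (ctx r p f) := by
  have hl : ∀ y, labA.eval b y = (l : ℕ) := fun y => (h.eval_labA y).trans h.rep.2.1
  have hl' : ∀ y, labB.eval b y = (l' : ℕ) := fun y => (h.eval_labB y).trans h.rep.2.2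
  have hc := getElem?_of_isChild h.node (j := i + 1) ⟨rfl, rfl⟩
  simp only [joinE, eval_ifeq, eval_mul (cell _ _ _), eval_zero,
    eval_cell h.parsed.varC (h.eval_nodeE_add 0) (hl 0),
    eval_cell h.parsed.varC (h.eval_nodeE_add 0) (hl' 0), h.occ _ _ hc]
  by_cases ho : e.Occurs l ∧ e.Occurs l'
  · rw [ind_true ho.1, ind_true ho.2, if_neg (by decide), count_join' _ _ _ _ _ _ ho.1 ho.2, eval_sum]
    have hn : (((v vR + 1) * (v vR + 1) * 2 * 2 : Ex).eval b 0).toNat = (r + 1) * (r + 1) * 2 * 2 := by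
      simp only [eval_mul, eval_add, eval_v, eval_one, eval_two, h.parsed.varR]
      exact_mod_cast Int.toNat_natCast _
    rw [hn]
    refine Finset.sum_congr rfl fun z _ => ?_
    have hs : sE.eval b (z : ℕ) = (z / 2 / 2 / (r + 1) : ℕ) := by simp [sE, h.parsed.varR]
    have hs' : sE'.eval b (z : ℕ) = (z / 2 / 2 % (r + 1) : ℕ) := by simp [sE', h.parsed.varR]
    have hj : jE.eval b (z : ℕ) = (z % 2 : ℕ) := by simp [jE]
    simp only [eval_ifeq, hl, hl', hs, hs', hj, eval_zero, Nat.cast_inj, Nat.cast_eq_zero,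
      ← Fin.ext_iff]
    by_cases hll : l = l'
    · rw [if_pos hll]
      by_cases hg : z / 2 / 2 / (r + 1) = z / 2 / 2 % (r + 1) ∧ z % 2 = 0
      · rw [if_pos hg.1, if_pos hg.2, if_pos fun _ => hg]
        exact h.eval_joinTermE ho.1 ho.2 z fun _ => hg
      · rw [← ite_and, if_neg hg, if_neg fun h => hg (h hll)]
    · rw [if_neg hll, if_pos fun h => absurd h hll]
      exact h.eval_joinTermE ho.1 ho.2 z fun h => absurd h hll
  -- One class is empty: the join adds neither edges nor flags, so the entry of the child at the
  -- same position is copied.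
  · rw [count_join_of_empty _ _ _ _ _ _ ho, if_pos]
    · rw [h.eval_tabE (g := f) (h.eval_nodeE_add 0) (by simp) hc (by omega)]
      congr 2
      funext q
      refine (ctx_congr r ?_ rfl).symm
      simp only [joinFlags]
      tauto
    · rw [mul_eq_zero]
      by_cases ho1 : e.Occurs l
      · exact Or.inr (ind_false fun h => ho ⟨ho1, h⟩)
      · exact Or.inl (ind_false ho1)

theorem TableState.eval_tableE {c k r X i : ℕ} {T : CWExpr c} {x : CWExpr c × (Fin c → Prop)}
    {f : Fin c → Fin (3 * r + 1)} {b : AState} (h : TableState T k r X i x f b) :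
    tableE.eval b 0 = count r X x.1 (ctx r x.2 f) := by
  simp only [tableE, eval_ifeq, h.eval_tag, eval_zero, eval_two, eval_three]
  have hrep := h.rep
  obtain ⟨e, p⟩ := x
  cases e with
  | intro l => rw [if_pos hrep.1, h.eval_introE]
  | join l l' e =>
    rw [hrep.1, if_neg (by decide), if_neg (by decide), if_neg (by decide), h.eval_joinE]
  | rename l l' e =>
    rw [hrep.1, if_neg (by decide), if_neg (by decide), if_pos rfl, h.eval_renameE]
  | union e₁ e₂ =>
    rw [show b.arr aO i = 3 from hrep, if_neg (by decide), if_pos rfl, h.eval_unionE]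

end RAM


namespace RAM

open Ex CWExpr

/-- Fill the array `aT`. -/
def tableFill : Prog := fill vI (v vN * v vW) aT (v vI) tableE

/-- The arrays other than the table are filled. -/
structure Prepared {c : ℕ} (T : CWExpr c) (k r X : ℕ) (a : AState) : Prop where
  parsed : Parsed T k r a
  varX : a.var vX = X
  ends : EndArr T (a.arr aE)
  occ : OccArr T (a.arr aN)
  flags : FlagArr T (a.arr aH)
  pow : ∀ l ≤ c, a.arr aP l = ((3 * r + 1) ^ l : ℕ)
  varD : a.var vD = (3 * r + 1 : ℕ)
  varW : a.var vW = ((3 * r + 1) ^ c : ℕ)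

theorem Prepared.fill {c k r X : ℕ} {T : CWExpr c} {a : AState} (h : Prepared T k r X a)
    {t : Fin 16} (ht : aP < t) (τ : ℕ → ℤ) (z : ℤ) :
    Prepared T k r X ((a.setArr t τ).setVar vI z) := by
  have h0 : aE ≠ t := by rintro rfl; exact absurd ht (by decide)
  have h1 : aN ≠ t := by rintro rfl; exact absurd ht (by decide)
  have h2 : aH ≠ t := by rintro rfl; exact absurd ht (by decide)
  have h3 : aP ≠ t := ht.ne
  refine ⟨h.parsed.fill (lt_trans (by decide) ht) τ z, ?_, ?_, ?_, ?_, ?_, ?_, ?_⟩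
  · simpa using h.varX
  · simpa [h0] using h.ends
  · simpa [h1] using h.occ
  · simpa [h2] using h.flags
  · simpa [h3] using h.pow
  · simpa using h.varD
  · simpa using h.varW

/-- `τ` is the table. -/
def TableArr {c : ℕ} (T : CWExpr c) (r X : ℕ) (τ : ℕ → ℤ) : Prop :=
  ∀ i x, (nodeList T)[i]? = some x → ∀ f : Fin c → Fin (3 * r + 1),
    τ (i * (3 * r + 1) ^ c + enc f) = count r X x.1 (ctx r x.2 f)

theorem exists_enc_eq {c m n : ℕ} (h : n < m ^ c) : ∃ f : Fin c → Fin m, enc f = n :=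
  ⟨finFunctionFinEquiv.symm ⟨n, h⟩, by rw [enc, Equiv.apply_symm_apply]⟩

theorem lim_tableE {Z r : ℕ} {b : AState} (hr : b.var vR = r)
    (hZ : (r + 1) * (r + 1) * 2 * 2 ≤ Z) : tableE.lim Z b 0 := by
  have hn : (((v vR + 1) * (v vR + 1) * 2 * 2 : Ex).eval b 0).toNat = (r + 1) * (r + 1) * 2 * 2 := by
    simp only [eval_mul, eval_add, eval_v, eval_one, eval_two, hr]
    exact_mod_cast Int.toNat_natCast _
  simp only [tableE, introE, renameE, unionE, joinE, lim_ifeq, lim_add, lim_ifle, lim_sum, hn, loE,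
    hiE, lim_cell, labA, labB, nodeE, digE, tabE, lim_arr, lim_div, lim_mod, lim_mul, lim_sub, lim_v,
    lim_zero, lim_one, lim_two, lim_three, lim_loc, joinTermE, joinLoA, joinLoB, joinHiA, joinHiB,
    sE, sE', iE, jE, lim_emax, lim_emin, and_self, implies_true, and_true, true_and]
  exact hZ

/-- Positions are treated from the last to the first, so all entries of later nodes, and in
particular of the children, are available. This is the only loop with an exponential number of
rounds. -/
theorem exists_tri_tableFill : ∃ P : Polynomial ℕ, ∀ (Z c k r X : ℕ) (T : CWExpr c) (a : AState),
    Bdd Z a → Prepared T k r X a → 1 ≤ X → len ((T.size * (3 * r + 1) ^ c : ℕ) : ℤ) ≤ Z →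
    (r + 1) * (r + 1) * 2 * 2 ≤ Z → len ((((r + 1) * X) ^ T.size : ℕ) : ℤ) ≤ Z →
      ∃ τ, Tri Z a tableFill ((T.size * (3 * r + 1) ^ c + 1) * P.eval Z)
        ((a.setArr aT τ).setVar vI 0) ∧ TableArr T r X τ := by
  obtain ⟨P, hP⟩ := exists_tri_fill vI (v vN * v vW) aT (v vI) tableE
  refine ⟨P, fun Z c k₀ r X T a ha hp hX hZ₁ hZ₂ hZ₃ => ?_⟩
  have h := hP Z (T.size * (3 * r + 1) ^ c) a (fun k τ => ∀ i x, (nodeList T)[i]? = some x →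
    ∀ f : Fin c → Fin (3 * r + 1), k ≤ i * (3 * r + 1) ^ c + enc f →
      τ (i * (3 * r + 1) ^ c + enc f) = count r X x.1 (ctx r x.2 f)) ha (by simp)
    (by simp [hp.parsed.varN, hp.varW]) hZ₁ (fun i x hx f hi => absurd hi ?_) ?_
  · obtain ⟨τ, ht, hτ⟩ := h
    exact ⟨τ, ht, fun i x hx f => hτ i x hx f (Nat.zero_le _)⟩
  · have h1 := Nat.mul_le_mul_right ((3 * r + 1) ^ c) (Nat.succ_le_of_lt (lt_size hx))
    have h2 := enc_lt f
    rw [Nat.succ_mul] at h1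
    omega
  intro k τ hk hJ
  have hW : 0 < (3 * r + 1) ^ c := by positivity
  obtain ⟨x, hx⟩ := exists_node T (i := k / (3 * r + 1) ^ c)
    (Nat.div_lt_of_lt_mul (by rwa [mul_comm]))
  obtain ⟨f, hf⟩ := exists_enc_eq (Nat.mod_lt k hW)
  have hkc := Nat.div_add_mod' k ((3 * r + 1) ^ c)
  rw [← hf] at hkc
  have hp' := hp.fill (t := aT) (by decide) τ k
  have hst : TableState T k₀ r X (k / (3 * r + 1) ^ c) x f ((a.setArr aT τ).setVar vI k) := by
    refine ⟨hp'.parsed, hp'.varX, hp'.ends, hp'.occ, hp'.flags, hp'.pow, hp'.varD, hp'.varW, ?_, hx, ?_⟩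
    · rw [hkc]; simp
    · intro j y hy hj g
      rw [setVar_arr, setArr_arr, if_pos rfl]
      refine hJ j y hy g ?_
      have h1 := Nat.mul_le_mul_right ((3 * r + 1) ^ c) (Nat.succ_le_of_lt hj)
      have h2 := enc_lt f
      rw [Nat.succ_mul] at h1
      omega
  refine ⟨k, _, by simp, lim_tableE hp'.parsed.varR hZ₂, by simp, hst.eval_tableE, ?_, ?_⟩
  · refine (len_mono ((count_le r X hX _ _).trans (Nat.pow_le_pow_right ?_ ?_))).trans hZ₃
    · exact Nat.mul_pos (Nat.succ_pos r) hX
    · exact (card_vert_le _).trans ((Nat.le_add_left _ _).trans (size_union_lt hx))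
  · intro i y hy g hi
    by_cases h : i * (3 * r + 1) ^ c + enc g = k
    · obtain ⟨h1, h2⟩ := mul_add_inj (enc_lt g) (enc_lt f) (h.trans hkc.symm)
      subst h1
      rw [hx] at hy
      cases hy
      rw [h, Function.update_self, finFunctionFinEquiv.injective (Fin.ext h2)]
    · rw [Function.update_of_ne h]
      exact hJ i y hy g (by omega)

/-- At the root no label gets further neighbours, so the digits are irrelevant and position 0 holds
the total. -/
theorem TableArr.root {c r X : ℕ} {T : CWExpr c} {τ : ℕ → ℤ} (h : TableArr T r X τ) :
    τ 0 = count r X T (fun _ => (0, r + 1)) := by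
  obtain ⟨f, hf⟩ := exists_enc_eq (m := 3 * r + 1) (c := c) (n := 0) (by positivity)
  have h1 := h 0 _ (nodes_zero _ _) f
  rw [hf, zero_mul, zero_add] at h1
  rw [h1]
  congr 2
  funext l
  exact if_neg id

/-! ### Extracting coefficients -/

/-- Fill the array `aQ` with the quotients of the first entry of the table by powers of `vX`. -/
def quoFill : Prog :=
  fill vI (v vL + 1) aQ (v vL - v vI)
    (ifle (v vL - v vI) 0 (arr aT 0) (arr aQ (v vL - v vI - 1) / v vX))

/-- Each quotient is obtained from the one before by one more division, so powers of `X` are never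
stored. -/
theorem exists_tri_quoFill : ∃ P : Polynomial ℕ, ∀ (Z n X F : ℕ) (a : AState), Bdd Z a →
    a.var vL = n → a.var vX = X → a.arr aT 0 = F → n + 3 ≤ Z → len (F : ℤ) ≤ Z →
      ∃ τ, Tri Z a quoFill ((n + 1 + 1) * P.eval Z) ((a.setArr aQ τ).setVar vI 0) ∧
        ∀ l ≤ n, τ l = (F / X ^ l : ℕ) := by
  obtain ⟨P, hP⟩ := exists_tri_fill vI (v vL + 1) aQ (v vL - v vI)
    (ifle (v vL - v vI) 0 (arr aT 0) (arr aQ (v vL - v vI - 1) / v vX))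
  refine ⟨P, fun Z n X F a ha hL hX hF hZ hlF => ?_⟩
  have h := hP Z (n + 1) a (fun k τ => ∀ l, l + k ≤ n → τ l = (F / X ^ l : ℕ)) ha (by simp)
    (by simp [hL]) ((len_natCast_le _).trans (by omega)) (by intro l hl; omega) ?_
  · obtain ⟨τ, ht, hτ⟩ := h
    exact ⟨τ, ht, fun l hl => hτ l (by omega)⟩
  intro k τ hk hJ
  generalize hb : (a.setArr aQ τ).setVar vI k = b
  have hbI : b.var vI = k := by simp [← hb]
  have hbL : b.var vL = n := by simp [← hb, hL]
  have hbX : b.var vX = X := by simp [← hb, hX]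
  have hbQ : b.arr aQ = τ := by simp [← hb]
  have hbT : b.arr aT 0 = F := by simp [← hb, hF]
  refine ⟨n - k, (F / X ^ (n - k) : ℕ), by simp, by simp, ?_, ?_, ?_, ?_⟩
  · simp only [eval_sub, eval_v, hbI, hbL]; omega
  · simp only [eval_ifle, eval_sub, eval_v, hbI, hbL, eval_zero, eval_div, hbX]
    split_ifs with h
    · have : n - k = 0 := by omega
      rw [this, pow_zero, Nat.div_one, eval_arr (n := 0) rfl, hbT]
    · rw [eval_arr (n := n - k - 1) (by simp only [eval_sub, eval_v, hbI, hbL, eval_one]; omega), hbQ,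
        hJ (n - k - 1) (by omega)]
      obtain ⟨m, hm⟩ : ∃ m, n - k = m + 1 := ⟨n - k - 1, by omega⟩
      rw [hm, Nat.add_sub_cancel, pow_succ, ← Nat.div_div_eq_div_mul]
      push_cast
      rfl
  · exact (len_mono (Nat.div_le_self _ _)).trans hlF
  · intro l hl
    by_cases h : l = n - k
    · rw [h, Function.update_self]
    · rw [Function.update_of_ne h]
      exact hJ l (by omega)

/-- Coefficients below `X` are the base-`X` digits of the value of the polynomial at `X`. -/
theorem sum_mul_pow_div_mod (X : ℕ) (j : ℕ) : ∀ (m : ℕ) (a : ℕ → ℕ), (∀ s, a s < X) → j < m →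
    (∑ s ∈ Finset.range m, a s * X ^ s) / X ^ j % X = a j := by
  induction j with
  | zero =>
    intro m a ha hm
    obtain ⟨m, rfl⟩ := Nat.exists_eq_succ_of_ne_zero hm.ne'
    rw [Nat.succ_eq_add_one, Finset.sum_range_succ', pow_zero, Nat.div_one, mul_one]
    have : ∑ s ∈ Finset.range m, a (s + 1) * X ^ (s + 1) =
        X * ∑ s ∈ Finset.range m, a (s + 1) * X ^ s := by
      rw [Finset.mul_sum]
      exact Finset.sum_congr rfl fun s _ => by ring
    rw [this, Nat.mul_add_mod, Nat.mod_eq_of_lt (ha 0)]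
  | succ j ih =>
    intro m a ha hm
    obtain ⟨m, rfl⟩ := Nat.exists_eq_succ_of_ne_zero (Nat.ne_zero_of_lt hm)
    have : ∑ s ∈ Finset.range m, a (s + 1) * X ^ (s + 1) =
        X * ∑ s ∈ Finset.range m, a (s + 1) * X ^ s := by
      rw [Finset.mul_sum]
      exact Finset.sum_congr rfl fun s _ => by ring
    rw [Nat.succ_eq_add_one, Finset.sum_range_succ', pow_zero, mul_one, this, pow_succ', ← Nat.div_div_eq_div_mul,
      Nat.mul_add_div ((Nat.zero_le _).trans_lt (ha 0)), Nat.div_eq_of_lt (ha 0), add_zero]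
    exact ih m (fun s => a (s + 1)) (fun s => ha _) (by omega)

end RAM


namespace RAM

open Ex CWExpr

/-! ### The whole program -/

/-- Cap the radius by the number of vertices and compute the number of contexts. -/
def capRadius : Stmt :=
  .seq (.assign vR (emin (v vR) (v vL))) (.assign vD (3 * v vR + 1))

/-- Compute the number of functions from labels to contexts. -/
def setWidth : Stmt := .assign vW (arr aP (v vC))

/-- Everything between reading the input and writing the output. -/
def solve : Prog :=
  .seq capRadius.code (.seq powFill (.seq setWidth.code (.seq endFill (.seq occFill
    (.seq flagFill (.seq tableFill quoFill))))))

theorem len_le_of_le_two_pow {m n : ℕ} (h : m ≤ 2 ^ n) : len (m : ℤ) ≤ n + 2 :=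
  len_le_of_abs_lt (by
    rw [Int.natAbs_natCast, pow_succ]
    have : 0 < 2 ^ n := by positivity
    omega)

/-- The bound on the lengths of all numbers that the program stores. -/
def room (N : ℕ) : ℕ := 10 * N * N + 20 * N + 20

/-- With the radius capped by the number of vertices and at most `2N` labels, all occurring lengths
are at most quadratic in `N`, which `room` covers. The factor `X` of the polynomial pays for the
rounds of the loops; only the table loop needs the exponential factor in addition. -/
theorem exists_tri_solve : ∃ P : Polynomial ℕ, ∀ (Z N c k r : ℕ) (T : CWExpr c) (a : AState),
    Bdd Z a → Parsed T k r a → (∀ i, a.arr aH i = 0) → T.size ≤ N → c ≤ 2 * N → room N ≤ Z →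
      ∃ a', Tri Z a solve (P.eval Z * (3 * r + 1) ^ c) a' ∧ a'.out = [] ∧ a'.var vK = k ∧
        a'.var vL = Fintype.card T.Vert ∧ a'.var vX = (2 ^ (Fintype.card T.Vert + 1) : ℕ) ∧
        ∀ l ≤ Fintype.card T.Vert, a'.arr aQ l =
          (count (min r (Fintype.card T.Vert)) (2 ^ (Fintype.card T.Vert + 1)) T
            (fun _ => (0, min r (Fintype.card T.Vert) + 1)) /
              (2 ^ (Fintype.card T.Vert + 1)) ^ l : ℕ) := by
  obtain ⟨P₁, h₁⟩ := capRadius.exists_tri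
  obtain ⟨P₂, h₂⟩ := exists_tri_powFill
  obtain ⟨P₃, h₃⟩ := setWidth.exists_tri
  obtain ⟨P₄, h₄⟩ := exists_tri_endFill
  obtain ⟨P₅, h₅⟩ := exists_tri_occFill
  obtain ⟨P₆, h₆⟩ := exists_tri_flagFill
  obtain ⟨P₇, h₇⟩ := exists_tri_tableFill
  obtain ⟨P₈, h₈⟩ := exists_tri_quoFill
  refine ⟨Polynomial.X * (P₁ + P₂ + P₃ + P₄ + P₅ + P₆ + P₇ + P₈),
    fun Z N c k r T a ha hp hflags hTN hcN hZ => ?_⟩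
  have hZ0 : 20 ≤ Z := le_trans (Nat.le_add_left _ _) hZ
  unfold room at hZ
  set n := Fintype.card T.Vert with hn
  have hnT : n ≤ T.size := card_vert_le T
  have hrn : min r n ≤ n := min_le_right _ _
  have hrr : min r n ≤ r := min_le_left _ _
  have hL := hp.varL
  rw [← hn] at hL
  have hR : (emin (v vR) (v vL)).eval a 0 = (min r n : ℕ) := by
    simp only [eval_emin, eval_v, hp.varR, hL, Nat.cast_min]
  set q := min r n with hq
  set X := 2 ^ (n + 1) with hX
  set D := 3 * q + 1 with hD
  have hN2 : N < 2 ^ N := Nat.lt_two_pow_self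
  have hD2 : D ≤ 2 ^ (N + 2) := by rw [pow_add]; omega
  have hW2 : D ^ c ≤ 2 ^ ((N + 2) * (2 * N)) :=
    (Nat.pow_le_pow_left hD2 c).trans (by
      rw [← pow_mul]
      exact Nat.pow_le_pow_right (by norm_num) (Nat.mul_le_mul_left _ hcN))
  have hW1 : 1 ≤ D ^ c := Nat.one_le_pow _ _ (by omega)
  have hNW : T.size * D ^ c ≤ 2 ^ (N + (N + 2) * (2 * N)) := by
    rw [pow_add]
    exact Nat.mul_le_mul (hTN.trans hN2.le) hW2
  have hX1 : 1 ≤ X := Nat.one_le_two_pow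
  have hqX : ((q + 1) * X) ^ T.size ≤ 2 ^ ((2 * N + 1) * N) := by
    rw [pow_mul]
    refine (Nat.pow_le_pow_right (Nat.mul_pos (Nat.succ_pos _) hX1) hTN).trans
      (Nat.pow_le_pow_left ?_ N)
    rw [show 2 * N + 1 = N + (N + 1) by ring, pow_add 2 N (N + 1)]
    exact Nat.mul_le_mul (by omega) (Nat.pow_le_pow_right (by norm_num) (by omega))
  have hTc : T.size * c ≤ N * (2 * N) := Nat.mul_le_mul hTN hcN
  have hmul1 : (N + 2) * (2 * N) = 2 * (N * N) + 4 * N := by ring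
  have hmul2 : (2 * N + 1) * N = 2 * (N * N) + N := by ring
  have hmul3 : N * (2 * N) = 2 * (N * N) := by ring
  have hmul4 : 10 * N * N = 10 * (N * N) := by ring
  have hqq : (q + 1) * (q + 1) ≤ (N + 1) * (N + 1) := Nat.mul_le_mul (by omega) (by omega)
  have hmul5 : (N + 1) * (N + 1) = N * N + 2 * N + 1 := by ring
  rw [hmul4] at hZ
  rw [hmul1] at hW2 hNW
  rw [hmul2] at hqX
  rw [hmul3] at hTc
  rw [hmul5] at hqq
  -- the radius
  have hrun : capRadius.run a = (a.setVar vR q).setVar vD D := by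
    show Stmt.run _ (Stmt.run _ a) = _
    simp only [Stmt.run, hR]
    congr 1
  have t₁ := h₁ Z a ha ⟨⟨by simp, by rw [hR]; exact (len_natCast_le _).trans (by omega)⟩,
    by simp, by
      simp only [Stmt.run, hR, eval_add, eval_mul, eval_three, eval_v, setVar_var, if_true, eval_one]
      exact len_le_of_le (n := D) (by omega) (by omega)⟩
  rw [hrun] at t₁
  generalize hb₁ : (a.setVar vR q).setVar vD D = b₁ at t₁
  have hp₁ : Parsed T k q b₁ := by
    rw [← hb₁]
    refine ⟨hp.out, ?_, ?_, ?_, ?_, ?_, ?_, ?_⟩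
    · simpa using hp.varK
    · simp
    · simpa using hp.varN
    · simpa using hp.varC
    · simpa using hp.varL
    · simpa using hp.varX
    · simpa using hp.node
  have hD₁ : b₁.var vD = D := by simp [← hb₁]
  have hH₁ : ∀ i, b₁.arr aH i = 0 := by simpa [← hb₁] using hflags
  -- the powers
  have hlW : len ((D ^ c : ℕ) : ℤ) ≤ Z := (len_le_of_le_two_pow hW2).trans (by omega)
  obtain ⟨τ₂, t₂, hτ₂⟩ := h₂ Z c D b₁ t₁.bdd hp₁.varC hD₁ (by omega) (by omega) hlW
  have hp₂ := hp₁.fill (t := aP) (by decide) τ₂ 0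
  have hrun₃ : setWidth.run ((b₁.setArr aP τ₂).setVar vI 0) =
      ((b₁.setArr aP τ₂).setVar vI 0).setVar vW (D ^ c : ℕ) := by
    simp only [setWidth, Stmt.run]
    rw [eval_arr (n := c) (by simpa using hp₁.varC)]
    simp [hτ₂]
  have t₃ := h₃ Z _ t₂.bdd ⟨by simp, by
    rw [eval_arr (n := c) (by simpa using hp₁.varC)]
    simpa [hτ₂] using hlW⟩
  rw [hrun₃] at t₃
  generalize hb₃ : ((b₁.setArr aP τ₂).setVar vI 0).setVar vW (D ^ c : ℕ) = b₃ at t₃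
  have hp₃ : Parsed T k q b₃ := by
    rw [← hb₃]
    refine ⟨hp₂.out, ?_, ?_, ?_, ?_, ?_, ?_, ?_⟩
    · simpa using hp₁.varK
    · simpa using hp₁.varR
    · simpa using hp₁.varN
    · simpa using hp₁.varC
    · simpa using hp₁.varL
    · simpa using hp₁.varX
    · simpa using hp₁.node
  have hD₃ : b₃.var vD = D := by simpa [← hb₃] using hD₁
  have hW₃ : b₃.var vW = (D ^ c : ℕ) := by simp [← hb₃]
  have hH₃ : ∀ i, b₃.arr aH i = 0 := by simpa [← hb₃] using hH₁
  have hP₃ : ∀ l ≤ c, b₃.arr aP l = (D ^ l : ℕ) := by simpa [← hb₃] using hτ₂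
  -- the other arrays
  obtain ⟨τ₄, t₄, hτ₄⟩ := h₄ Z c k q T b₃ t₃.bdd hp₃ (by omega)
  have hp₄ := hp₃.fill (t := aE) (by decide) τ₄ 0
  obtain ⟨τ₅, t₅, hτ₅⟩ := h₅ Z c k q T _ t₄.bdd hp₄ (by simpa using hτ₄)
    ((len_natCast_le _).trans (by omega)) (by omega)
  have hp₅ := hp₄.fill (t := aN) (by decide) τ₅ 0
  obtain ⟨τ₆, t₆, hτ₆⟩ := h₆ Z c k q T _ t₅.bdd hp₅ (by simpa using hτ₄) (by simpa using hτ₅)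
    (by simpa using hH₃) ((len_natCast_le _).trans (by omega)) (by omega)
  have hp₆ := hp₅.fill (t := aH) (by decide) τ₆ 0
  -- the table
  obtain ⟨τ₇, t₇, hτ₇⟩ := h₇ Z c k q X T _ t₆.bdd ⟨hp₆, hp₆.varX, by simpa using hτ₄,
    by simpa using hτ₅, by simpa using hτ₆, hP₃, hD₃,
    hW₃⟩ hX1 ((len_le_of_le_two_pow hNW).trans (by omega)) (by omega)
    ((len_le_of_le_two_pow hqX).trans (by omega))
  have hp₇ := hp₆.fill (t := aT) (by decide) τ₇ 0
  obtain ⟨τ₈, t₈, hτ₈⟩ := h₈ Z n X (count q X T fun _ => (0, q + 1)) _ t₇.bdd hp₇.varL hp₇.varX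
    (by simpa using hτ₇.root) (by omega) (by
      refine (len_mono ((count_le q X hX1 _ _).trans (Nat.pow_le_pow_right ?_ hnT))).trans
        ((len_le_of_le_two_pow hqX).trans (by omega))
      exact Nat.mul_pos (Nat.succ_pos _) hX1)
  have hp₈ := hp₇.fill (t := aQ) (by decide) τ₈ 0
  refine ⟨_, (t₁.seq (t₂.seq (t₃.seq (t₄.seq (t₅.seq (t₆.seq (t₇.seq t₈))))))).mono ?_, hp₈.out,
    hp₈.varK, hp₈.varL, hp₈.varX, by simpa using hτ₈⟩
  -- Capping the radius can only lower the number of digits.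
  have hWr : D ^ c ≤ (3 * r + 1) ^ c := Nat.pow_le_pow_left (by omega) c
  refine le_trans ?_ (Nat.mul_le_mul_left _ hWr)
  simp only [Polynomial.eval_mul, Polynomial.eval_add, Polynomial.eval_X]
  have key : ∀ m p : ℕ, m ≤ Z → m * p ≤ Z * p * D ^ c := fun m p hm =>
    (Nat.mul_le_mul_right p hm).trans (Nat.le_mul_of_pos_right _ hW1)
  have k₁ := key 1 (P₁.eval Z) (by omega)
  have k₂ := key (c + 1 + 1) (P₂.eval Z) (by omega)
  have k₃ := key 1 (P₃.eval Z) (by omega)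
  have k₄ := key (T.size + 1) (P₄.eval Z) (by omega)
  have k₅ := key (T.size * c + 1) (P₅.eval Z) (by omega)
  have k₆ := key (T.size * c * 2 + 1) (P₆.eval Z) (by omega)
  have k₇ : (T.size * D ^ c + 1) * P₇.eval Z ≤ Z * P₇.eval Z * D ^ c := by
    calc (T.size * D ^ c + 1) * P₇.eval Z ≤ (T.size * D ^ c + D ^ c) * P₇.eval Z := by gcongr
      _ = (T.size + 1) * P₇.eval Z * D ^ c := by ring
      _ ≤ Z * P₇.eval Z * D ^ c := by gcongr; omega
  have k₈ := key (n + 1 + 1) (P₈.eval Z) (by omega)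
  calc _ ≤ Z * P₁.eval Z * D ^ c + (Z * P₂.eval Z * D ^ c + (Z * P₃.eval Z * D ^ c +
        (Z * P₄.eval Z * D ^ c + (Z * P₅.eval Z * D ^ c + (Z * P₆.eval Z * D ^ c +
        (Z * P₇.eval Z * D ^ c + Z * P₈.eval Z * D ^ c)))))) := by
        rw [one_mul] at k₁ k₃
        gcongr
    _ = _ := by ring

end RAM


namespace RAM

open Ex CWExpr

/-- In `inputSize` the cast acts on the list, as a bind; here it is moved inside the mapped
function. -/
theorem inputSize_eq (l : List ℕ) : inputSize l = (l.map fun n : ℕ => len (n : ℤ)).sum := by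
  have h : (l.flatMap fun n : ℕ => [(n : ℤ)]) = l.map fun n : ℕ => (n : ℤ) :=
    (List.map_eq_flatMap ..).symm
  show (List.map (fun z : ℤ => len z) (l.flatMap fun n : ℕ => [(n : ℤ)])).sum = _
  rw [h, List.map_map]
  rfl

theorem len_le_inputSize {l : List ℕ} {n : ℕ} (h : n ∈ l) : len (n : ℤ) ≤ inputSize l := by
  rw [inputSize_eq]
  exact List.le_sum_of_mem (List.mem_map.2 ⟨n, h, rfl⟩)

theorem length_le_inputSize (l : List ℕ) : l.length ≤ inputSize l := by
  rw [inputSize_eq]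
  refine le_trans (by simp) (List.length_le_sum_of_one_le (l.map fun n : ℕ => len (n : ℤ)) ?_)
  intro m hm
  obtain ⟨n, -, rfl⟩ := List.mem_map.1 hm
  exact one_le_len _

theorem size_le_length_encode {cw : ℕ} (T : CWExpr cw) : T.size ≤ T.encode.length := by
  induction T with
  | intro l => simp [size, preorder, encode]
  | join a b e ih => simp [size, preorder, encode] at ih ⊢; omega
  | rename a b e ih => simp [size, preorder, encode] at ih ⊢; omega
  | union e₁ e₂ h₁ h₂ => simp [size, preorder, encode] at h₁ h₂ ⊢; omega

theorem size_le_inputSize {cw : ℕ} (k r : ℕ) (T : CWExpr cw) :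
    T.size ≤ inputSize (centerInput k r T) := by
  refine le_trans ?_ (length_le_inputSize _)
  refine (size_le_length_encode T).trans ?_
  simp only [centerInput, List.length_cons]
  omega

theorem len_le_room {l : List ℕ} {z : ℤ} (h : z ∈ l.map fun n : ℕ => (n : ℤ)) :
    len z ≤ room (inputSize l) := by
  obtain ⟨n, hn, rfl⟩ := List.mem_map.1 h
  have := len_le_inputSize hn
  unfold room
  omega

/-- The program that writes the value of `o` at the end. -/
def program (o : Ex) : Prog := .seq parse (.seq solve (Stmt.write o).code)

/-- Both versions of the problem differ only in the final expression, which adds up the digits with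
exponents selected by `p`. -/
theorem exists_polynomial_program (o : Ex) (p : ℕ → ℕ → Prop) [DecidableRel p]
    (ho : ∀ (Z k n X : ℕ) (a : AState), a.var vK = k → a.var vL = n → a.var vX = X → n + 1 ≤ Z →
      o.lim Z a 0 ∧ o.eval a 0 = ∑ j ∈ Finset.range (n + 1), if p j k then a.arr aQ j % X else 0) :
    ∃ P : Polynomial ℕ, ∀ (cw k r : ℕ) (T : CWExpr cw),
      (program o).OutputsWithin (centerInput k r T)
        [∑ s ∈ Finset.range (Fintype.card T.Vert + 1),
          if p s k then numExactCenters T.graph s r else 0]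
        (P.eval (inputSize (centerInput k r T)) * (3 * r + 1) ^ cw) := by
  obtain ⟨P₁, h₁⟩ := exists_tri_parse
  obtain ⟨P₂, h₂⟩ := exists_tri_solve
  obtain ⟨P₃, h₃⟩ := (Stmt.write o).exists_tri
  -- The inner polynomial is `room`, so costs in terms of `Z` become costs in terms of the input
  -- size.
  refine ⟨(P₁ + P₂ + P₃).comp (10 * Polynomial.X * Polynomial.X + 20 * Polynomial.X + 20),
    fun cw k r T => ?_⟩
  set S := inputSize (centerInput k r T) with hS
  set Z := room S with hZ
  have hsize := size_le_inputSize k r T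
  rw [← hS] at hsize
  have hZ' : 10 * (S * S) + 20 * S + 20 = Z := by rw [hZ, room]; ring
  obtain ⟨c, T', ψ, a₁, hψ, hc, hmap, hp, hflags, t₁⟩ := h₁ Z k r cw T
    (bdd_init (by omega) fun z hz => len_le_room hz) (by omega)
  obtain ⟨f⟩ := nonempty_map_iso ψ hψ T'
  rw [hmap] at f
  have hcard : Fintype.card T'.Vert = Fintype.card T.Vert := Fintype.card_congr f.toEquiv
  have hT' : T'.size = T.size := by
    rw [← hmap, size, size, preorder_map, List.length_map]
  obtain ⟨a₂, t₂, hout, hK, hL, hX, hQ⟩ := h₂ Z S c k r T' a₁ t₁.bdd hp hflags (by omega) (by omega)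
    le_rfl
  have hn := (card_vert_le T').trans (hT'.le.trans hsize)
  set n := Fintype.card T'.Vert with hn'
  obtain ⟨hlim, heval⟩ := ho Z k n _ a₂ hK hL hX (by omega)
  have t₃ := h₃ Z a₂ t₂.bdd hlim
  have hval : o.eval a₂ 0 = (∑ s ∈ Finset.range (Fintype.card T.Vert + 1),
      if p s k then numExactCenters T.graph s r else 0 : ℕ) := by
    rw [heval, ← hcard, Nat.cast_sum]
    refine Finset.sum_congr rfl fun s hs => ?_
    have hsn := Finset.mem_range.1 hs
    split_ifs
    -- Digit `s` counts the centers of size `s` for the relabelled expression and the capped radius;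
    -- the cap and the relabelling are then undone.
    · rw [hQ s (by omega), count_eq_sum, ← Int.natCast_emod, sum_mul_pow_div_mod _ s (n + 1)
        (fun s => numExactCenters T'.graph s (min r n)) (fun s => numExactCenters_lt _ _ _) hsn,
        numExactCenters_min_card, numExactCenters_iso f]
    · rfl
  obtain ⟨t, s, hr, ht, hs⟩ := (t₁.seq (t₂.seq t₃)).runs _ (sim_init _)
  refine ⟨t, s, hr, ht.trans ?_, ?_⟩
  · have hcw : c ≤ cw := by simpa using Fintype.card_le_of_injective ψ hψ
    have hpow : (3 * r + 1) ^ c ≤ (3 * r + 1) ^ cw := Nat.pow_le_pow_right (by omega) hcw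
    have hpos : 1 ≤ (3 * r + 1) ^ cw := Nat.one_le_pow _ _ (by omega)
    have hev : (10 * Polynomial.X * Polynomial.X + 20 * Polynomial.X + 20 : Polynomial ℕ).eval S =
        Z := by
      rw [hZ, room]
      simp
    rw [Polynomial.eval_comp, hev, Polynomial.eval_add, Polynomial.eval_add, add_mul, add_mul,
      add_assoc]
    gcongr
    · exact Nat.le_mul_of_pos_right _ hpos
    · exact Nat.le_mul_of_pos_right _ hpos
  · rw [hs.out]
    simp only [Stmt.run, hout, hval]
    simp

/-- The sum of the coefficients with exponent at most `vK`. -/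
def atMostE : Ex := sum (v vL + 1) (ifle loc (v vK) (mod (arr aQ loc) (v vX)) 0)

/-- The coefficient with exponent `vK`. -/
def exactlyE : Ex := sum (v vL + 1) (ifeq loc (v vK) (mod (arr aQ loc) (v vX)) 0)

theorem lim_eval_atMostE (Z k n X : ℕ) (a : AState) (hK : a.var vK = k) (hL : a.var vL = n)
    (hX : a.var vX = X) (hn : n + 1 ≤ Z) : atMostE.lim Z a 0 ∧ atMostE.eval a 0 =
      ∑ j ∈ Finset.range (n + 1), if j ≤ k then a.arr aQ j % X else 0 := by
  have hn' : ((v vL + 1 : Ex).eval a 0).toNat = n + 1 := by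
    simp only [eval_add, eval_v, hL, eval_one]; omega
  refine ⟨by simp only [atMostE, lim_sum, hn']; simp [hn], ?_⟩
  rw [atMostE, eval_sum, hn']
  refine Finset.sum_congr rfl fun j _ => ?_
  simp only [eval_ifle, eval_loc, eval_v, hK, Nat.cast_le, eval_mod, hX, eval_zero]
  rw [eval_arr (n := j) rfl]

theorem lim_eval_exactlyE (Z k n X : ℕ) (a : AState) (hK : a.var vK = k) (hL : a.var vL = n)
    (hX : a.var vX = X) (hn : n + 1 ≤ Z) : exactlyE.lim Z a 0 ∧ exactlyE.eval a 0 =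
      ∑ j ∈ Finset.range (n + 1), if j = k then a.arr aQ j % X else 0 := by
  have hn' : ((v vL + 1 : Ex).eval a 0).toNat = n + 1 := by
    simp only [eval_add, eval_v, hL, eval_one]; omega
  refine ⟨by simp only [exactlyE, lim_sum, hn']; simp [hn], ?_⟩
  rw [exactlyE, eval_sum, hn']
  refine Finset.sum_congr rfl fun j _ => ?_
  simp only [eval_ifeq, eval_loc, eval_v, hK, Nat.cast_inj, eval_mod, hX, eval_zero]
  rw [eval_arr (n := j) rfl]

end RAM

/-- Brings the exact version into the form of a sum over all sizes; a size above the number of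
vertices contributes nothing on either side. -/
theorem numExactCenters_eq_sum {V : Type*} [Fintype V] (G : SimpleGraph V) (k r : ℕ) :
    numExactCenters G k r = ∑ s ∈ Finset.range (Fintype.card V + 1),
      if s = k then numExactCenters G s r else 0 := by
  rw [Finset.sum_ite_eq']
  split_ifs with hk
  · rfl
  · exact numExactCenters_eq_zero _ _ _ (by simpa using hk)

theorem mainTheorem3 :
    (∃ (prog : RAM.Prog) (P : Polynomial ℕ),
      ∀ (V : Type*) (G : SimpleGraph V) (k r cw : ℕ) (T : CWExpr cw),
        1 ≤ k → 1 ≤ r → T.IsExprFor G →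
        prog.OutputsWithin (centerInput k r T) [numCenters G k r]
          (P.eval (RAM.inputSize (centerInput k r T)) * (3 * r + 1) ^ cw)) ∧
    (∃ (prog : RAM.Prog) (P : Polynomial ℕ),
      ∀ (V : Type*) (G : SimpleGraph V) (k r cw : ℕ) (T : CWExpr cw),
        1 ≤ k → 1 ≤ r → T.IsExprFor G →
        prog.OutputsWithin (centerInput k r T) [numExactCenters G k r]
          (P.eval (RAM.inputSize (centerInput k r T)) * (3 * r + 1) ^ cw)) := by
  constructor
  · obtain ⟨P, hP⟩ :=
      RAM.exists_polynomial_program RAM.atMostE (fun s k => s ≤ k) RAM.lim_eval_atMostE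
    refine ⟨RAM.program RAM.atMostE, P, fun V G k r cw T _ _ hf => ?_⟩
    obtain ⟨f⟩ := hf
    rw [← numCenters_iso f, numCenters_eq_sum]
    exact hP cw k r T
  · obtain ⟨P, hP⟩ :=
      RAM.exists_polynomial_program RAM.exactlyE (fun s k => s = k) RAM.lim_eval_exactlyE
    refine ⟨RAM.program RAM.exactlyE, P, fun V G k r cw T _ _ hf => ?_⟩
    obtain ⟨f⟩ := hf
    rw [← numExactCenters_iso f, numExactCenters_eq_sum]
    exact hP cw k r T
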